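/- The search problem König is PPP-complete (under polynomial-time reductions between total search problems). Here Collision is the following problem: given a Boolean circuit $C:\{0,1\}^n\to\{0,1\}^n$, find $x$ with $C(x)=0^n$, or $x\neq y$ with $C(x)=C(y)$. PPP is the class of problems in TFNP that are reducible in polynomial time to Collision. A problem is PPP-complete if it is in PPP and every problem in PPP is reducible to it in polynomial time. An instance of König is a node $r\in\{0,1\}^n$ (the root) and a Boolean circuit $P:\{0,1\}^n\to\{0,1\}^n\times\{0,1\}$. The circuit maps a node $x$ to its parent $p(x)$ and to a bit that says whether $x$ is the left ($0$) or the right ($1$) child of its parent; a node with $p(x)=x$ is called a root and is not a child of itself. The problem is to find one of the following: 1. Invalid root: the node $r$, if $p(r)\neq r$. 2. Non-unique root: a node $x\neq r$ with $p(x)=x$. 3. Far away node: a node $x$ with $p^{k}(x)\neq r$ for all $0\le k\le n$. 4. Long path: a node $x$ with $p^{n}(x)=r$ and $p^{k}(x)\neq r$ for all $0\le k<n$, that is, a node whose path to the root has length $n$. 5. Identical children: nodes $x\neq y$, neither of them its own parent, with $P(x)=P(y)$, that is, two left children or two right children of the same node. -/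

import Mathlib

namespace KonigPPP

/-! ### Polynomial time, search problems, reductions -/

/-- A search problem: a binary relation between binary strings (instances) and
binary strings (solutions). -/
abbrev SearchProblem : Type := List Bool → List Bool → Prop

/-- The pair `(x, y)` written on the tape as `x # y`, with the marker `# = none`. -/
def pairEnc (p : List Bool × List Bool) : List (Option Bool) :=
  p.1.map some ++ none :: p.2.map some

/-- `f : {0,1}* → {0,1}*` is computed by a Turing machine in polynomial time. -/
def PolyTime (f : List Bool → List Bool) : Prop :=
  Nonempty (Turing.TM2ComputableInPolyTime (id : List Bool → List Bool)
    (id : List Bool → List Bool) f)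

/-- `g : {0,1}* × {0,1}* → {0,1}*` is computed by a Turing machine in polynomial time. -/
def PolyTime₂ (g : List Bool × List Bool → List Bool) : Prop :=
  Nonempty (Turing.TM2ComputableInPolyTime pairEnc (id : List Bool → List Bool) g)

/-- `R` belongs to TFNP: solutions have polynomially bounded length, the relation is decidable in
polynomial time, and every instance has a solution. -/
def InTFNP (R : SearchProblem) : Prop :=
  (∃ p : Polynomial ℕ, ∀ x y, R x y → y.length ≤ p.eval x.length) ∧
  (∃ d : List Bool × List Bool → Bool,
    PolyTime₂ (fun p => [d p]) ∧ ∀ x y, d (x, y) = true ↔ R x y) ∧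
  (∀ x, ∃ y, R x y)

/-- `R` is reducible to `S` in polynomial time: `f` maps instances of `R` to instances of `S`,
and `g` recovers a solution of `x` from any solution of `f x`. -/
def Reducible (R S : SearchProblem) : Prop :=
  ∃ (f : List Bool → List Bool) (g : List Bool × List Bool → List Bool),
    PolyTime f ∧ PolyTime₂ g ∧ ∀ x y, S (f x) y → R x (g (x, y))

/-- The search problem on strings that belongs to a family of instances `ι` with the encoding
`enc`; a string that encodes no instance has the empty string as its only solution. -/
def ofEncoding {ι : Type} (enc : ι → List Bool) (sol : ι → List Bool → Prop) : SearchProblem :=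
  fun x y => (∃ i, enc i = x ∧ sol i y) ∨ ((¬ ∃ i, enc i = x) ∧ y = [])

/-! ### Boolean circuits -/

/-- A gate of fan-in two over the full binary basis: an arbitrary Boolean function `op` of two
arguments, and the wires `left`, `right` that it reads. -/
structure Gate where
  op : Bool → Bool → Bool
  left : ℕ
  right : ℕ

/-- A Boolean circuit. Wires `0, …, numInputs - 1` are the inputs, the `k`-th gate defines wire
`numInputs + k`, and `outputs` lists the output wires. -/
structure Circuit where
  numInputs : ℕ
  gates : List Gate
  outputs : List ℕ

/-- The value of wire `i`; a wire that has not been defined carries the constant `0`. -/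
def wire (vs : List Bool) (i : ℕ) : Bool := vs.getD i false

/-- The values of all wires on input `x`, in order. -/
def Circuit.wires (C : Circuit) (x : List Bool) : List Bool :=
  C.gates.foldl (fun vs g => vs ++ [g.op (wire vs g.left) (wire vs g.right)]) x

/-- The output of the circuit on the input `x` (a string of length `numInputs`). -/
def Circuit.eval (C : Circuit) (x : List Bool) : List Bool :=
  C.outputs.map (wire (C.wires x))

/-- Unary, self-delimiting code of a natural number. Wire numbers are at most the size of the
circuit, so this is polynomially related to binary. -/
def encNat (k : ℕ) : List Bool := List.replicate k true ++ [false]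

/-- Self-delimiting code of a list whose elements have self-delimiting codes. -/
def encList {α : Type} (e : α → List Bool) (l : List α) : List Bool :=
  l.flatMap (fun a => true :: e a) ++ [false]

def encGate (g : Gate) : List Bool :=
  [g.op false false, g.op false true, g.op true false, g.op true true] ++
    (encNat g.left ++ encNat g.right)

def Circuit.enc (C : Circuit) : List Bool :=
  encNat C.numInputs ++ (encList encGate C.gates ++ encList encNat C.outputs)

/-! ### Collision and the class PPP -/

/-- An instance of Collision: a circuit `C : {0,1}ⁿ → {0,1}ⁿ`. -/
structure CollisionInstance where
  C : Circuit
  hC : C.outputs.length = C.numInputs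

/-- A solution is a string that `C` maps to `0ⁿ`, or two distinct strings with the same image. -/
def CollisionInstance.IsSolution (I : CollisionInstance) (s : List Bool) : Prop :=
  (∃ a : List Bool, a.length = I.C.numInputs ∧ s = false :: a ∧
    I.C.eval a = List.replicate I.C.numInputs false) ∨
  (∃ a b : List Bool, a.length = I.C.numInputs ∧ b.length = I.C.numInputs ∧
    s = true :: (a ++ b) ∧ a ≠ b ∧ I.C.eval a = I.C.eval b)

def collision : SearchProblem :=
  ofEncoding (fun I : CollisionInstance => I.C.enc) CollisionInstance.IsSolution

/-- PPP: the problems in TFNP that are reducible to Collision in polynomial time. -/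
def InPPP (R : SearchProblem) : Prop := InTFNP R ∧ Reducible R collision

/-- PPP-hard: every problem in PPP is reducible to `R` in polynomial time. -/
def PPPHard (R : SearchProblem) : Prop := ∀ S : SearchProblem, InPPP S → Reducible S R

/-- PPP-complete: in PPP and PPP-hard. -/
def PPPComplete (R : SearchProblem) : Prop := InPPP R ∧ PPPHard R

/-! ### The König problem -/

/-- An instance of König: a circuit `P : {0,1}ⁿ → {0,1}ⁿ × {0,1}` and a root `r ∈ {0,1}ⁿ`. -/
structure KonigInstance where
  P : Circuit
  root : List Bool
  hP : P.outputs.length = P.numInputs + 1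
  hroot : root.length = P.numInputs

namespace KonigInstance

variable (I : KonigInstance)

/-- The number of bits of a node. -/
def n : ℕ := I.P.numInputs

/-- The parent of a node: the first `n` output bits. -/
def parent (x : List Bool) : List Bool := (I.P.eval x).take I.n

/-- Which child of its parent a node is: the last output bit (`false`: left, `true`: right). -/
def side (x : List Bool) : Bool := (I.P.eval x).getD I.n false

/-- The designated root is not its own parent. -/
def InvalidRoot (x : List Bool) : Prop := x = I.root ∧ I.parent x ≠ x

/-- A node other than the designated root is a root (its own parent). -/
def NonUniqueRoot (x : List Bool) : Prop := x ≠ I.root ∧ I.parent x = x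

/-- The root is not reached from `x` within `n` steps to the parent. -/
def FarAway (x : List Bool) : Prop := ∀ k ≤ I.n, I.parent^[k] x ≠ I.root

/-- The path from `x` to the root has length exactly `n`. -/
def LongPath (x : List Bool) : Prop :=
  I.parent^[I.n] x = I.root ∧ ∀ k < I.n, I.parent^[k] x ≠ I.root

/-- `x` and `y` are two distinct left children, or two distinct right children, of one node.
A node that is its own parent is a root and does not count as a child. -/
def IdenticalChildren (x y : List Bool) : Prop :=
  x ≠ y ∧ I.parent x ≠ x ∧ I.parent y ≠ y ∧ I.parent x = I.parent y ∧ I.side x = I.side y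

def IsSolution (s : List Bool) : Prop :=
  (∃ x : List Bool, x.length = I.n ∧ s = false :: x ∧
    (I.InvalidRoot x ∨ I.NonUniqueRoot x ∨ I.FarAway x ∨ I.LongPath x)) ∨
  (∃ x y : List Bool, x.length = I.n ∧ y.length = I.n ∧ s = true :: (x ++ y) ∧
    I.IdenticalChildren x y)

end KonigInstance

def konig : SearchProblem :=
  ofEncoding (fun I : KonigInstance => I.P.enc ++ I.root) KonigInstance.IsSolution

end KonigPPP

/-! König reduces to Collision by an address map. Let a node x first meet r after d < n steps. Its
address is the string of the sides of x, p(x), ..., p^(d-1)(x), followed by 1 and then by zeros up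
to length n. A node that does not meet r in fewer than n steps gets the address 0ⁿ. So an argument
mapped to 0ⁿ is a far away node or the start of a long path. If a ≠ b share a nonzero address, the
last 1 shows that their depths agree, and the earlier bits show that their sides agree all the way
up. At the step before their paths first merge, the two ancestors are identical children. The
address is computed by n rounds of the circuit P with a flag recording whether r has been met
(`eval_addressCircuit`, `identicalChildren_of_address_eq`). Collision is total by the pigeonhole
principle, and the reduction carries totality over to König.

Collision reduces to König by a heap. The nodes are the strings of length n+1, the root is 0ⁿ1, and
the parent of an inner node is obtained by prepending 0 and dropping the last bit, which is the
side. The leaves are the strings 1c. The leaf 1c is hung at the position of the leaf 1C(c), and the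
spare string 0ⁿ⁺¹ at that of 10ⁿ. Every node reaches the root in at most n steps, which is fewer
than its n+1 bits, and the root is the only fixed point. Hence every solution is a pair of identical
children, that is, two nodes at one position: either two leaves 1a, 1b with C(a) = C(b), or a leaf
1a and 0ⁿ⁺¹ with C(a) = 0ⁿ (`eval_treeCircuit`, `collisionSolution_spec`). Hardness then follows
from transitivity of reductions.

The rest shows that these maps are polynomial-time in the sense of `TM2ComputableInPolyTime`.
Machines are combined on a joint set of stacks to obtain composition, concatenation and iteration;
finite-state transducers supply the elementary operations. From these come folds with polynomially
bounded accumulators (`PolyFun.foldl`), and from folds all list and circuit operations, including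
the parser for encoded circuits. `polyTime_iff` and `polyTime₂_iff` return to the notions of the
statement. -/

namespace KonigPPP

open Turing Function

/-! ### Programs for stack machines -/

section Programs

variable {K : Type} [DecidableEq K] {Γ : K → Type} {σ : Type}

/-- `n` steps of the program `m` lead from `c` to `c'`. -/
def Runs {Λ : Type} (m : Λ → TM2.Stmt Γ Λ σ) (n : ℕ) (c c' : TM2.Cfg Γ Λ σ) : Prop :=
  (flip bind (TM2.step m))^[n] (some c) = some c'

theorem Runs.refl {Λ : Type} (m : Λ → TM2.Stmt Γ Λ σ) (c : TM2.Cfg Γ Λ σ) : Runs m 0 c c := rfl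

theorem Runs.trans {Λ : Type} {m : Λ → TM2.Stmt Γ Λ σ} {n n' : ℕ} {c c' c'' : TM2.Cfg Γ Λ σ}
    (h : Runs m n c c') (h' : Runs m n' c' c'') : Runs m (n' + n) c c'' := by
  unfold Runs at *
  rw [iterate_add_apply, h, h']

theorem Runs.single {Λ : Type} {m : Λ → TM2.Stmt Γ Λ σ} (l : Λ) (v : σ) (S : ∀ k, List (Γ k)) :
    Runs m 1 ⟨some l, v, S⟩ (TM2.stepAux (m l) v S) := rfl

theorem iterate_bind_none {α : Type} (f : α → Option α) (n : ℕ) :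
    (flip bind f)^[n] (none : Option α) = none := by
  induction n with
  | zero => rfl
  | succ n ih => rw [iterate_succ_apply]; exact ih

theorem runs_succ_iff {Λ : Type} {m : Λ → TM2.Stmt Γ Λ σ} {n : ℕ} {c c'' : TM2.Cfg Γ Λ σ} :
    Runs m (n + 1) c c'' ↔ ∃ c', TM2.step m c = some c' ∧ Runs m n c' c'' := by
  unfold Runs
  rw [iterate_succ_apply]
  change (flip bind (TM2.step m))^[n] (TM2.step m c) = some c'' ↔ _
  cases h : TM2.step m c with
  | none =>
    rw [iterate_bind_none]
    simp
  | some c' => simp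

/-- An embedding of stacks and internal states into those of a larger machine. -/
structure Emb {K₁ : Type} (Γ₁ : K₁ → Type) (σ₁ : Type) (Γ : K → Type) (σ : Type) where
  k : K₁ → K
  toBig : ∀ i, Γ₁ i → Γ (k i)
  ofBig : ∀ i, Γ (k i) → Γ₁ i
  get : σ → σ₁
  set : σ₁ → σ → σ

/-- The configurations `v, S` of the small machine appear as `sv v, sS S` in the large one. -/
structure Emb.Compat {K₁ : Type} [DecidableEq K₁] {Γ₁ : K₁ → Type} {σ₁ : Type}
    (E : Emb Γ₁ σ₁ Γ σ) (sv : σ₁ → σ) (sS : (∀ i, List (Γ₁ i)) → ∀ k, List (Γ k)) : Prop where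
  ofBig_toBig : ∀ i x, E.ofBig i (E.toBig i x) = x
  get_sv : ∀ v, E.get (sv v) = v
  set_sv : ∀ v w, E.set w (sv v) = sv w
  stack : ∀ S i, sS S (E.k i) = (S i).map (E.toBig i)
  update : ∀ S i l, sS (Function.update S i l) = Function.update (sS S) (E.k i) (l.map (E.toBig i))

/-- Translation of a statement along an embedding; labels are renamed by `φ`, and halting becomes
a jump to `ex` (or stays halting for `ex = none`). -/
def trStmt {K₁ : Type} {Γ₁ : K₁ → Type} {σ₁ Λ₁ Λ : Type} (E : Emb Γ₁ σ₁ Γ σ) (φ : Λ₁ → Λ)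
    (ex : Option Λ) : TM2.Stmt Γ₁ Λ₁ σ₁ → TM2.Stmt Γ Λ σ
  | .push i f q => .push (E.k i) (fun v => E.toBig i (f (E.get v))) (trStmt E φ ex q)
  | .peek i f q =>
      .peek (E.k i) (fun v o => E.set (f (E.get v) (o.map (E.ofBig i))) v) (trStmt E φ ex q)
  | .pop i f q =>
      .pop (E.k i) (fun v o => E.set (f (E.get v) (o.map (E.ofBig i))) v) (trStmt E φ ex q)
  | .load f q => .load (fun v => E.set (f (E.get v)) v) (trStmt E φ ex q)
  | .branch f q₁ q₂ => .branch (fun v => f (E.get v)) (trStmt E φ ex q₁) (trStmt E φ ex q₂)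
  | .goto f => .goto (fun v => φ (f (E.get v)))
  | .halt => match ex with
    | none => .halt
    | some l => .goto (fun _ => l)

/-- The image of a configuration under an embedding. -/
def trCfg {K₁ : Type} {Γ₁ : K₁ → Type} {σ₁ Λ₁ Λ : Type} (φ : Λ₁ → Λ)
    (ex : Option Λ) (sv : σ₁ → σ) (sS : (∀ i, List (Γ₁ i)) → ∀ k, List (Γ k))
    (c : TM2.Cfg Γ₁ Λ₁ σ₁) : TM2.Cfg Γ Λ σ :=
  ⟨c.l.elim ex (fun l => some (φ l)), sv c.var, sS c.stk⟩

/-- Each instruction reads and writes only the embedded part of the state and stacks. The jump that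
replaces halting also ends the statement, so one step is simulated by exactly one step. -/
theorem stepAux_trStmt {K₁ : Type} [DecidableEq K₁] {Γ₁ : K₁ → Type} {σ₁ Λ₁ Λ : Type}
    {E : Emb Γ₁ σ₁ Γ σ} (φ : Λ₁ → Λ) (ex : Option Λ) {sv : σ₁ → σ}
    {sS : (∀ i, List (Γ₁ i)) → ∀ k, List (Γ k)} (hE : E.Compat sv sS)
    (q : TM2.Stmt Γ₁ Λ₁ σ₁) (v : σ₁) (S : ∀ i, List (Γ₁ i)) :
    TM2.stepAux (trStmt E φ ex q) (sv v) (sS S) = trCfg φ ex sv sS (TM2.stepAux q v S) := by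
  have hhead : ∀ S i, (sS S (E.k i)).head?.map (E.ofBig i) = (S i).head? := by
    intro S i
    rw [hE.stack, List.head?_map, Option.map_map]
    have : E.ofBig i ∘ E.toBig i = id := funext (hE.ofBig_toBig i)
    rw [this, Option.map_id_fun, id]
  induction q generalizing v S with
  | push i f q ih =>
    simp only [trStmt, TM2.stepAux]
    rw [← ih, hE.update, hE.get_sv, hE.stack]; rfl
  | peek i f q ih =>
    simp only [trStmt, TM2.stepAux]
    rw [← ih, hE.set_sv, hE.get_sv, hhead]
  | pop i f q ih =>
    simp only [trStmt, TM2.stepAux]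
    rw [← ih, hE.set_sv, hE.get_sv, hhead, hE.update, hE.stack, List.map_tail]
  | load f q ih =>
    simp only [trStmt, TM2.stepAux]
    rw [← ih, hE.set_sv, hE.get_sv]
  | branch f q₁ q₂ ih₁ ih₂ =>
    simp only [trStmt, TM2.stepAux, hE.get_sv]
    cases f v
    · exact ih₂ v S
    · exact ih₁ v S
  | goto f => simp [trStmt, TM2.stepAux, trCfg, hE.get_sv]
  | halt => cases ex <;> simp [trStmt, TM2.stepAux, trCfg]

/-- The simulation has no overhead, so time bounds carry over unchanged. A halted target
configuration is mapped to one at the label `ex`, where the next program can start. -/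
theorem Runs.tr {K₁ : Type} [DecidableEq K₁] {Γ₁ : K₁ → Type} {σ₁ Λ₁ Λ : Type}
    {E : Emb Γ₁ σ₁ Γ σ} {φ : Λ₁ → Λ} {ex : Option Λ} {sv : σ₁ → σ}
    {sS : (∀ i, List (Γ₁ i)) → ∀ k, List (Γ k)} (hE : E.Compat sv sS)
    {m : Λ₁ → TM2.Stmt Γ₁ Λ₁ σ₁} {M : Λ → TM2.Stmt Γ Λ σ}
    (hM : ∀ l, M (φ l) = trStmt E φ ex (m l)) {n : ℕ} {c c' : TM2.Cfg Γ₁ Λ₁ σ₁}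
    (h : Runs m n c c') : Runs M n (trCfg φ ex sv sS c) (trCfg φ ex sv sS c') := by
  induction n generalizing c with
  | zero =>
    obtain rfl : c = c' := Option.some.inj h
    rfl
  | succ n ih =>
    obtain ⟨c₁, hc, hr⟩ := runs_succ_iff.1 h
    refine runs_succ_iff.2 ⟨_, ?_, ih hr⟩
    obtain ⟨l, v, S⟩ := c
    cases l with
    | none => simp [TM2.step] at hc
    | some l =>
      simp only [TM2.step, Option.some.injEq] at hc
      subst hc
      rw [← stepAux_trStmt φ ex hE, ← hM]
      rfl

/-- The embedding of a machine into itself. -/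
def Emb.refl (Γ : K → Type) (σ : Type) : Emb Γ σ Γ σ := ⟨id, fun _ => id, fun _ => id, id, fun w _ => w⟩

theorem Emb.compat_refl : (Emb.refl Γ σ).Compat id id := by
  constructor <;> simp [Emb.refl]

/-- A program with an entry label; it ends by halting. -/
structure Prog (Γ : K → Type) (σ : Type) where
  Λ : Type
  fin : Fintype Λ
  entry : Λ
  m : Λ → TM2.Stmt Γ Λ σ

/-- The program leads from `(v, S)` to `(v', S')` in at most `t` steps. -/
def Prog.Run (F : Prog Γ σ) (t : ℕ) (v : σ) (S : ∀ k, List (Γ k)) (v' : σ)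
    (S' : ∀ k, List (Γ k)) : Prop :=
  ∃ n ≤ t, Runs F.m n ⟨some F.entry, v, S⟩ ⟨none, v', S'⟩

/-- Sequential composition. -/
def Prog.seq (F G : Prog Γ σ) : Prog Γ σ where
  Λ := F.Λ ⊕ G.Λ
  fin := letI := F.fin; letI := G.fin; inferInstance
  entry := .inl F.entry
  m := Sum.elim (fun l => trStmt (Emb.refl Γ σ) .inl (some (.inr G.entry)) (F.m l))
    (fun l => trStmt (Emb.refl Γ σ) .inr none (G.m l))

theorem Prog.Run.seq {F G : Prog Γ σ} {t t' : ℕ} {v v' v'' : σ} {S S' S'' : ∀ k, List (Γ k)}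
    (h : F.Run t v S v' S') (h' : G.Run t' v' S' v'' S'') :
    (F.seq G).Run (t + t') v S v'' S'' := by
  obtain ⟨n, hn, h⟩ := h
  obtain ⟨n', hn', h'⟩ := h'
  refine ⟨n' + n, by omega, ?_⟩
  have e := Runs.tr (M := (F.seq G).m) (φ := .inl) (ex := some (.inr G.entry)) Emb.compat_refl
    (sv := id) (sS := id) (fun l => rfl) h
  have e' := Runs.tr (M := (F.seq G).m) (φ := .inr) (ex := none) Emb.compat_refl
    (fun l => rfl) h'
  exact e.trans e'

/-- Run a machine inside a larger one. -/
def Prog.call {K₁ : Type} {Γ₁ : K₁ → Type} {σ₁ : Type}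
    (E : Emb Γ₁ σ₁ Γ σ) (F : Prog Γ₁ σ₁) : Prog Γ σ where
  Λ := F.Λ
  fin := F.fin
  entry := F.entry
  m l := trStmt E id none (F.m l)

theorem Prog.Run.call {K₁ : Type} [DecidableEq K₁] {Γ₁ : K₁ → Type} {σ₁ : Type}
    {E : Emb Γ₁ σ₁ Γ σ} {sv : σ₁ → σ}
    {sS : (∀ i, List (Γ₁ i)) → ∀ k, List (Γ k)} (hE : E.Compat sv sS) {F : Prog Γ₁ σ₁} {t : ℕ}
    {v v' : σ₁} {S S' : ∀ i, List (Γ₁ i)} (h : F.Run t v S v' S') :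
    (Prog.call E F).Run t (sv v) (sS S) (sv v') (sS S') := by
  obtain ⟨n, hn, h⟩ := h
  exact ⟨n, hn, Runs.tr (M := (Prog.call E F).m) (φ := id) (ex := none) hE (fun l => rfl) h⟩

theorem Prog.Run.mono {F : Prog Γ σ} {t t' : ℕ} {v v' : σ} {S S' : ∀ k, List (Γ k)}
    (h : F.Run t v S v' S') (ht : t ≤ t') : F.Run t' v S v' S' := by
  obtain ⟨n, hn, h⟩ := h
  exact ⟨n, hn.trans ht, h⟩

end Programs

/-! ### Programs with a register for one symbol -/

section Register

variable {K : Type} [DecidableEq K] {Γ : K → Type} {σ : Type} {T : Type}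

/-- Move the content of stack `a` to the stacks `b` and, if `dup` is set, `c`, reversing it. -/
def Prog.move2 [Inhabited T] (σ : Type) (a b c : K) (dup : Bool) (f : Γ a → T) (g : T → Γ b) (h : T → Γ c) :
    Prog Γ (Option T × σ) where
  Λ := Unit
  fin := inferInstance
  entry := ()
  m _ := .pop a (fun v o => (o.map f, v.2)) <|
    .branch (fun v => v.1.isSome)
      (.push b (fun v => g (v.1.getD default)) <|
        .branch (fun _ => dup)
          (.push c (fun v => h (v.1.getD default)) (.goto fun _ => ()))
          (.goto fun _ => ()))
      .halt

/-- The additional step is the pop that finds the stack empty. It also resets the register to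
`none`, so that the program ends in a state from which the next one can start. -/
theorem Prog.run_move [Inhabited T] {a b : K} (hab : a ≠ b) (f : Γ a → T) (g : T → Γ b) (x : Option T)
    (v : σ) (S : ∀ k, List (Γ k)) :
    (Prog.move2 σ a b b false f g g).Run ((S a).length + 1) (x, v) S (none, v)
      (update (update S a []) b (((S a).map (g ∘ f)).reverse ++ S b)) := by
  refine ⟨(S a).length + 1, le_rfl, ?_⟩
  induction h : S a generalizing S x with
  | nil =>
    have : update (update S a []) b (S b) = S := by
      rw [← h, update_eq_self, update_eq_self]
    simp only [List.length_nil, List.map_nil, List.reverse_nil, List.nil_append, this]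
    refine (Runs.single _ _ _).trans (n := 1) (n' := 0) ?_
    have h2 : update S a [] = S := by rw [← h, update_eq_self]
    simp [move2, h, h2, Runs.refl]
  | cons s l ih =>
    refine (Runs.single _ _ _).trans (n := 1) (n' := l.length + 1) ?_
    have hS := ih (some (f s)) (update (update S a l) b (g (f s) :: S b)) (by simp [hab])
    have hstep : TM2.stepAux ((move2 σ a b b false f g g).m ()) (x, v) S =
        ⟨some (), (some (f s), v), update (update S a l) b (g (f s) :: S b)⟩ := by
      simp [move2, h, hab.symm]
    have e : update (update S a []) b (((s :: l).map (g ∘ f)).reverse ++ S b) =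
        update (update (update (update S a l) b (g (f s) :: S b)) a []) b
          ((l.map (g ∘ f)).reverse ++ update (update S a l) b (g (f s) :: S b) b) := by
      simp only [List.map_cons, List.reverse_cons, List.append_assoc, update_self,
        List.singleton_append, comp_apply]
      funext k
      by_cases h2 : k = b
      · subst h2; simp
      · by_cases h3 : k = a
        · subst h3; simp [h2]
        · simp [h2, h3]
    rw [e]
    exact hstep ▸ hS

theorem Prog.run_move2 [Inhabited T] {a b c : K} (hab : a ≠ b) (hac : a ≠ c) (hbc : b ≠ c) (f : Γ a → T)
    (g : T → Γ b) (h : T → Γ c) (x : Option T) (v : σ) (S : ∀ k, List (Γ k)) :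
    (Prog.move2 σ a b c true f g h).Run ((S a).length + 1) (x, v) S (none, v)
      (update (update (update S a []) b (((S a).map (g ∘ f)).reverse ++ S b)) c
        (((S a).map (h ∘ f)).reverse ++ S c)) := by
  refine ⟨(S a).length + 1, le_rfl, ?_⟩
  induction hl : S a generalizing S x with
  | nil =>
    have h2 : update S a [] = S := by rw [← hl, update_eq_self]
    simp only [List.length_nil, List.map_nil, List.reverse_nil, List.nil_append, h2,
      update_eq_self]
    refine (Runs.single _ _ _).trans (n := 1) (n' := 0) ?_
    simp [move2, hl, h2, Runs.refl]
  | cons s l ih =>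
    refine (Runs.single _ _ _).trans (n := 1) (n' := l.length + 1) ?_
    have hS := ih (some (f s))
      (update (update (update S a l) b (g (f s) :: S b)) c (h (f s) :: S c)) (by simp [hab, hac])
    have hstep : TM2.stepAux ((move2 σ a b c true f g h).m ()) (x, v) S =
        ⟨some (), (some (f s), v), update (update (update S a l) b (g (f s) :: S b)) c
          (h (f s) :: S c)⟩ := by
      simp [move2, hl, hab.symm, hac.symm, hbc.symm]
    have e : update (update (update S a []) b (((s :: l).map (g ∘ f)).reverse ++ S b)) c
          (((s :: l).map (h ∘ f)).reverse ++ S c) =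
        update (update (update (update (update (update S a l) b (g (f s) :: S b)) c
          (h (f s) :: S c)) a []) b ((l.map (g ∘ f)).reverse ++
            update (update (update S a l) b (g (f s) :: S b)) c (h (f s) :: S c) b)) c
          ((l.map (h ∘ f)).reverse ++
            update (update (update S a l) b (g (f s) :: S b)) c (h (f s) :: S c) c) := by
      simp only [List.map_cons, List.reverse_cons, List.append_assoc, update_self,
        List.singleton_append, comp_apply, update_of_ne hbc]
      funext k
      by_cases h1 : k = c
      · subst h1; simp
      · by_cases h2 : k = b
        · subst h2; simp [h1]
        · by_cases h3 : k = a
          · subst h3; simp [h1, h2]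
          · simp [h1, h2, h3]
    rw [e]
    exact hstep ▸ hS

/-- Repeat `F` as long as a symbol can be popped from stack `a`. -/
def Prog.whilePop (a : K) (f : Γ a → T) (F : Prog Γ (Option T × σ)) : Prog Γ (Option T × σ) where
  Λ := Option F.Λ
  fin := letI := F.fin; inferInstance
  entry := none
  m l := l.elim
    (.pop a (fun v o => (o.map f, v.2)) <|
      .branch (fun v => v.1.isSome)
        (.load (fun v => (none, v.2)) (.goto fun _ => some F.entry))
        .halt)
    (fun l => trStmt (Emb.refl Γ _) some (some none) (F.m l))

/-- `S i` describes the stacks after `i` rounds, and stack `a` is a unary counter. A round costs one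
step for the pop and at most `t` for the body; the final step is the pop that fails. -/
theorem Prog.run_whilePop {a : K} {f : Γ a → T} {F : Prog Γ (Option T × σ)} {t : ℕ} {v : σ}
    (n : ℕ) (S : ℕ → ∀ k, List (Γ k)) (hlen : ∀ i ≤ n, (S i a).length = n - i)
    (h : ∀ i < n, F.Run t (none, v) (update (S i) a (S i a).tail) (none, v) (S (i + 1))) :
    (Prog.whilePop a f F).Run (n * (t + 1) + 1) (none, v) (S 0) (none, v) (S n) := by
  induction n generalizing S with
  | zero =>
    refine ⟨1, by omega, ?_⟩
    have h0 : S 0 a = [] := by simpa using hlen 0 le_rfl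
    have h2 : update (S 0) a [] = S 0 := by rw [← h0, update_eq_self]
    refine (Runs.single _ _ _).trans (n := 1) (n' := 0) ?_
    simp [whilePop, h0, h2, Runs.refl]
  | succ n ih =>
    obtain ⟨k, hk, hr⟩ := ih (fun i => S (i + 1))
      (fun i hi => by rw [hlen (i + 1) (by omega)]; omega) (fun i hi => h (i + 1) (by omega))
    obtain ⟨k', hk', hr'⟩ := h 0 (by omega)
    refine ⟨k + (k' + 1), by rw [Nat.succ_mul]; omega, ?_⟩
    have e := Runs.tr (M := (whilePop a f F).m) (φ := some) (ex := some none) Emb.compat_refl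
      (fun l => rfl) hr'
    refine Runs.trans (Runs.trans (n := 1) (Runs.single _ _ _) (?_ : Runs _ k' _ _)) hr
    have h0 := hlen 0 (by omega)
    obtain ⟨s, l, hs⟩ : ∃ s l, S 0 a = s :: l := by
      cases hS : S 0 a with
      | nil => rw [hS] at h0; simp at h0
      | cons s l => exact ⟨s, l, rfl⟩
    simpa [whilePop, hs, trCfg] using e

end Register

/-! ### Functions computed in polynomial time, and their closure properties -/

theorem eval_le_eval (p : Polynomial ℕ) {m n : ℕ} (h : m ≤ n) : p.eval m ≤ p.eval n := by
  induction p using Polynomial.induction_on' with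
  | add p q hp hq => simpa using add_le_add hp hq
  | monomial k a => simpa using Nat.mul_le_mul_left a (Nat.pow_le_pow_left h k)

/-- `f` is computed in polynomial time with respect to the given encodings. -/
def Poly {α β A B : Type} (ea : α → List A) (eb : β → List B) (f : α → β) : Prop :=
  Nonempty (TM2ComputableInPolyTime ea eb f)

/-- All stacks are empty, except that `k` holds `l`. -/
def single {K : Type} [DecidableEq K] {Γ : K → Type} (k : K) (l : List (Γ k)) : ∀ k, List (Γ k) :=
  update (fun _ => []) k l

section

variable {K : Type} [DecidableEq K] {Γ : K → Type}

@[simp] theorem single_self (k : K) (l : List (Γ k)) : single k l k = l := by simp [single]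

theorem single_nil (k : K) : single k ([] : List (Γ k)) = fun _ => [] := by simp [single]

theorem update_single (k : K) (l l' : List (Γ k)) : update (single k l) k l' = single k l' := by
  simp [single]

end

theorem initList_eq (tm : FinTM2) (s : List (tm.Γ tm.k₀)) :
    initList tm s = ⟨some tm.main, tm.initialState, single tm.k₀ s⟩ := by
  unfold initList
  congr 1
  funext k
  by_cases h : k = tm.k₀
  · subst h; simp
  · simp [h, single]

theorem haltList_eq (tm : FinTM2) (s : List (tm.Γ tm.k₁)) :
    haltList tm s = ⟨none, tm.initialState, single tm.k₁ s⟩ := by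
  unfold haltList
  congr 1
  funext k
  by_cases h : k = tm.k₁
  · subst h; simp
  · simp [h, single]

/-- The program has to end in its initial state with every stack but the output stack empty, because
`haltList` prescribes the halting configuration completely. -/
theorem Poly.of_prog {α β A B : Type} {ea : α → List A} {eb : β → List B} {f : α → β} {K : Type}
    [DecidableEq K] [Fintype K] {Γ : K → Type} {σ : Type} [Fintype σ] (F : Prog Γ σ) (v : σ)
    (k₀ k₁ : K) [Fintype (Γ k₀)] (e₀ : Γ k₀ ≃ A) (e₁ : Γ k₁ ≃ B) (p : Polynomial ℕ)
    (h : ∀ a, F.Run (p.eval (ea a).length) v (single k₀ ((ea a).map e₀.symm)) v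
      (single k₁ ((eb (f a)).map e₁.symm))) : Poly ea eb f := by
  let tm : FinTM2 :=
    { K := K, k₀ := k₀, k₁ := k₁, Γ := Γ, Λ := F.Λ, main := F.entry, ΛFin := F.fin, σ := σ
      initialState := v, m := F.m }
  refine ⟨⟨⟨tm, e₀, e₁⟩, p, fun a => Classical.choice ?_⟩⟩
  obtain ⟨n, hn, hr⟩ := h a
  refine ⟨⟨⟨n, ?_⟩, hn⟩⟩
  rw [initList_eq, Option.map_some, haltList_eq]
  exact hr

/-- A polynomial time machine in the form of a program. -/
structure Machine {α β A B : Type} (ea : α → List A) (eb : β → List B) (f : α → β) where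
  K : Type
  dec : DecidableEq K
  fin : Fintype K
  Γ : K → Type
  σ : Type
  finσ : Fintype σ
  F : Prog Γ σ
  v : σ
  k₀ : K
  k₁ : K
  finΓ : Fintype (Γ k₀)
  e₀ : Γ k₀ ≃ A
  e₁ : Γ k₁ ≃ B
  p : Polynomial ℕ
  run : ∀ a, F.Run (p.eval (ea a).length) v (single k₀ ((ea a).map e₀.symm)) v
      (single k₁ ((eb (f a)).map e₁.symm))

attribute [instance] Machine.dec Machine.fin Machine.finσ Machine.finΓ

theorem Poly.machine {α β A B : Type} {ea : α → List A} {eb : β → List B} {f : α → β}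
    (h : Poly ea eb f) : Nonempty (Machine ea eb f) := by
  obtain ⟨h⟩ := h
  refine ⟨⟨h.tm.K, inferInstance, h.tm.kFin, h.tm.Γ, h.tm.σ, h.tm.σFin,
    ⟨h.tm.Λ, h.tm.ΛFin, h.tm.main, h.tm.m⟩, h.tm.initialState, h.tm.k₀, h.tm.k₁, h.tm.Γk₀Fin,
    h.inputAlphabet, h.outputAlphabet, h.time, fun a => ?_⟩⟩
  have ho := h.outputsFun a
  refine ⟨ho.steps, ho.steps_le_m, ?_⟩
  have he := ho.evals_in_steps
  generalize ho.steps = n at he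
  rw [Option.map_some, haltList_eq, initList_eq] at he
  exact he

/-! #### Bounds on the length of the output -/

section

variable {K : Type} [DecidableEq K] {Γ : K → Type} {σ Λ : Type}

/-- The number of push instructions in a statement. -/
def pushes : TM2.Stmt Γ Λ σ → ℕ
  | .push _ _ q => pushes q + 1
  | .peek _ _ q => pushes q
  | .pop _ _ q => pushes q
  | .load _ q => pushes q
  | .branch _ q₁ q₂ => pushes q₁ + pushes q₂
  | .goto _ => 0
  | .halt => 0

theorem length_stepAux_le (q : TM2.Stmt Γ Λ σ) (v : σ) (S : ∀ k, List (Γ k)) (k : K) :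
    ((TM2.stepAux q v S).stk k).length ≤ (S k).length + pushes q := by
  induction q generalizing v S with
  | push i f q ih =>
    refine (ih _ _).trans ?_
    by_cases h : k = i
    · subst h; simp [pushes]; omega
    · simp [pushes, h]
  | peek i f q ih => exact ih _ _
  | pop i f q ih =>
    refine (ih _ _).trans ?_
    by_cases h : k = i
    · subst h; simp [pushes]
    · simp [pushes, h]
  | load f q ih => exact ih _ _
  | branch f q₁ q₂ ih₁ ih₂ =>
    simp only [TM2.stepAux, pushes]
    cases f v
    · exact (ih₂ v S).trans (by omega)
    · exact (ih₁ v S).trans (by omega)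
  | goto f => simp [TM2.stepAux]
  | halt => simp [TM2.stepAux]

theorem Runs.length_le {m : Λ → TM2.Stmt Γ Λ σ} {C : ℕ} (hC : ∀ l, pushes (m l) ≤ C) {n : ℕ}
    {c c' : TM2.Cfg Γ Λ σ} (h : Runs m n c c') (k : K) :
    (c'.stk k).length ≤ (c.stk k).length + n * C := by
  induction n generalizing c with
  | zero =>
    obtain rfl : c = c' := Option.some.inj h
    simp
  | succ n ih =>
    obtain ⟨c₁, hc, hr⟩ := runs_succ_iff.1 h
    obtain ⟨l, v, S⟩ := c
    cases l with
    | none => simp [TM2.step] at hc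
    | some l =>
      simp only [TM2.step, Option.some.injEq] at hc
      subst hc
      have h1 := ih hr
      have h2 := length_stepAux_le (m l) v S k
      have h3 := hC l
      rw [Nat.succ_mul]
      simp only at *
      omega

theorem Prog.exists_pushes_le {K : Type} {Γ : K → Type} {σ : Type} (F : Prog Γ σ) : ∃ C, ∀ l, pushes (F.m l) ≤ C := by
  have := F.fin
  obtain ⟨C, hC⟩ := (Set.finite_range (fun l => pushes (F.m l))).bddAbove
  exact ⟨C, fun l => hC ⟨l, rfl⟩⟩

end

/-- A step pushes at most a constant number of symbols, so the output is bounded by the input length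
plus a multiple of the running time. Composition needs this to bound the input of the second
machine. -/
theorem Poly.length_le {α β A B : Type} {ea : α → List A} {eb : β → List B} {f : α → β}
    (h : Poly ea eb f) : ∃ q : Polynomial ℕ, ∀ a, (eb (f a)).length ≤ q.eval (ea a).length := by
  obtain ⟨M⟩ := h.machine
  obtain ⟨C, hC⟩ := M.F.exists_pushes_le
  refine ⟨.X + M.p * .C C, fun a => ?_⟩
  obtain ⟨n, hn, hr⟩ := M.run a
  have h1 := Runs.length_le hC hr M.k₁
  have h2 : (single M.k₀ ((ea a).map M.e₀.symm) M.k₁).length ≤ (ea a).length := by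
    by_cases hk : M.k₁ = M.k₀
    · rw [hk]; simp
    · simp [single, hk]
  have h3 := Nat.mul_le_mul_right C hn
  simp only [single_self, List.length_map, Polynomial.eval_add, Polynomial.eval_X,
    Polynomial.eval_mul, Polynomial.eval_C] at *
  omega

/-! #### Two machines with common auxiliary stacks -/

section Join

variable {K₁ K₂ : Type} [DecidableEq K₁] [DecidableEq K₂] {Γ₁ : K₁ → Type} {Γ₂ : K₂ → Type}
  {σ₁ σ₂ T : Type}

/-- Stack alphabets of the joint machine. -/
abbrev JΓ (T : Type) (Γ₁ : K₁ → Type) (Γ₂ : K₂ → Type) : Fin 3 ⊕ (K₁ ⊕ K₂) → Type :=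
  Sum.elim (fun _ => T) (Sum.elim Γ₁ Γ₂)

/-- The stacks of the joint machine. -/
def join (a : Fin 3 → List T) (S₁ : ∀ k, List (Γ₁ k)) (S₂ : ∀ k, List (Γ₂ k)) :
    ∀ k, List (JΓ T Γ₁ Γ₂ k)
  | .inl i => a i
  | .inr (.inl k) => S₁ k
  | .inr (.inr k) => S₂ k

theorem update_join_aux (a : Fin 3 → List T) (S₁ : ∀ k, List (Γ₁ k)) (S₂ : ∀ k, List (Γ₂ k))
    (i : Fin 3) (l : List T) :
    update (join a S₁ S₂) (.inl i) l = join (update a i l) S₁ S₂ := by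
  funext k
  rcases k with k | k | k
  · by_cases h : k = i
    · subst h
      exact (update_self (f := join a S₁ S₂) _ _).trans (update_self (f := a) k l).symm
    · exact (update_of_ne (by simpa using h) _ (join a S₁ S₂)).trans
        (show a k = update a i l k from (update_of_ne h l a).symm)
  · exact update_of_ne (by simp) _ (join a S₁ S₂)
  · exact update_of_ne (by simp) _ (join a S₁ S₂)

theorem update_join_left (a : Fin 3 → List T) (S₁ : ∀ k, List (Γ₁ k)) (S₂ : ∀ k, List (Γ₂ k))
    (i : K₁) (l : List (Γ₁ i)) :
    update (join a S₁ S₂) (.inr (.inl i)) l = join a (update S₁ i l) S₂ := by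
  funext k
  rcases k with k | k | k
  · exact update_of_ne (by simp) _ (join a S₁ S₂)
  · by_cases h : k = i
    · subst h
      exact (update_self (f := join a S₁ S₂) _ _).trans (update_self (f := S₁) k l).symm
    · exact (update_of_ne (by simpa using h) _ (join a S₁ S₂)).trans
        (show S₁ k = update S₁ i l k from (update_of_ne h l S₁).symm)
  · exact update_of_ne (by simp) _ (join a S₁ S₂)

theorem update_join_right (a : Fin 3 → List T) (S₁ : ∀ k, List (Γ₁ k)) (S₂ : ∀ k, List (Γ₂ k))
    (i : K₂) (l : List (Γ₂ i)) :
    update (join a S₁ S₂) (.inr (.inr i)) l = join a S₁ (update S₂ i l) := by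
  funext k
  rcases k with k | k | k
  · exact update_of_ne (by simp) _ (join a S₁ S₂)
  · exact update_of_ne (by simp) _ (join a S₁ S₂)
  · by_cases h : k = i
    · subst h
      exact (update_self (f := join a S₁ S₂) _ _).trans (update_self (f := S₂) k l).symm
    · exact (update_of_ne (by simpa using h) _ (join a S₁ S₂)).trans
        (show S₂ k = update S₂ i l k from (update_of_ne h l S₂).symm)

theorem join_nil {K₁ K₂ : Type} {Γ₁ : K₁ → Type} {Γ₂ : K₂ → Type} :
    join (T := T) (fun _ => []) (fun k : K₁ => ([] : List (Γ₁ k)))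
    (fun k : K₂ => ([] : List (Γ₂ k))) = fun _ => [] := by
  funext k
  rcases k with k | k | k <;> rfl

theorem join_single_aux (i : Fin 3) (l : List T) :
    join (update (fun _ => []) i l) (fun k : K₁ => ([] : List (Γ₁ k)))
      (fun k : K₂ => ([] : List (Γ₂ k))) = single (.inl i) l :=
  (update_join_aux (fun _ => []) _ _ i l).symm.trans
    (congrArg (fun S => update S _ _) join_nil)

theorem join_single_left (i : K₁) (l : List (Γ₁ i)) :
    join (fun _ => ([] : List T)) (single i l)
      (fun k : K₂ => ([] : List (Γ₂ k))) = single (.inr (.inl i)) l :=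
  (update_join_left _ (fun _ => []) _ i l).symm.trans
    (congrArg (fun S => update S _ _) join_nil)

theorem join_single_right (i : K₂) (l : List (Γ₂ i)) :
    join (fun _ => ([] : List T)) (fun k : K₁ => ([] : List (Γ₁ k))) (single i l)
      = single (.inr (.inr i)) l :=
  (update_join_right _ _ (fun _ => []) i l).symm.trans
    (congrArg (fun S => update S _ _) join_nil)

/-- The first machine as a part of the joint machine. -/
def embLeft : Emb Γ₁ σ₁ (JΓ T Γ₁ Γ₂) (Option T × σ₁ × σ₂) :=
  ⟨fun k => .inr (.inl k), fun _ x => x, fun _ x => x, fun v => v.2.1, fun w v => (v.1, w, v.2.2)⟩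

/-- The second machine as a part of the joint machine. -/
def embRight : Emb Γ₂ σ₂ (JΓ T Γ₁ Γ₂) (Option T × σ₁ × σ₂) :=
  ⟨fun k => .inr (.inr k), fun _ x => x, fun _ x => x, fun v => v.2.2, fun w v => (v.1, v.2.1, w)⟩

theorem compat_left (x : Option T) (w : σ₂) (a : Fin 3 → List T) (S₂ : ∀ k, List (Γ₂ k)) :
    (embLeft : Emb Γ₁ σ₁ (JΓ T Γ₁ Γ₂) (Option T × σ₁ × σ₂)).Compat (fun v => (x, v, w))
      (fun S => join a S S₂) where
  ofBig_toBig _ _ := rfl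
  get_sv _ := rfl
  set_sv _ _ := rfl
  stack S i := (List.map_id (S i)).symm
  update S i l := by
    have : l.map (embLeft.toBig (Γ := JΓ T Γ₁ Γ₂) (σ := Option T × σ₁ × σ₂) i) = l :=
      List.map_id l
    rw [this]
    exact (update_join_left a S S₂ i l).symm

theorem compat_right (x : Option T) (w : σ₁) (a : Fin 3 → List T) (S₁ : ∀ k, List (Γ₁ k)) :
    (embRight : Emb Γ₂ σ₂ (JΓ T Γ₁ Γ₂) (Option T × σ₁ × σ₂)).Compat (fun v => (x, w, v))
      (fun S => join a S₁ S) where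
  ofBig_toBig _ _ := rfl
  get_sv _ := rfl
  set_sv _ _ := rfl
  stack S i := (List.map_id (S i)).symm
  update S i l := by
    have : l.map (embRight.toBig (Γ := JΓ T Γ₁ Γ₂) (σ := Option T × σ₁ × σ₂) i) = l :=
      List.map_id l
    rw [this]
    exact (update_join_right a S₁ S i l).symm

/-- Move a stack of the first machine to an auxiliary stack. -/
def leftToAux (σ₁ σ₂ : Type) [Inhabited T] (k : K₁) (i : Fin 3) (f : Γ₁ k → T) :
    Prog (JΓ T Γ₁ Γ₂) (Option T × σ₁ × σ₂) :=
  Prog.move2 _ (.inr (.inl k)) (.inl i) (.inl i) false f id id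

/-- Move an auxiliary stack to a stack of the first machine. -/
def auxToLeft (σ₁ σ₂ : Type) [Inhabited T] (i : Fin 3) (k : K₁) (f : T → Γ₁ k) :
    Prog (JΓ T Γ₁ Γ₂) (Option T × σ₁ × σ₂) :=
  Prog.move2 _ (.inl i) (.inr (.inl k)) (.inr (.inl k)) false id f f

/-- Move an auxiliary stack to a stack of the second machine. -/
def auxToRight (σ₁ σ₂ : Type) [Inhabited T] (i : Fin 3) (k : K₂) (f : T → Γ₂ k) :
    Prog (JΓ T Γ₁ Γ₂) (Option T × σ₁ × σ₂) :=
  Prog.move2 _ (.inl i) (.inr (.inr k)) (.inr (.inr k)) false id f f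

/-- Move a stack of the first machine to two auxiliary stacks. -/
def leftDup (σ₁ σ₂ : Type) [Inhabited T] (k : K₁) (i j : Fin 3) (f : Γ₁ k → T) :
    Prog (JΓ T Γ₁ Γ₂) (Option T × σ₁ × σ₂) :=
  Prog.move2 _ (.inr (.inl k)) (.inl i) (.inl j) true f id id

/-- Move an auxiliary stack to two others. -/
def auxDup (T : Type) (Γ₁ : K₁ → Type) (Γ₂ : K₂ → Type) (σ₁ σ₂ : Type) [Inhabited T]
    (i j k : Fin 3) : Prog (JΓ T Γ₁ Γ₂) (Option T × σ₁ × σ₂) :=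
  Prog.move2 _ (.inl i) (.inl j) (.inl k) true id id id

variable [Inhabited T] (x : σ₁) (y : σ₂) (a : Fin 3 → List T) (S₁ : ∀ k, List (Γ₁ k))
  (S₂ : ∀ k, List (Γ₂ k))

theorem run_leftToAux (k : K₁) (i : Fin 3) (f : Γ₁ k → T) :
    (leftToAux (Γ₂ := Γ₂) σ₁ σ₂ k i f).Run ((S₁ k).length + 1) (none, x, y) (join a S₁ S₂)
      (none, x, y)
      (join (update a i (((S₁ k).map f).reverse ++ a i)) (update S₁ k []) S₂) := by
  have h := Prog.run_move (T := T) (Γ := JΓ T Γ₁ Γ₂) (a := .inr (.inl k)) (b := .inl i) (by simp) f id none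
    (x, y) (join a S₁ S₂)
  rw [← update_join_aux, ← update_join_left]
  exact h

theorem run_auxToLeft (k : K₁) (i : Fin 3) (f : T → Γ₁ k) :
    (auxToLeft (Γ₂ := Γ₂) σ₁ σ₂ i k f).Run ((a i).length + 1) (none, x, y) (join a S₁ S₂)
      (none, x, y)
      (join (update a i []) (update S₁ k (((a i).map f).reverse ++ S₁ k)) S₂) := by
  have h := Prog.run_move (T := T) (Γ := JΓ T Γ₁ Γ₂) (a := .inl i) (b := .inr (.inl k)) (by simp) id f none
    (x, y) (join a S₁ S₂)
  rw [← update_join_left, ← update_join_aux]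
  exact h

theorem run_auxToRight (k : K₂) (i : Fin 3) (f : T → Γ₂ k) :
    (auxToRight (Γ₁ := Γ₁) σ₁ σ₂ i k f).Run ((a i).length + 1) (none, x, y) (join a S₁ S₂)
      (none, x, y)
      (join (update a i []) S₁ (update S₂ k (((a i).map f).reverse ++ S₂ k))) := by
  have h := Prog.run_move (T := T) (Γ := JΓ T Γ₁ Γ₂) (a := .inl i) (b := .inr (.inr k)) (by simp) id f none
    (x, y) (join a S₁ S₂)
  rw [← update_join_right, ← update_join_aux]
  exact h

theorem run_leftDup (k : K₁) {i j : Fin 3} (hij : i ≠ j) (f : Γ₁ k → T) :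
    (leftDup (Γ₂ := Γ₂) σ₁ σ₂ k i j f).Run ((S₁ k).length + 1) (none, x, y) (join a S₁ S₂)
      (none, x, y)
      (join (update (update a i (((S₁ k).map f).reverse ++ a i)) j
        (((S₁ k).map f).reverse ++ a j)) (update S₁ k []) S₂) := by
  have h := Prog.run_move2 (Γ := JΓ T Γ₁ Γ₂) (a := .inr (.inl k)) (b := .inl i) (c := .inl j)
    (by simp) (by simp) (by simpa using hij) f (id : T → T) id none (x, y) (join a S₁ S₂)
  rw [← update_join_aux, ← update_join_aux, ← update_join_left]
  exact h

theorem run_auxDup {i j k : Fin 3} (hij : i ≠ j) (hik : i ≠ k) (hjk : j ≠ k) :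
    (auxDup T Γ₁ Γ₂ σ₁ σ₂ i j k).Run ((a i).length + 1) (none, x, y) (join a S₁ S₂) (none, x, y)
      (join (update (update (update a i []) j ((a i).reverse ++ a j)) k ((a i).reverse ++ a k))
        S₁ S₂) := by
  have h := Prog.run_move2 (Γ := JΓ T Γ₁ Γ₂) (a := .inl i) (b := .inl j) (c := .inl k)
    (by simpa using hij) (by simpa using hik) (by simpa using hjk) (id : T → T) id id none (x, y)
    (join a S₁ S₂)
  rw [← update_join_aux, ← update_join_aux, ← update_join_aux]
  have e : ((a i).map (id ∘ id : T → T)).reverse = (a i).reverse := by simp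
  rw [← e]
  exact h

end Join

/-! #### Composition -/

/-- Both machines live on disjoint stacks of one joint machine. The intermediate result travels over
an auxiliary stack; each of the two moves reverses it, so its order is restored. -/
theorem Poly.comp {α β γ A B C : Type} [Fintype B] [Inhabited B] {ea : α → List A}
    {eb : β → List B} {ec : γ → List C} {f : α → β} {g : β → γ} (hg : Poly eb ec g)
    (hf : Poly ea eb f) : Poly ea ec (fun a => g (f a)) := by
  obtain ⟨q, hq⟩ := hf.length_le
  obtain ⟨M⟩ := hf.machine
  obtain ⟨N⟩ := hg.machine
  let F : Prog (JΓ B M.Γ N.Γ) (Option B × M.σ × N.σ) :=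
    (((Prog.call embLeft M.F).seq (leftToAux _ _ M.k₁ 0 M.e₁)).seq
      (auxToRight _ _ 0 N.k₀ N.e₀.symm)).seq (Prog.call embRight N.F)
  have : Fintype (JΓ B M.Γ N.Γ (.inr (.inl M.k₀))) := M.finΓ
  refine Poly.of_prog F (none, M.v, N.v) (.inr (.inl M.k₀)) (.inr (.inr N.k₁)) M.e₀ N.e₁
    (M.p + (q + 1) + (q + 1) + N.p.comp q) (fun a => ?_)
  have h1 := (M.run a).call
    (compat_left (none : Option B) N.v (fun _ => []) (fun k : N.K => ([] : List (N.Γ k))))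
  have h2 := run_leftToAux M.v N.v (fun _ => []) (single M.k₁ ((eb (f a)).map M.e₁.symm))
    (fun k : N.K => ([] : List (N.Γ k))) M.k₁ 0 M.e₁
  rw [update_single, single_nil, single_self, List.map_map, Equiv.self_comp_symm, List.map_id,
    List.append_nil] at h2
  have h3 := run_auxToRight M.v N.v (update (fun _ => []) 0 (eb (f a)).reverse)
    (fun k : M.K => ([] : List (M.Γ k))) (fun k : N.K => ([] : List (N.Γ k))) N.k₀ 0 N.e₀.symm
  rw [update_self, List.map_reverse, List.reverse_reverse, List.append_nil, update_idem] at h3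
  have h4 := (N.run (f a)).call
    (compat_right (none : Option B) M.v (fun _ => []) (fun k : M.K => ([] : List (M.Γ k))))
  have e0 : update (fun _ : Fin 3 => ([] : List B)) 0 [] = fun _ => [] := by simp
  rw [e0] at h3
  have h := ((h1.seq h2).seq h3).seq h4
  rw [join_single_left, join_single_right] at h
  refine h.mono ?_
  have hq := hq a
  have hp := eval_le_eval N.p hq
  simp only [List.length_map, List.length_reverse, Polynomial.eval_add, Polynomial.eval_one,
    Polynomial.eval_comp]
  omega

/-! #### Concatenation of outputs -/

/-- The input is duplicated, both machines run, and the output of the first is pushed on top of the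
output of the second, after one reversal on an auxiliary stack. -/
theorem Poly.append {α : Type} {ea : α → List Bool} {f g : α → List Bool}
    (hf : Poly ea id f) (hg : Poly ea id g) : Poly ea id (fun a => f a ++ g a) := by
  obtain ⟨q, hq⟩ := hf.length_le
  obtain ⟨M⟩ := hf.machine
  obtain ⟨N⟩ := hg.machine
  let F : Prog (JΓ Bool M.Γ N.Γ) (Option Bool × M.σ × N.σ) :=
    ((((((auxDup Bool M.Γ N.Γ M.σ N.σ 0 1 2).seq (auxToLeft _ _ 1 M.k₀ M.e₀.symm)).seq
      (auxToRight _ _ 2 N.k₀ N.e₀.symm)).seq (Prog.call embLeft M.F)).seq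
      (Prog.call embRight N.F)).seq (leftToAux _ _ M.k₁ 0 M.e₁)).seq
      (auxToRight _ _ 0 N.k₁ N.e₁.symm)
  have : Fintype (JΓ Bool M.Γ N.Γ (.inl 0)) := inferInstanceAs (Fintype Bool)
  refine Poly.of_prog F (none, M.v, N.v) (.inl 0) (.inr (.inr N.k₁)) (Equiv.refl Bool) N.e₁
    ((.X + 1) + (.X + 1) + (.X + 1) + M.p + N.p + (q + 1) + (q + 1)) (fun a => ?_)
  have h0 := run_auxDup M.v N.v (update (fun _ => []) 0 (ea a)) (fun k : M.K => ([] : List (M.Γ k)))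
    (fun k : N.K => ([] : List (N.Γ k))) (i := 0) (j := 1) (k := 2) (by decide) (by decide)
    (by decide)
  have h1 := run_auxToLeft M.v N.v
    (update (update (fun _ => []) 1 (ea a).reverse) 2 (ea a).reverse)
    (fun k : M.K => ([] : List (M.Γ k))) (fun k : N.K => ([] : List (N.Γ k))) M.k₀ 1 M.e₀.symm
  have h2 := run_auxToRight M.v N.v (update (fun _ => []) 2 (ea a).reverse)
    (single M.k₀ ((ea a).map M.e₀.symm)) (fun k : N.K => ([] : List (N.Γ k))) N.k₀ 2 N.e₀.symm
  have h3 := (M.run a).call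
    (compat_left (none : Option Bool) N.v (fun _ => []) (single N.k₀ ((ea a).map N.e₀.symm)))
  have h4 := (N.run a).call
    (compat_right (none : Option Bool) M.v (fun _ => []) (single M.k₁ ((f a).map M.e₁.symm)))
  have h5 := run_leftToAux M.v N.v (fun _ => []) (single M.k₁ ((f a).map M.e₁.symm))
    (single N.k₁ ((g a).map N.e₁.symm)) M.k₁ 0 M.e₁
  have h6 := run_auxToRight M.v N.v (update (fun _ => []) 0 (f a).reverse) (fun k : M.K => ([] : List (M.Γ k)))
    (single N.k₁ ((g a).map N.e₁.symm)) N.k₁ 0 N.e₁.symm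
  have e1 : update (update (update (fun _ => []) 1 (ea a).reverse) 2 (ea a).reverse) 1 [] =
      update (fun _ : Fin 3 => ([] : List Bool)) 2 (ea a).reverse := by
    funext i; fin_cases i <;> simp [update]
  have e2 : update (update (fun _ => []) 1 (ea a).reverse) 2 (ea a).reverse (1 : Fin 3) =
      (ea a).reverse := by simp [update]
  have e3 : update (fun _ : Fin 3 => ([] : List Bool)) 2 [] = fun _ => [] := by simp
  have e0 : update (fun _ : Fin 3 => ([] : List Bool)) 0 [] = fun _ => [] := by simp
  rw [update_idem, e0, update_self, update_of_ne (by decide), update_of_ne (by decide),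
    List.append_nil] at h0
  rw [e1, e2, List.map_reverse, List.reverse_reverse, List.append_nil] at h1
  rw [update_idem, e3, update_self, List.map_reverse, List.reverse_reverse, List.append_nil] at h2
  rw [update_single, single_nil, single_self, List.map_map, Equiv.self_comp_symm, List.map_id,
    List.append_nil] at h5
  rw [update_self, update_idem, single_self, update_single, e0, List.map_reverse,
    List.reverse_reverse, ← List.map_append] at h6
  have h := (((((h0.seq h1).seq h2).seq h3).seq h4).seq h5).seq h6
  rw [join_single_right, join_single_aux] at h
  have hid : (ea a).map (Equiv.refl Bool).symm = ea a := List.map_id _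
  refine (congrArg (fun l => F.Run _ _ (single (Γ := JΓ Bool M.Γ N.Γ) (.inl 0) l) _ _) hid).mpr
    (h.mono ?_)
  have hq := hq a
  simp only [id, List.length_map, List.length_reverse, Polynomial.eval_add, Polynomial.eval_one,
    Polynomial.eval_X] at *
  omega

/-! #### Iteration -/

/-- A copy of the input code on auxiliary stack 2 is the loop counter, which is why the number of
iterations is the length of that code. The size bound is required only along orbits that start at
some `ι c`. -/
theorem Poly.iterate {α : Type} {ea : α → List Bool} {γ : Type} {s : α → α}
    (hs : Poly ea ea s) (ι : γ → α) (p : Polynomial ℕ)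
    (hp : ∀ c, ∀ i ≤ (ea (ι c)).length, (ea (s^[i] (ι c))).length ≤ p.eval (ea (ι c)).length) :
    Poly (fun c => ea (ι c)) ea (fun c => s^[(ea (ι c)).length] (ι c)) := by
  obtain ⟨M⟩ := hs.machine
  let body : Prog (JΓ Bool M.Γ M.Γ) (Option Bool × M.σ × M.σ) :=
    ((Prog.call embLeft M.F).seq (leftToAux _ _ M.k₁ 0 M.e₁)).seq (auxToLeft _ _ 0 M.k₀ M.e₀.symm)
  let F : Prog (JΓ Bool M.Γ M.Γ) (Option Bool × M.σ × M.σ) :=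
    ((leftDup _ _ M.k₀ 0 2 M.e₀).seq (auxToLeft _ _ 0 M.k₀ M.e₀.symm)).seq (Prog.whilePop (.inl 2) id body)
  have : Fintype (JΓ Bool M.Γ M.Γ (.inr (.inl M.k₀))) := M.finΓ
  refine Poly.of_prog F (none, M.v, M.v) (.inr (.inl M.k₀)) (.inr (.inl M.k₀)) M.e₀ M.e₀
    ((.X + 1) + (.X + 1) + (.X * ((M.p.comp p + (p + 1) + (p + 1)) + 1) + 1))
    (fun c => ?_)
  set w := ea (ι c) with hw
  have e0 (i : Fin 3) : update (fun _ : Fin 3 => ([] : List Bool)) i [] = fun _ => [] := by simp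
  have h0 := run_leftDup M.v M.v (fun _ => []) (single M.k₀ (w.map M.e₀.symm))
    (fun k : M.K => ([] : List (M.Γ k))) M.k₀ (i := 0) (j := 2) (by decide) M.e₀
  rw [update_single, single_nil, single_self, List.map_map, Equiv.self_comp_symm, List.map_id,
    List.append_nil] at h0
  have h1 := run_auxToLeft M.v M.v (update (update (fun _ => []) 0 w.reverse) 2 w.reverse)
    (fun k : M.K => ([] : List (M.Γ k))) (fun k : M.K => ([] : List (M.Γ k))) M.k₀ 0 M.e₀.symm
  have e1 : update (update (update (fun _ => []) 0 w.reverse) 2 w.reverse) 0 [] =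
      update (fun _ : Fin 3 => ([] : List Bool)) 2 w.reverse := by
    funext i; fin_cases i <;> simp [update]
  have e2 : update (update (fun _ => []) 0 w.reverse) 2 w.reverse (0 : Fin 3) = w.reverse := by
    simp [update]
  rw [e1, e2, List.append_nil, List.map_reverse, List.reverse_reverse] at h1
  have e3 (i : ℕ) : update (update (fun _ : Fin 3 => ([] : List Bool)) 2 (w.reverse.drop i)) 0 [] =
      update (fun _ => []) 2 (w.reverse.drop i) := by
    funext j; fin_cases j <;> simp [update]
  have e4 (i : ℕ) : update (fun _ : Fin 3 => ([] : List Bool)) 2 (w.reverse.drop i) 0 = [] := by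
    simp [update]
  -- After `i` rounds: the counter has lost `i` symbols, and the input stack of the machine holds
  -- the code of the `i`-th iterate.
  let S (i : ℕ) : ∀ k, List (JΓ Bool M.Γ M.Γ k) :=
    join (update (fun _ => []) 2 (w.reverse.drop i)) (single M.k₀ ((ea (s^[i] (ι c))).map M.e₀.symm))
      (fun k : M.K => ([] : List (M.Γ k)))
  have hS2 (i : ℕ) : S i (.inl 2) = w.reverse.drop i :=
    update_self (β := fun _ => List Bool) (2 : Fin 3) (w.reverse.drop i) (fun _ => [])
  have h3 := Prog.run_whilePop (a := .inl 2) (f := (id : Bool → Bool)) (F := body) (v := (M.v, M.v))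
    (t := (M.p.comp p + (p + 1) + (p + 1)).eval w.length) w.length S
    (fun i _ => (congrArg List.length (hS2 i)).trans (by simp)) (fun i hi => by
      have e5 : update (S i) (.inl 2) (S i (.inl 2)).tail =
          join (update (fun _ => []) 2 (w.reverse.drop (i + 1)))
            (single M.k₀ ((ea (s^[i] (ι c))).map M.e₀.symm))
            (fun k : M.K => ([] : List (M.Γ k))) := by
        rw [hS2]
        refine (update_join_aux _ _ _ _ _).trans ?_
        exact congrArg (fun a => join a _ _) ((update_idem _ _ _).trans
          (congrArg (update (fun _ => []) 2) List.tail_drop))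
      rw [e5]
      have b1 := (M.run (s^[i] (ι c))).call (compat_left (none : Option Bool) M.v
        (update (fun _ => []) 2 (w.reverse.drop (i + 1))) (fun k : M.K => ([] : List (M.Γ k))))
      rw [← iterate_succ_apply' s i] at b1
      have b2 := run_leftToAux M.v M.v (update (fun _ => []) 2 (w.reverse.drop (i + 1)))
        (single M.k₁ ((ea (s^[i + 1] (ι c))).map M.e₁.symm))
        (fun k : M.K => ([] : List (M.Γ k))) M.k₁ 0 M.e₁
      rw [update_single, single_nil, single_self, List.map_map, Equiv.self_comp_symm, List.map_id,
        e4, List.append_nil] at b2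
      have b3 := run_auxToLeft M.v M.v
        (update (update (fun _ => []) 2 (w.reverse.drop (i + 1))) 0 (ea (s^[i + 1] (ι c))).reverse)
        (fun k : M.K => ([] : List (M.Γ k)))
        (fun k : M.K => ([] : List (M.Γ k))) M.k₀ 0 M.e₀.symm
      rw [update_self, List.map_reverse, List.reverse_reverse, List.append_nil, update_idem, e3]
        at b3
      refine ((b1.seq b2).seq b3).mono ?_
      have l1 := eval_le_eval M.p (hp c i hi.le)
      have l2 := hp c (i + 1) hi
      rw [← hw] at l1 l2
      simp only [List.length_map, List.length_reverse, Polynomial.eval_add, Polynomial.eval_one,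
        Polynomial.eval_comp]
      omega)
  have hSn : S w.length = single (.inr (.inl M.k₀))
      ((ea (s^[w.length] (ι c))).map M.e₀.symm) := by
    have : w.reverse.drop w.length = [] := by simp
    simp only [S]
    rw [this, e0]
    exact join_single_left _ _
  rw [hSn] at h3
  have h := (h0.seq h1).seq h3
  rw [join_single_left] at h
  refine h.mono ?_
  simp only [List.length_map, List.length_reverse, Polynomial.eval_add, Polynomial.eval_one,
    Polynomial.eval_mul, Polynomial.eval_X]
  omega

/-! #### Finite-state transducers -/

/-- A finite-state transducer; `out q none` is written at the end of the input. -/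
structure Transducer (A B Q : Type) where
  next : Q → A → Q
  out : Q → Option A → List B

namespace Transducer

variable {A B Q : Type} (T : Transducer A B Q)

/-- The output of the transducer in state `q`. -/
def run (q : Q) : List A → List B
  | [] => T.out q none
  | a :: l => T.out q (some a) ++ run (T.next q a) l

/-- Stack alphabets: an input and an output stack. -/
abbrev StackAlphabet (A B : Type) : Bool → Type
  | false => A
  | true => B

/-- Push the symbols of a word to the output stack. -/
def pushAll {Λ : Type} (l : List B) (s : TM2.Stmt (StackAlphabet A B) Λ (Option A)) :
    TM2.Stmt (StackAlphabet A B) Λ (Option A) :=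
  l.foldr (fun b s => .push true (fun _ => b) s) s

theorem stepAux_pushAll {Λ : Type} (l : List B) (s : TM2.Stmt (StackAlphabet A B) Λ (Option A)) (v : Option A)
    (S : ∀ k, List (StackAlphabet A B k)) :
    TM2.stepAux (pushAll l s) v S =
      TM2.stepAux s v (update S true ((l.reverse : List B) ++ (S true : List B) : List B)) := by
  induction l generalizing S with
  | nil =>
    have : update S true (S true) = S := update_eq_self _ _
    exact congrArg (TM2.stepAux s v) this.symm
  | cons b l ih =>
    refine (ih _).trans (congrArg (TM2.stepAux s v) ?_)
    rw [update_idem]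
    refine congrArg (update S true) ?_
    rw [update_self]
    simp

/-- The program of a transducer; the output is reversed. -/
def prog [Fintype Q] [Fintype A] (q₀ : Q) : Prog (StackAlphabet A B) (Option A) where
  Λ := Q × Option (Option A)
  fin := inferInstance
  entry := (q₀, none)
  m
    | (q, none) => .pop false (fun _ o => o) (.goto fun v => (q, some v))
    | (q, some (some a)) => pushAll (T.out q (some a)) (.goto fun _ => (T.next q a, none))
    | (q, some none) => pushAll (T.out q none) .halt

/-- Each symbol takes two steps, one to pop it and one to write the corresponding output; the end of
the input takes two as well. -/
theorem run_prog [Fintype Q] [Fintype A] (q₀ q : Q) (v : Option A) (S : ∀ k, List (StackAlphabet A B k)) :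
    Runs (T.prog q₀).m (2 * ((S false).length + 1)) ⟨some (q, none), v, S⟩
      ⟨none, none, update (update S false []) true
        (((T.run q (S false)).reverse ++ (S true : List B) : List B))⟩ := by
  induction h : (S false : List A) generalizing q v S with
  | nil =>
    refine (Runs.single _ _ _).trans (n := 1) (n' := 1) ?_
    have e : TM2.stepAux ((T.prog q₀).m (q, none)) v S =
        ⟨some (q, some none), none, update S false []⟩ := by
      simp [prog, h]
    rw [e]
    refine (Runs.single _ _ _).trans (n := 1) (n' := 0) ?_
    have e' := stepAux_pushAll (T.out q none) .halt none (update S false [])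
      (Λ := Q × Option (Option A))
    exact congrArg some e'
  | cons a l ih =>
    have e1 : TM2.stepAux ((T.prog q₀).m (q, none)) v S =
        ⟨some (q, some (some a)), some a, update S false l⟩ := by
      simp [prog, h]
    have e2 : TM2.stepAux ((T.prog q₀).m (q, some (some a))) (some a) (update S false l) =
        ⟨some (T.next q a, none), some a, update (update S false l) true
          (((T.out q (some a)).reverse ++ (S true : List B) : List B))⟩ :=
      stepAux_pushAll (T.out q (some a)) (.goto fun _ => (T.next q a, none)) (some a)
        (update S false l)
    have r1 : Runs (T.prog q₀).m 1 ⟨some (q, none), v, S⟩ _ := Runs.single _ _ _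
    rw [e1] at r1
    have r2 : Runs (T.prog q₀).m 1 ⟨some (q, some (some a)), some a, update S false l⟩ _ :=
      Runs.single _ _ _
    rw [e2] at r2
    have r3 := ih (T.next q a) (some a) (update (update S false l) true
          (((T.out q (some a)).reverse ++ (S true : List B) : List B))) rfl
    have e3 : update (update (update (update S false l) true
          (((T.out q (some a)).reverse ++ (S true : List B) : List B))) false []) true
          ((T.run (T.next q a) l).reverse ++
            ((T.out q (some a)).reverse ++ (S true : List B)) : List B) =
        update (update S false []) true
          (((T.run q (a :: l)).reverse ++ (S true : List B) : List B)) := by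
      funext k
      cases k <;> simp [run]
    rw [← e3]
    exact (r1.trans r2).trans r3

theorem poly_reverse [Finite Q] [Fintype A] (q : Q) {α : Type} (ea : α → List A) :
    Poly ea id (fun a => (T.run q (ea a)).reverse) := by
  have := Fintype.ofFinite Q
  have : Fintype (StackAlphabet A B false) := inferInstanceAs (Fintype A)
  refine Poly.of_prog (T.prog q) none false true (Equiv.refl A) (Equiv.refl B) (2 * (.X + 1))
    fun a => ⟨2 * ((ea a).length + 1), by simp, ?_⟩
  have h := T.run_prog q q none (single false (ea a))
  have e : update (update (single (Γ := StackAlphabet A B) false (ea a)) false []) true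
      (((T.run q (ea a)).reverse ++ (single (Γ := StackAlphabet A B) false (ea a) true : List B) : List B)) =
      single true (T.run q (ea a)).reverse := by
    funext k
    cases k <;> simp [single]
  have e1 : (ea a).map (Equiv.refl A).symm = ea a := List.map_id _
  have e2 : (T.run q (ea a)).reverse.map (Equiv.refl B).symm = (T.run q (ea a)).reverse :=
    List.map_id _
  refine (congrArg₂ (fun l l' => Runs _ _ ⟨_, _, single (Γ := StackAlphabet A B) false l⟩
    ⟨_, _, single (Γ := StackAlphabet A B) true l'⟩) e1 e2).mpr ?_
  exact (congrArg (fun S => Runs _ _ _ (⟨_, _, S⟩ : TM2.Cfg _ _ _)) e).mp h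

/-- Functions computed by a finite-state transducer are computed in polynomial time. -/
theorem poly [Finite Q] [Fintype A] [Fintype B] [Inhabited B] (q : Q) {α β : Type}
    {ea : α → List A} {eb : β → List B} {f : α → β} (h : ∀ a, T.run q (ea a) = eb (f a)) :
    Poly ea eb f := by
  -- The stack program delivers its output reversed; a second pass with a copying transducer
  -- reverses it back.
  let R : Transducer B B Unit := ⟨fun _ _ => (), fun _ o => o.toList⟩
  have hR (l : List B) : R.run () l = l := by
    induction l with
    | nil => rfl
    | cons b l ih => exact congrArg (b :: ·) ih
  have h1 := (R.poly_reverse () (id : List B → List B)).comp (T.poly_reverse q ea)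
  simp only [hR, id, List.reverse_reverse, h] at h1
  obtain ⟨h1⟩ := h1
  exact ⟨⟨h1.toTM2ComputableAux, h1.time, h1.outputsFun⟩⟩

end Transducer

/-! ### Data types with a binary code -/

/-- A type whose elements are represented by binary strings. -/
class Code (α : Type) where
  enc : α → List Bool

/-- The length of the code. -/
def size {α : Type} [Code α] (a : α) : ℕ := (Code.enc a).length

/-- Mark every bit of a string with a preceding `true`. -/
def mark (l : List Bool) : List Bool := l.flatMap (fun b => [true, b])

@[simp] theorem mark_nil : mark [] = [] := rfl

@[simp] theorem mark_cons (b : Bool) (l : List Bool) : mark (b :: l) = true :: b :: mark l := rfl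

@[simp] theorem length_mark (l : List Bool) : (mark l).length = 2 * l.length := by
  induction l with
  | nil => rfl
  | cons b l ih => simp [ih]; ring

instance : Code Bool := ⟨fun b => [b]⟩
instance : Code Unit := ⟨fun _ => []⟩
instance : Code ℕ := ⟨fun n => List.replicate n false⟩
instance {α β : Type} [Code α] [Code β] : Code (α × β) :=
  ⟨fun x => mark (Code.enc x.1) ++ false :: Code.enc x.2⟩
instance {α : Type} [Code α] : Code (List α) :=
  ⟨fun l => l.flatMap (fun a => mark (Code.enc a) ++ [false])⟩

/-! ### Lengths of codes -/

section Size

variable {α β : Type} [Code α] [Code β]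

theorem enc_bool (b : Bool) : Code.enc b = [b] := rfl
theorem enc_nat (n : ℕ) : Code.enc n = List.replicate n false := rfl
theorem enc_pair (x : α × β) : Code.enc x = mark (Code.enc x.1) ++ false :: Code.enc x.2 := rfl
theorem enc_nil : Code.enc ([] : List α) = [] := rfl
-- A nonempty list has the same code as the pair of its head and tail, so the transducers for pairs
-- also serve for lists.
theorem enc_cons (a : α) (l : List α) : Code.enc (a :: l) = mark (Code.enc a) ++ false :: Code.enc l := by
  simp [Code.enc]
theorem enc_append (l l' : List α) : Code.enc (l ++ l') = Code.enc l ++ Code.enc l' := by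
  simp [Code.enc]

@[simp] theorem size_bool (b : Bool) : size b = 1 := rfl
@[simp] theorem size_unit (b : Unit) : size b = 0 := rfl
@[simp] theorem size_nat (n : ℕ) : size n = n := List.length_replicate
@[simp] theorem size_pair (a : α) (b : β) : size (a, b) = 2 * size a + 1 + size b := by
  simp only [size, enc_pair, List.length_append, length_mark, List.length_cons]
  omega
@[simp] theorem size_nil : size ([] : List α) = 0 := rfl
@[simp] theorem size_cons (a : α) (l : List α) : size (a :: l) = 2 * size a + 1 + size l := by
  simp only [size, enc_cons, List.length_append, length_mark, List.length_cons]
  omega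
@[simp] theorem size_append (l l' : List α) : size (l ++ l') = size l + size l' := by
  simp [size, enc_append]

theorem length_le_size (l : List α) : l.length ≤ size l := by
  induction l with
  | nil => simp
  | cons a l ih => simp; omega

theorem size_le_of_mem {a : α} {l : List α} (h : a ∈ l) : size a ≤ size l := by
  induction l with
  | nil => simp at h
  | cons b l ih =>
    rcases List.mem_cons.1 h with rfl | h
    · simp; omega
    · have := ih h
      simp; omega

theorem size_list_le {l : List α} {B : ℕ} (h : ∀ a ∈ l, size a ≤ B) :
    size l ≤ l.length * (2 * B + 1) := by
  induction l with
  | nil => simp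
  | cons b l ih =>
    have h1 := ih fun a ha => h a (List.mem_cons_of_mem _ ha)
    have h2 := h b List.mem_cons_self
    rw [size_cons, List.length_cons, add_mul, one_mul]
    omega

theorem size_prefix_le {l l' : List α} (h : l' <+: l) : size l' ≤ size l := by
  obtain ⟨t, rfl⟩ := h
  simp

theorem size_suffix_le {l l' : List α} (h : l' <:+ l) : size l' ≤ size l := by
  obtain ⟨t, rfl⟩ := h
  simp

@[simp] theorem size_list_bool (l : List Bool) : size l = 3 * l.length := by
  induction l with
  | nil => rfl
  | cons b l ih => simp [ih]; ring

end Size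

/-! ### Polynomially bounded functions -/

/-- `f` is bounded by a polynomial in the size of its argument. -/
def PolyBdd {α : Type} [Code α] (f : α → ℕ) : Prop :=
  ∃ p : Polynomial ℕ, ∀ a, f a ≤ p.eval (size a)

namespace PolyBdd

variable {α β : Type} [Code α] [Code β] {f g : α → ℕ}

theorem const (n : ℕ) : PolyBdd (fun _ : α => n) := ⟨.C n, fun a => by simp⟩

theorem size_self : PolyBdd (fun a : α => size a) := ⟨.X, fun a => by simp⟩

theorem add (hf : PolyBdd f) (hg : PolyBdd g) : PolyBdd (fun a => f a + g a) := by
  obtain ⟨p, hp⟩ := hf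
  obtain ⟨q, hq⟩ := hg
  exact ⟨p + q, fun a => by simpa using add_le_add (hp a) (hq a)⟩

theorem mul (hf : PolyBdd f) (hg : PolyBdd g) : PolyBdd (fun a => f a * g a) := by
  obtain ⟨p, hp⟩ := hf
  obtain ⟨q, hq⟩ := hg
  exact ⟨p * q, fun a => by simpa using Nat.mul_le_mul (hp a) (hq a)⟩

theorem eval (p : Polynomial ℕ) (hf : PolyBdd f) : PolyBdd (fun a => p.eval (f a)) := by
  obtain ⟨q, hq⟩ := hf
  exact ⟨p.comp q, fun a => by simpa using eval_le_eval p (hq a)⟩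

end PolyBdd

/-! ### Polynomial time functions between data types -/

/-- `f` is computed in polynomial time on the codes. -/
@[fun_prop]
def PolyFun {α β : Type} [Code α] [Code β] (f : α → β) : Prop :=
  Poly (Code.enc : α → List Bool) (Code.enc : β → List Bool) f

theorem Poly.congr {α β γ A B : Type} {ea : α → List A} {eb : β → List B} {ec : γ → List B}
    {f : α → β} {g : α → γ} (hf : Poly ea eb f) (h : ∀ a, eb (f a) = ec (g a)) :
    Poly ea ec g := by
  obtain ⟨h1⟩ := hf
  exact ⟨⟨h1.toTM2ComputableAux, h1.time, fun a => h a ▸ h1.outputsFun a⟩⟩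

/-- The transducer that copies its input. -/
def copyTransducer : Transducer Bool Bool Unit := ⟨fun _ _ => (), fun _ o => o.toList⟩

theorem run_copyTransducer (l : List Bool) : copyTransducer.run () l = l := by
  induction l with
  | nil => rfl
  | cons b l ih => exact congrArg (b :: ·) ih

/-- The transducer that ignores its input. -/
def constTransducer (w : List Bool) : Transducer Bool Bool Unit :=
  ⟨fun _ _ => (), fun _ o => o.elim w (fun _ => [])⟩

theorem run_constTransducer (w l : List Bool) : (constTransducer w).run () l = w := by
  induction l with
  | nil => rfl
  | cons b l ih => exact ih

/-- The transducer that marks every bit of its input, and adds an end mark. -/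
def markTransducer : Transducer Bool Bool Unit :=
  ⟨fun _ _ => (), fun _ o => o.elim [false] (fun b => [true, b])⟩

theorem run_markTransducer (l : List Bool) : markTransducer.run () l = mark l ++ [false] := by
  induction l with
  | nil => rfl
  | cons b l ih => exact congrArg (fun t => true :: b :: t) ih

/-- The next state in the scan of `mark l ++ false :: l'`: the states `none` and `some false` occur
in the first part, and `some true` in the second. -/
def scanNext : Option Bool → Bool → Option Bool
  | none, true => some false
  | none, false => some true
  | some false, _ => none
  | some true, _ => some true

/-- The transducer that extracts the first component of a pair. -/
def fstTransducer : Transducer Bool Bool (Option Bool) where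
  next := scanNext
  out
    | some false, some b => [b]
    | _, _ => []

/-- The transducer that extracts the second component of a pair. -/
def sndTransducer : Transducer Bool Bool (Option Bool) where
  next := scanNext
  out
    | some true, some b => [b]
    | _, _ => []

theorem run_fstTransducer (l l' : List Bool) :
    fstTransducer.run none (mark l ++ false :: l') = l := by
  induction l with
  | nil =>
    have : ∀ l', fstTransducer.run (some true) l' = [] := by
      intro l'
      induction l' with
      | nil => rfl
      | cons b l ih => exact ih
    exact this l'
  | cons b l ih => exact congrArg (b :: ·) ih

theorem run_sndTransducer (l l' : List Bool) :
    sndTransducer.run none (mark l ++ false :: l') = l' := by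
  induction l with
  | nil =>
    have : ∀ l', sndTransducer.run (some true) l' = l' := by
      intro l'
      induction l' with
      | nil => rfl
      | cons b l ih => exact congrArg (b :: ·) ih
    exact this l'
  | cons b l ih => exact ih

/-- The transducer that extracts one of two strings, according to a bit. -/
def selectTransducer : Transducer Bool Bool (Bool ⊕ Bool ⊕ Bool × Option Bool) where
  next
    | .inl false, _ => .inl true
    | .inl true, b => .inr (.inl b)
    | .inr (.inl b), _ => .inr (.inr (b, none))
    | .inr (.inr (b, q)), a => .inr (.inr (b, scanNext q a))
  out
    | .inr (.inr (true, q)), o => fstTransducer.out q o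
    | .inr (.inr (false, q)), o => sndTransducer.out q o
    | _, _ => []

theorem run_selectTransducer (b : Bool) (l l' : List Bool) :
    selectTransducer.run (.inl false) (mark [b] ++ false :: (mark l ++ false :: l')) =
      if b then l else l' := by
  have h1 : ∀ m q, selectTransducer.run (.inr (.inr (true, q))) m = fstTransducer.run q m := by
    intro m
    induction m with
    | nil => intro q; rfl
    | cons a m ih => intro q; exact congrArg (fstTransducer.out q (some a) ++ ·) (ih _)
  have h2 : ∀ m q, selectTransducer.run (.inr (.inr (false, q))) m = sndTransducer.run q m := by
    intro m
    induction m with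
    | nil => intro q; rfl
    | cons a m ih => intro q; exact congrArg (sndTransducer.out q (some a) ++ ·) (ih _)
  cases b
  · exact (h2 _ none).trans (run_sndTransducer l l')
  · exact (h1 _ none).trans (run_fstTransducer l l')

/-- The transducer that drops the first bit. -/
def tailTransducer : Transducer Bool Bool Bool :=
  ⟨fun _ _ => true, fun q o => if q then o.toList else []⟩

theorem run_tailTransducer (l : List Bool) : tailTransducer.run false l = l.tail := by
  have h : ∀ l, tailTransducer.run true l = l := by
    intro l
    induction l with
    | nil => rfl
    | cons b l ih => exact congrArg (b :: ·) ih
  cases l with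
  | nil => rfl
  | cons b l => exact h l

/-- The transducer that tests whether its input is empty. -/
def emptyTransducer : Transducer Bool Bool Bool :=
  ⟨fun _ _ => true, fun q o => o.elim [!q] (fun _ => [])⟩

theorem run_emptyTransducer (l : List Bool) : emptyTransducer.run false l = [l.isEmpty] := by
  have h : ∀ l, emptyTransducer.run true l = [false] := by
    intro l
    induction l with
    | nil => rfl
    | cons b l ih => exact ih
  cases l with
  | nil => rfl
  | cons b l => exact h l

/-! ### Closure of polynomial-time functions under pairing, branching and elementary operations -/

namespace PolyFun

variable {α β γ δ : Type} [Code α] [Code β] [Code γ] [Code δ]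

theorem size_le {f : α → β} (hf : PolyFun f) : PolyBdd (fun a => size (f a)) := Poly.length_le hf

theorem of_enc {f : α → β} (h : ∀ a, Code.enc (f a) = Code.enc a) : PolyFun f :=
  copyTransducer.poly () fun a => (run_copyTransducer _).trans (h a).symm

theorem append_enc {f : α → β} {g : α → γ} {h : α → δ} (hf : PolyFun f) (hg : PolyFun g)
    (e : ∀ a, Code.enc (h a) = Code.enc (f a) ++ Code.enc (g a)) : PolyFun h := by
  have hf' : Poly (Code.enc : α → List Bool) id (fun a => Code.enc (f a)) := hf.congr fun _ => rfl
  have hg' : Poly (Code.enc : α → List Bool) id (fun a => Code.enc (g a)) := hg.congr fun _ => rfl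
  exact (hf'.append hg').congr fun a => (e a).symm

@[fun_prop] theorem id : PolyFun (fun a : α => a) := of_enc fun _ => rfl

@[fun_prop] theorem const (b : β) : PolyFun (fun _ : α => b) :=
  (constTransducer (Code.enc b)).poly () fun _ => run_constTransducer _ _

@[fun_prop] theorem comp {g : β → γ} {f : α → β} (hg : PolyFun g) (hf : PolyFun f) :
    PolyFun (fun a => g (f a)) := Poly.comp hg hf

@[fun_prop] theorem prodMk {f : α → β} {g : α → γ} (hf : PolyFun f) (hg : PolyFun g) :
    PolyFun (fun a => (f a, g a)) := by
  have h1 : Poly (Code.enc : β → List Bool) (_root_.id : List Bool → List Bool)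
      (fun b => mark (Code.enc b) ++ [false]) :=
    markTransducer.poly () fun b => run_markTransducer _
  have hg' : Poly (Code.enc : α → List Bool) _root_.id (fun a => Code.enc (g a)) :=
    hg.congr fun _ => rfl
  exact ((h1.comp hf).append hg').congr fun a => by simp [enc_pair]

theorem prod_fst : PolyFun (fun x : α × β => x.1) :=
  fstTransducer.poly none fun _ => run_fstTransducer _ _

theorem prod_snd : PolyFun (fun x : α × β => x.2) :=
  sndTransducer.poly none fun _ => run_sndTransducer _ _

@[fun_prop] theorem fst {f : α → β × γ} (hf : PolyFun f) : PolyFun (fun a => (f a).1) :=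
  prod_fst.comp hf

@[fun_prop] theorem snd {f : α → β × γ} (hf : PolyFun f) : PolyFun (fun a => (f a).2) :=
  prod_snd.comp hf

@[fun_prop] theorem ite {c : α → Bool} {f g : α → β} (hc : PolyFun c) (hf : PolyFun f)
    (hg : PolyFun g) : PolyFun (fun a => if c a then f a else g a) := by
  have h : PolyFun (fun x : Bool × β × β => if x.1 then x.2.1 else x.2.2) :=
    selectTransducer.poly (.inl false) fun x => by
      refine (run_selectTransducer x.1 _ _).trans ?_
      cases x.1 <;> rfl
  exact h.comp (hc.prodMk (hf.prodMk hg))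

@[fun_prop] theorem not {c : α → Bool} (hc : PolyFun c) : PolyFun (fun a => !(c a)) := by
  have h : PolyFun (fun a => if c a then false else true) := by fun_prop
  exact h.congr fun a => by cases c a <;> rfl

@[fun_prop] theorem and {c d : α → Bool} (hc : PolyFun c) (hd : PolyFun d) :
    PolyFun (fun a => c a && d a) := by
  have h : PolyFun (fun a => if c a then d a else false) := by fun_prop
  exact h.congr fun a => by cases c a <;> rfl

@[fun_prop] theorem or {c d : α → Bool} (hc : PolyFun c) (hd : PolyFun d) :
    PolyFun (fun a => c a || d a) := by
  have h : PolyFun (fun a => if c a then true else d a) := by fun_prop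
  exact h.congr fun a => by cases c a <;> rfl

@[fun_prop] theorem beq_bool {c d : α → Bool} (hc : PolyFun c) (hd : PolyFun d) :
    PolyFun (fun a => c a == d a) := by
  have h : PolyFun (fun a => if c a then d a else !(d a)) := by fun_prop
  exact h.congr fun a => by cases c a <;> cases d a <;> rfl

/-! #### Numbers and lists -/

@[fun_prop] theorem add {f g : α → ℕ} (hf : PolyFun f) (hg : PolyFun g) :
    PolyFun (fun a => f a + g a) :=
  hf.append_enc hg fun a => by simp [enc_nat]

@[fun_prop] theorem pred {f : α → ℕ} (hf : PolyFun f) : PolyFun (fun a => f a - 1) := by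
  have h : PolyFun (fun n : ℕ => n - 1) := tailTransducer.poly false fun n =>
    (run_tailTransducer _).trans (by simp [enc_nat])
  exact h.comp hf

@[fun_prop] theorem eq_zero {f : α → ℕ} (hf : PolyFun f) : PolyFun (fun a => decide (f a = 0)) := by
  have h : PolyFun (fun n : ℕ => decide (n = 0)) := emptyTransducer.poly false fun n =>
    (run_emptyTransducer _).trans (by cases n <;> rfl)
  exact h.comp hf

@[fun_prop] theorem cons {f : α → β} {g : α → List β} (hf : PolyFun f) (hg : PolyFun g) :
    PolyFun (fun a => f a :: g a) :=
  (hf.prodMk hg).congr fun _ => (enc_cons _ _).symm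

@[fun_prop] theorem append {f g : α → List β} (hf : PolyFun f) (hg : PolyFun g) :
    PolyFun (fun a => f a ++ g a) :=
  hf.append_enc hg fun _ => enc_append _ _

@[fun_prop] theorem isEmpty {f : α → List β} (hf : PolyFun f) :
    PolyFun (fun a => (f a).isEmpty) := by
  have h : PolyFun (fun l : List β => l.isEmpty) := emptyTransducer.poly false fun l =>
    (run_emptyTransducer _).trans (by cases l <;> simp [enc_nil, enc_cons, enc_bool])
  exact h.comp hf

@[fun_prop] theorem tail {f : α → List β} (hf : PolyFun f) : PolyFun (fun a => (f a).tail) := by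
  have h : PolyFun (fun l : List β => l.tail) := sndTransducer.poly none fun l => by
    cases l with
    | nil => rfl
    | cons a l => rw [enc_cons, run_sndTransducer]; rfl
  exact h.comp hf

@[fun_prop] theorem headD {f : α → List β} {d : α → β} (hf : PolyFun f) (hd : PolyFun d) :
    PolyFun (fun a => (f a).headD (d a)) := by
  have h : PolyFun (fun x : List β × β => x.1.headD x.2) := by
    -- With the default appended the list is never empty, and its head is the first component of a
    -- pair code.
    have h1 : Poly (fun x : List β × β => Code.enc (x.1 ++ [x.2])) Code.enc
        (fun x : List β × β => x.1.headD x.2) := fstTransducer.poly none fun x => by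
      obtain ⟨l, d⟩ := x
      cases l with
      | nil => exact (congrArg _ (enc_cons d [])).trans (run_fstTransducer (Code.enc d) _)
      | cons a l =>
        exact (congrArg _ (enc_cons _ _)).trans (run_fstTransducer (Code.enc a) _)
    have h2 : PolyFun (fun x : List β × β => x.1 ++ [x.2]) := by fun_prop
    exact h1.comp (h2.congr (ec := fun x : List β × β => Code.enc (x.1 ++ [x.2])) (g := _root_.id)
      fun _ => rfl)
  exact h.comp (hf.prodMk hd)

end PolyFun

namespace PolyFun

variable {α β γ δ : Type} [Code α] [Code β] [Code γ] [Code δ]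

/-! #### Bounded recursion -/

/-- One step of the evaluation of a fold: remaining list, accumulator, parameter. -/
def foldStep [Inhabited α] (step : γ → β → α → β) (x : List α × β × γ) : List α × β × γ :=
  if x.1.isEmpty then x else (x.1.tail, step x.2.2 x.2.1 (x.1.headD default), x.2.2)

omit [Code α] [Code β] [Code γ] in
-- The step is the identity once the list is used up, so superfluous iterations do no harm.
theorem foldStep_iterate [Inhabited α] (step : γ → β → α → β) (l : List α) (b : β) (c : γ) (n : ℕ) :
    (foldStep step)^[n] (l, b, c) = (l.drop n, (l.take n).foldl (step c) b, c) := by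
  induction n generalizing l b with
  | zero => simp
  | succ n ih =>
    rw [iterate_succ_apply]
    cases l with
    | nil => simpa [foldStep] using ih [] b
    | cons a l => simpa [foldStep] using ih l (step c b a)

/-- The main tool for polynomial time. A polynomial-time step alone does not suffice, since iterated
steps could square the size each time; so the accumulators on all prefixes must be polynomially
bounded. -/
theorem foldl [Inhabited α] {l : γ → List α} {init : γ → β} {step : γ → β → α → β}
    (hl : PolyFun l) (hi : PolyFun init)
    (hs : PolyFun (fun x : γ × β × α => step x.1 x.2.1 x.2.2))
    {bound : γ → ℕ} (hb : PolyBdd bound)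
    (h : ∀ c l', l' <+: l c → size (l'.foldl (step c) (init c)) ≤ bound c) :
    PolyFun (fun c => (l c).foldl (step c) (init c)) := by
  have hstep : PolyFun (foldStep step) := by
    have : PolyFun (fun x : List α × β × γ => step x.2.2 x.2.1 (x.1.headD default)) :=
      hs.comp (f := fun x : List α × β × γ => (x.2.2, x.2.1, x.1.headD default)) (by fun_prop)
    unfold foldStep
    fun_prop
  have hι : PolyFun (fun c => (l c, init c, c)) := by fun_prop
  obtain ⟨p, hp⟩ := hb
  -- The summand `X` pays for the remaining list and the parameter, and `2 * p` for the accumulator,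
  -- whose code is doubled inside a pair.
  have hit := Poly.iterate hstep (fun c => (l c, init c, c)) (.X + 2 * p) (fun c i _ => by
    rw [foldStep_iterate]
    have h1 := h c _ (List.take_prefix i (l c))
    have h2 := hp c
    have h3 := size_suffix_le (List.drop_suffix i (l c))
    have h4 : size c ≤ size (l c, init c, c) := by simp; omega
    have h5 := eval_le_eval p h4
    change size _ ≤ Polynomial.eval (size _) _
    simp only [Polynomial.eval_add, Polynomial.eval_X, Polynomial.eval_mul, Polynomial.eval_ofNat]
    simp only [size_pair] at h5 ⊢
    omega)
  have h2 := hit.comp (hι.congr (g := _root_.id) fun _ => rfl)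
  have h3 : PolyFun (fun x : List α × β × γ => x.2.1) := by fun_prop
  have h4 := Poly.comp h3 h2
  refine h4.congr fun c => ?_
  simp only [_root_.id, foldStep_iterate]
  -- The number of iterations is the size of the whole initial state, which is at least the length
  -- of the list.
  rw [List.take_of_length_le]
  refine le_trans (length_le_size _) ?_
  change _ ≤ size _
  simp only [size_pair]
  omega

/-- Iteration. -/
theorem iterate {n : γ → ℕ} {init : γ → β} {step : γ → β → β} (hn : PolyFun n) (hi : PolyFun init)
    (hs : PolyFun (fun x : γ × β => step x.1 x.2)) {bound : γ → ℕ} (hb : PolyBdd bound)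
    (h : ∀ c, ∀ i ≤ n c, size ((step c)^[i] (init c)) ≤ bound c) :
    PolyFun (fun c => (step c)^[n c] (init c)) := by
  have hf : ∀ (s : β → β) (l : List Unit) (b : β), l.foldl (fun b _ => s b) b = s^[l.length] b := by
    intro s l
    induction l with
    | nil => intro b; rfl
    | cons a l ih => intro b; exact ih _
  -- A list of `n` units and the number `n` have the same code, so a loop is a fold over units.
  have hl : PolyFun (fun c => List.replicate (n c) ()) := hn.congr fun c => by
    rw [enc_nat]
    induction n c with
    | zero => rfl
    | succ k ih => rw [List.replicate_succ, List.replicate_succ, ih, enc_cons]; rfl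
  have := foldl (step := fun c b _ => step c b) hl hi
    (hs.comp (f := fun x : γ × β × Unit => (x.1, x.2.1)) (by fun_prop)) hb (fun c l' hl' => by
      rw [hf]
      exact h c _ (by simpa using hl'.length_le))
  simpa only [hf, List.length_replicate] using this

/-! #### Operations on lists and numbers -/

theorem map [Inhabited α] {l : γ → List α} {f : γ → α → β} (hl : PolyFun l)
    (hf : PolyFun (fun x : γ × α => f x.1 x.2)) : PolyFun (fun c => (l c).map (f c)) := by
  have he : ∀ (g : α → β) (l : List α) (b : List β),
      l.foldl (fun b a => b ++ [g a]) b = b ++ l.map g := by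
    intro g l
    induction l with
    | nil => simp
    | cons a l ih => intro b; simp [ih]
  obtain ⟨q, hq⟩ := hf.size_le
  have hls := hl.size_le
  have hb : PolyBdd (fun c => size (l c) * (2 * q.eval (2 * size c + 1 + size (l c)) + 1)) :=
    hls.mul (((PolyBdd.const 2).mul (((((PolyBdd.const 2).mul .size_self).add (.const 1)).add
      hls).eval q)).add (.const 1))
  have := foldl (init := fun _ => []) (step := fun c b a => b ++ [f c a]) hl (const _)
    (by
      have := hf.comp (f := fun x : γ × List β × α => (x.1, x.2.2)) (by fun_prop)
      fun_prop) hb (fun c l' hl' => by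
      rw [he, List.nil_append]
      refine (size_list_le (B := q.eval (2 * size c + 1 + size (l c))) ?_).trans
        (Nat.mul_le_mul_right _ ?_)
      · intro b hb
        obtain ⟨a, ha, rfl⟩ := List.mem_map.1 hb
        refine (hq (c, a)).trans (eval_le_eval q ?_)
        have := size_le_of_mem (hl'.subset ha)
        simp only [size_pair]
        omega
      · rw [List.length_map]
        exact hl'.length_le.trans (length_le_size _))
  simpa only [he, List.nil_append] using this

-- Replacing every element by the unit turns the code of the list into the unary code of its length.
@[fun_prop] theorem length [Inhabited β] {f : α → List β} (hf : PolyFun f) :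
    PolyFun (fun a => (f a).length) :=
  (map (f := fun _ _ => ()) hf (const _)).congr fun a => by
    rw [enc_nat]
    induction f a with
    | nil => rfl
    | cons b l ih => rw [List.map_cons, enc_cons, ih]; rfl

@[fun_prop] theorem sub {f g : α → ℕ} (hf : PolyFun f) (hg : PolyFun g) :
    PolyFun (fun a => f a - g a) := by
  have he : ∀ m n : ℕ, (fun k => k - 1)^[n] m = m - n := by
    intro m n
    induction n with
    | zero => rfl
    | succ n ih => rw [iterate_succ_apply', ih]; omega
  have := iterate (step := fun _ k => k - 1) hg hf (by fun_prop) hf.size_le (fun a i _ => by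
    simp [he])
  simpa only [he] using this

@[fun_prop] theorem mul {f g : α → ℕ} (hf : PolyFun f) (hg : PolyFun g) :
    PolyFun (fun a => f a * g a) := by
  have he : ∀ m n : ℕ, (fun k => k + m)^[n] 0 = m * n := by
    intro m n
    induction n with
    | zero => rfl
    | succ n ih => rw [iterate_succ_apply', ih]; ring
  have := iterate (init := fun _ => 0) (step := fun a k => k + f a) hg (const _)
    (by fun_prop) (hf.size_le.mul hg.size_le) (fun a i hi => by
    simpa [he] using Nat.mul_le_mul_left _ hi)
  simpa only [he] using this

@[fun_prop] theorem le {f g : α → ℕ} (hf : PolyFun f) (hg : PolyFun g) :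
    PolyFun (fun a => decide (f a ≤ g a)) := by
  have : PolyFun (fun a => decide (f a - g a = 0)) := by fun_prop
  simpa only [Nat.sub_eq_zero_iff_le] using this

@[fun_prop] theorem lt {f g : α → ℕ} (hf : PolyFun f) (hg : PolyFun g) :
    PolyFun (fun a => decide (f a < g a)) := by
  have : PolyFun (fun a => decide (f a + 1 ≤ g a)) := by fun_prop
  simpa only [Nat.succ_le_iff] using this

@[fun_prop] theorem eq_nat {f g : α → ℕ} (hf : PolyFun f) (hg : PolyFun g) :
    PolyFun (fun a => decide (f a = g a)) := by
  have : PolyFun (fun a => decide (f a ≤ g a) && decide (g a ≤ f a)) := by fun_prop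
  exact this.congr fun a => congrArg _ (by
    rw [Bool.eq_iff_iff]
    simp only [Bool.and_eq_true, decide_eq_true_eq]
    omega)

@[fun_prop] theorem range {f : α → ℕ} (hf : PolyFun f) : PolyFun (fun a => List.range (f a)) := by
  have he : ∀ n : ℕ, (fun l : List ℕ => l ++ [l.length])^[n] [] = List.range n := by
    intro n
    induction n with
    | zero => rfl
    | succ n ih => rw [iterate_succ_apply', ih, List.length_range, List.range_succ]
  have hs := hf.size_le
  have := iterate (init := fun _ => []) (step := fun _ (l : List ℕ) => l ++ [l.length]) hf (const _)
    (by fun_prop) (hs.mul (((PolyBdd.const 2).mul hs).add (.const 1))) (fun a i hi => by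
      rw [he]
      refine (size_list_le (B := f a) ?_).trans ?_
      · intro j hj
        have := List.mem_range.1 hj
        simp; omega
      · rw [List.length_range, size_nat]
        exact Nat.mul_le_mul_right _ hi)
  simpa only [he] using this

@[fun_prop] theorem flatten [Inhabited β] {f : α → List (List β)} (hf : PolyFun f) :
    PolyFun (fun a => (f a).flatten) := by
  have he : ∀ (L : List (List β)) b, L.foldl (fun b l => b ++ l) b = b ++ L.flatten := by
    intro L
    induction L with
    | nil => simp
    | cons l L ih => intro b; simp [ih]
  have hsz : ∀ L : List (List β), size L.flatten ≤ size L := by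
    intro L
    induction L with
    | nil => simp
    | cons l L ih => simp; omega
  have := foldl (init := fun _ => []) (step := fun _ (b : List β) l => b ++ l) hf (const _)
    (by fun_prop) hf.size_le (fun a l' hl' => by
      rw [he, List.nil_append]
      exact (hsz l').trans (size_prefix_le hl'))
  simpa only [he, List.nil_append] using this

theorem flatMap [Inhabited α] [Inhabited β] {l : γ → List α} {f : γ → α → List β} (hl : PolyFun l)
    (hf : PolyFun (fun x : γ × α => f x.1 x.2)) : PolyFun (fun c => (l c).flatMap (f c)) := by
  simpa only [List.flatMap_def] using (map hl hf).flatten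

@[fun_prop] theorem drop [Inhabited β] {f : α → List β} {n : α → ℕ} (hn : PolyFun n)
    (hf : PolyFun f) : PolyFun (fun a => (f a).drop (n a)) := by
  have he : ∀ (l : List β) n, List.tail^[n] l = l.drop n := by
    intro l n
    induction n with
    | zero => rfl
    | succ n ih => rw [iterate_succ_apply', ih, List.tail_drop]
  have := iterate (step := fun _ => List.tail) hn hf (by fun_prop) hf.size_le (fun a i _ => by
    rw [he]
    exact size_suffix_le (List.drop_suffix _ _))
  simpa only [he] using this

@[fun_prop] theorem getD [Inhabited β] {f : α → List β} {n : α → ℕ} {d : α → β}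
    (hf : PolyFun f) (hn : PolyFun n) (hd : PolyFun d) :
    PolyFun (fun a => (f a).getD (n a) (d a)) := by
  have : PolyFun (fun a => ((f a).drop (n a)).headD (d a)) := by fun_prop
  refine this.congr fun a => ?_
  rw [List.headD_eq_head?_getD, List.head?_drop, List.getD_eq_getElem?_getD]

@[fun_prop] theorem take [Inhabited β] {f : α → List β} {n : α → ℕ} (hn : PolyFun n)
    (hf : PolyFun f) : PolyFun (fun a => (f a).take (n a)) := by
  -- The truncated difference `n - (n - length)` is the minimum of `n` and the length.
  have h : PolyFun (fun a => (List.range (n a - (n a - (f a).length))).map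
      (fun i => (f a).getD i default)) := map (by fun_prop) (by fun_prop)
  refine h.congr fun a => congrArg _ ?_
  refine List.ext_getElem ?_ fun i h1 h2 => ?_
  · simp; omega
  · have : i < (f a).length := by simp at h2; omega
    simp [this]

theorem all [Inhabited α] {l : γ → List α} {f : γ → α → Bool} (hl : PolyFun l)
    (hf : PolyFun (fun x : γ × α => f x.1 x.2)) : PolyFun (fun c => (l c).all (f c)) := by
  have he : ∀ (p : α → Bool) (l : List α) (b : Bool),
      l.foldl (fun b a => b && p a) b = (b && l.all p) := by
    intro p l
    induction l with
    | nil => simp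
    | cons a l ih => intro b; simp [ih, Bool.and_assoc]
  have := foldl (init := fun _ => true) (step := fun c b a => b && f c a) hl (const _)
    (by
      have := hf.comp (f := fun x : γ × Bool × α => (x.1, x.2.2)) (by fun_prop)
      fun_prop) (.const 1) (fun c l' _ => by simp)
  simpa only [he, Bool.true_and] using this

@[fun_prop] theorem eq_list {f g : α → List Bool} (hf : PolyFun f) (hg : PolyFun g) :
    PolyFun (fun a => decide (f a = g a)) := by
  have h : PolyFun (fun a => decide ((f a).length = (g a).length) &&
      (List.range (f a).length).all (fun i => (f a).getD i false == (g a).getD i false)) :=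
    and (by fun_prop) (all (by fun_prop) (by fun_prop))
  refine h.congr fun a => congrArg _ ?_
  rw [Bool.eq_iff_iff]
  simp only [Bool.and_eq_true, decide_eq_true_eq, List.all_eq_true, List.mem_range, beq_iff_eq]
  constructor
  · rintro ⟨h1, h2⟩
    refine List.ext_getElem h1 fun i hi hi' => ?_
    simpa [hi, hi'] using h2 i hi
  · intro h
    simp [h]

end PolyFun

/-! ### Strings, pairs of strings and their codes -/

/-- From a string to its code as a list. -/
def encodeTransducer : Transducer Bool Bool Unit :=
  ⟨fun _ _ => (), fun _ o => o.elim [] (fun b => [true, b, false])⟩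

theorem run_encodeTransducer (l : List Bool) : encodeTransducer.run () l = Code.enc l := by
  induction l with
  | nil => rfl
  | cons b l ih =>
    rw [enc_cons, enc_bool, ← ih]
    rfl

/-- From the code of a list of bits to the list. -/
def decodeTransducer : Transducer Bool Bool (Fin 3) where
  next q _ := q + 1
  out
    | 1, some b => [b]
    | _, _ => []

theorem run_decodeTransducer (l : List Bool) : decodeTransducer.run 0 (Code.enc l) = l := by
  induction l with
  | nil => rfl
  | cons b l ih =>
    rw [enc_cons, enc_bool]
    have h : decodeTransducer.run 0 (mark [b] ++ false :: Code.enc l) =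
        b :: decodeTransducer.run 0 (Code.enc l) := by
      simp [mark, Transducer.run, decodeTransducer]
    rw [h, ih]

/-- From a pair of strings, separated by a marker, to its code. -/
def encodePairTransducer : Transducer (Option Bool) Bool Bool where
  next q o := q || o.isNone
  out
    | false, some (some b) => [true, true, true, b, true, false]
    | false, some none => [false]
    | true, some (some b) => [true, b, false]
    | _, _ => []

theorem run_encodePairTransducer (x y : List Bool) :
    encodePairTransducer.run false (pairEnc (x, y)) = Code.enc (x, y) := by
  induction x with
  | nil =>
    have h : ∀ y : List Bool, encodePairTransducer.run true (y.map some) = Code.enc y := by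
      intro y
      induction y with
      | nil => rfl
      | cons b l ih =>
        rw [enc_cons, enc_bool, ← ih]
        rfl
    exact congrArg (false :: ·) (h y)
  | cons b x ih =>
    rw [enc_pair] at ih ⊢
    rw [enc_cons, enc_bool]
    exact congrArg ([true, true, true, b, true, false] ++ ·) ih

/-- From the code of a pair of strings to the pair, separated by a marker. -/
def decodePairTransducer : Transducer Bool (Option Bool) (Fin 6 ⊕ Fin 3) where
  next
    | .inl q, b => if q = 0 ∧ b = false then .inr 0 else .inl (q + 1)
    | .inr q, _ => .inr (q + 1)
  out
    | .inl 0, some false => [none]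
    | .inl 3, some b => [some b]
    | .inr 1, some b => [some b]
    | _, _ => []

/-- A bit `b` of the first string is coded as `[true, b, false]` and then marked to six symbols,
with `b` at position 3. A `false` at position 0 is the separator. In the second string a bit takes
three symbols, with `b` at position 1. -/
theorem run_decodePairTransducer (x y : List Bool) :
    decodePairTransducer.run (.inl 0) (Code.enc (x, y)) = pairEnc (x, y) := by
  induction x with
  | nil =>
    have h : ∀ y : List Bool, decodePairTransducer.run (.inr 0) (Code.enc y) = y.map some := by
      intro y
      induction y with
      | nil => rfl
      | cons b l ih =>
        rw [enc_cons, enc_bool]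
        exact congrArg (some b :: ·) ih
    exact congrArg (none :: ·) (h y)
  | cons b x ih =>
    rw [enc_pair] at ih ⊢
    rw [enc_cons, enc_bool]
    exact congrArg (some b :: ·) ih

theorem poly_encode : Poly (id : List Bool → List Bool) Code.enc (fun l : List Bool => l) :=
  encodeTransducer.poly () run_encodeTransducer

theorem poly_decode : Poly Code.enc (id : List Bool → List Bool) (fun l : List Bool => l) :=
  decodeTransducer.poly 0 run_decodeTransducer

/-- Transducers translate between a string and its code as a list of bits, so the notion on raw
strings may be replaced by the one on codes. -/
theorem polyTime_iff {f : List Bool → List Bool} : PolyTime f ↔ PolyFun f :=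
  ⟨fun h => poly_encode.comp (Poly.comp h poly_decode),
    fun h => poly_decode.comp (Poly.comp h poly_encode)⟩

theorem polyTime₂_iff {g : List Bool × List Bool → List Bool} : PolyTime₂ g ↔ PolyFun g := by
  have h1 : Poly pairEnc Code.enc (fun p : List Bool × List Bool => p) :=
    encodePairTransducer.poly false fun p => run_encodePairTransducer p.1 p.2
  have h2 : Poly Code.enc pairEnc (fun p : List Bool × List Bool => p) :=
    decodePairTransducer.poly (.inl 0) fun p => run_decodePairTransducer p.1 p.2
  exact ⟨fun h => poly_encode.comp (Poly.comp h h2), fun h => poly_decode.comp (Poly.comp h h1)⟩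

/-! ### Reductions -/

theorem Reducible.trans {R S U : SearchProblem} (h : Reducible R S) (h' : Reducible S U) :
    Reducible R U := by
  obtain ⟨f, g, hf, hg, hR⟩ := h
  obtain ⟨f', g', hf', hg', hS⟩ := h'
  rw [polyTime_iff] at hf hf'
  rw [polyTime₂_iff] at hg hg'
  refine ⟨fun x => f' (f x), fun p => g (p.1, g' (f p.1, p.2)), polyTime_iff.2 (by fun_prop),
    polyTime₂_iff.2 (by fun_prop), fun x y h => hR x _ (hS _ _ h)⟩

/-! ### Circuits as data -/

instance : Inhabited Gate := ⟨⟨fun _ _ => false, 0, 0⟩⟩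

/-- The truth table and the wires of a gate. -/
def Gate.data (g : Gate) : (Bool × Bool × Bool × Bool) × ℕ × ℕ :=
  ((g.op false false, g.op false true, g.op true false, g.op true true), g.left, g.right)

instance : Code Gate := ⟨fun g => Code.enc g.data⟩

instance : Code Circuit := ⟨fun C => Code.enc (C.numInputs, C.gates, C.outputs)⟩

/-- The Boolean function with the given truth table. -/
def ofTable (a b c d : Bool) (x y : Bool) : Bool :=
  if x then (if y then d else c) else (if y then b else a)

theorem ofTable_op (f : Bool → Bool → Bool) :
    ofTable (f false false) (f false true) (f true false) (f true true) = f := by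
  funext x y
  cases x <;> cases y <;> rfl

/-- Increase the numbers of the wires that a gate reads. -/
def Gate.shift (g : Gate) (s : ℕ) : Gate := ⟨g.op, s + g.left, s + g.right⟩

/-- The value of a gate. -/
def Gate.val (g : Gate) (vs : List Bool) : Bool := g.op (wire vs g.left) (wire vs g.right)

namespace PolyFun

variable {γ : Type} [Code γ]

theorem gate_data : PolyFun Gate.data := of_enc fun _ => rfl

@[fun_prop] theorem gate_left {g : γ → Gate} (hg : PolyFun g) : PolyFun (fun c => (g c).left) :=
  (by fun_prop : PolyFun (fun x : (Bool × Bool × Bool × Bool) × ℕ × ℕ => x.2.1)).comp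
    (gate_data.comp hg)

@[fun_prop] theorem gate_right {g : γ → Gate} (hg : PolyFun g) : PolyFun (fun c => (g c).right) :=
  (by fun_prop : PolyFun (fun x : (Bool × Bool × Bool × Bool) × ℕ × ℕ => x.2.2)).comp
    (gate_data.comp hg)

-- The code of a gate contains its truth table, so evaluating the gate is a table lookup.
@[fun_prop] theorem gate_op {g : γ → Gate} {a b : γ → Bool} (hg : PolyFun g) (ha : PolyFun a)
    (hb : PolyFun b) : PolyFun (fun c => (g c).op (a c) (b c)) := by
  have h : PolyFun (fun x : ((Bool × Bool × Bool × Bool) × ℕ × ℕ) × Bool × Bool =>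
      if x.2.1 then (if x.2.2 then x.1.1.2.2.2 else x.1.1.2.2.1)
      else (if x.2.2 then x.1.1.2.1 else x.1.1.1)) := by fun_prop
  refine (h.comp (f := fun c => ((g c).data, a c, b c)) ((gate_data.comp hg).prodMk
    (ha.prodMk hb))).congr fun c => ?_
  dsimp only
  cases a c <;> cases b c <;> rfl

@[fun_prop] theorem gate_mk {op : Bool → Bool → Bool} {l r : γ → ℕ} (hl : PolyFun l)
    (hr : PolyFun r) : PolyFun (fun c => Gate.mk op (l c) (r c)) :=
  (by fun_prop : PolyFun (fun c => ((op false false, op false true, op true false, op true true),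
    l c, r c))).congr fun _ => rfl

@[fun_prop] theorem gate_ofTable {o₁ o₂ o₃ o₄ : γ → Bool} {l r : γ → ℕ} (h₁ : PolyFun o₁)
    (h₂ : PolyFun o₂) (h₃ : PolyFun o₃) (h₄ : PolyFun o₄) (hl : PolyFun l)
    (hr : PolyFun r) :
    PolyFun (fun c => Gate.mk (ofTable (o₁ c) (o₂ c) (o₃ c) (o₄ c)) (l c) (r c)) :=
  (by fun_prop : PolyFun (fun c => ((o₁ c, o₂ c, o₃ c, o₄ c), l c, r c))).congr fun _ => rfl

@[fun_prop] theorem gate_shift {g : γ → Gate} {s : γ → ℕ} (hg : PolyFun g) (hs : PolyFun s) :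
    PolyFun (fun c => (g c).shift (s c)) := by
  have h : PolyFun (fun x : ((Bool × Bool × Bool × Bool) × ℕ × ℕ) × ℕ =>
      (x.1.1, x.2 + x.1.2.1, x.2 + x.1.2.2)) := by fun_prop
  exact (h.comp (f := fun c => ((g c).data, s c)) ((gate_data.comp hg).prodMk hs)).congr
    fun _ => rfl

theorem circuit_data : PolyFun (fun C : Circuit => (C.numInputs, C.gates, C.outputs)) :=
  of_enc fun _ => rfl

@[fun_prop] theorem numInputs {C : γ → Circuit} (hC : PolyFun C) :
    PolyFun (fun c => (C c).numInputs) :=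
  (by fun_prop : PolyFun (fun x : ℕ × List Gate × List ℕ => x.1)).comp (circuit_data.comp hC)

@[fun_prop] theorem gates {C : γ → Circuit} (hC : PolyFun C) : PolyFun (fun c => (C c).gates) :=
  (by fun_prop : PolyFun (fun x : ℕ × List Gate × List ℕ => x.2.1)).comp (circuit_data.comp hC)

@[fun_prop] theorem outputs {C : γ → Circuit} (hC : PolyFun C) : PolyFun (fun c => (C c).outputs) :=
  (by fun_prop : PolyFun (fun x : ℕ × List Gate × List ℕ => x.2.2)).comp (circuit_data.comp hC)

@[fun_prop] theorem circuit_mk {n : γ → ℕ} {g : γ → List Gate} {o : γ → List ℕ} (hn : PolyFun n)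
    (hg : PolyFun g) (ho : PolyFun o) : PolyFun (fun c => Circuit.mk (n c) (g c) (o c)) :=
  (by fun_prop : PolyFun (fun c => (n c, g c, o c))).congr fun _ => rfl

/-! #### Evaluation -/

@[fun_prop] theorem wire {v : γ → List Bool} {i : γ → ℕ} (hv : PolyFun v) (hi : PolyFun i) :
    PolyFun (fun c => wire (v c) (i c)) := by
  unfold KonigPPP.wire
  fun_prop

end PolyFun

/-- The values of the wires after the evaluation of a list of gates. -/
def runGates (gs : List Gate) (vs : List Bool) : List Bool :=
  gs.foldl (fun vs g => vs ++ [g.val vs]) vs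

theorem Circuit.wires_eq (C : Circuit) (x : List Bool) : C.wires x = runGates C.gates x := rfl

@[simp] theorem runGates_nil (vs : List Bool) : runGates [] vs = vs := rfl

@[simp] theorem runGates_cons (g : Gate) (gs : List Gate) (vs : List Bool) :
    runGates (g :: gs) vs = runGates gs (vs ++ [g.val vs]) := rfl

theorem runGates_append (gs gs' : List Gate) (vs : List Bool) :
    runGates (gs ++ gs') vs = runGates gs' (runGates gs vs) := List.foldl_append

@[simp] theorem length_runGates (gs : List Gate) (vs : List Bool) :
    (runGates gs vs).length = vs.length + gs.length := by
  induction gs generalizing vs with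
  | nil => simp
  | cons g gs ih => simp [ih]; omega

namespace PolyFun

variable {γ : Type} [Code γ]

@[fun_prop] theorem wires {C : γ → Circuit} {x : γ → List Bool} (hC : PolyFun C)
    (hx : PolyFun x) : PolyFun (fun c => (C c).wires (x c)) := by
  refine foldl (l := fun c => (C c).gates) (init := x)
    (step := fun _ vs g => vs ++ [g.val vs]) (by fun_prop) hx (by unfold Gate.val; fun_prop)
    (hx.size_le.add ((PolyBdd.const 3).mul (gates hC).size_le)) (fun c l' hl' => ?_)
  have h := length_runGates l' (x c)
  have h1 := hl'.length_le
  have h2 := length_le_size (C c).gates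
  change size (runGates l' (x c)) ≤ _
  rw [size_list_bool, size_list_bool]
  omega

@[fun_prop] theorem eval {C : γ → Circuit} {x : γ → List Bool} (hC : PolyFun C)
    (hx : PolyFun x) : PolyFun (fun c => (C c).eval (x c)) :=
  map (by fun_prop) (by fun_prop)

/-! #### Encoding as a string -/

@[fun_prop] theorem encNat {n : γ → ℕ} (hn : PolyFun n) : PolyFun (fun c => encNat (n c)) := by
  have : PolyFun (fun c => (List.range (n c)).map (fun _ => true) ++ [false]) :=
    append (map (by fun_prop) (by fun_prop)) (const _)
  simpa [KonigPPP.encNat] using this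

theorem encList {α : Type} [Code α] [Inhabited α] {e : α → List Bool} {l : γ → List α}
    (he : PolyFun e) (hl : PolyFun l) : PolyFun (fun c => encList e (l c)) :=
  append (flatMap hl (by fun_prop)) (const _)

theorem encGate : PolyFun encGate := by
  unfold KonigPPP.encGate
  fun_prop

@[fun_prop] theorem circuit_enc {C : γ → Circuit} (hC : PolyFun C) :
    PolyFun (fun c => (C c).enc) := by
  have h1 : PolyFun (fun c => KonigPPP.encList KonigPPP.encGate (C c).gates) :=
    encList encGate (by fun_prop)
  have h2 : PolyFun (fun c => KonigPPP.encList KonigPPP.encNat (C c).outputs) :=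
    encList (by fun_prop) (by fun_prop)
  unfold Circuit.enc
  fun_prop

end PolyFun

/-! ### Parsing -/

/-- `p` reads a value with the self-delimiting code `e` off a string. -/
def Parses {α : Type} (p : List Bool → α × List Bool) (e : α → List Bool) : Prop :=
  ∀ a r, p (e a ++ r) = (a, r)

/-- A code that can be parsed is uniquely decodable, even when followed by arbitrary text. -/
theorem Parses.inj {α : Type} {p : List Bool → α × List Bool} {e : α → List Bool}
    (h : Parses p e) {a a' : α} {r r' : List Bool} (he : e a ++ r = e a' ++ r') :
    a = a' ∧ r = r' := by
  have h1 := h a r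
  rw [he, h a' r'] at h1
  exact ⟨(congrArg Prod.fst h1).symm, (congrArg Prod.snd h1).symm⟩

/-- One step of the parser for lists: list read so far, rest of the string, end flag. -/
def parseListStep {α : Type} (p : List Bool → α × List Bool) (s : List α × List Bool × Bool) :
    List α × List Bool × Bool :=
  if s.2.2 then s
  else if s.2.1.headD false then (s.1 ++ [(p s.2.1.tail).1], (p s.2.1.tail).2, false)
  else (s.1, s.2.1.tail, true)

/-- The parser for lists. -/
def parseList {α : Type} (p : List Bool → α × List Bool) (x : List Bool) : List α × List Bool :=
  (((parseListStep p)^[x.length] ([], x, false)).1, ((parseListStep p)^[x.length] ([], x, false)).2.1)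

theorem Parses.list {α : Type} {p : List Bool → α × List Bool} {e : α → List Bool}
    (h : Parses p e) : Parses (parseList p) (encList e) := by
  have hdone : ∀ n (l : List α) r, (parseListStep p)^[n] (l, r, true) = (l, r, true) := fun n l r =>
    iterate_fixed (by simp [parseListStep]) n
  have key : ∀ (l : List α) r n acc, l.length + 1 ≤ n →
      (parseListStep p)^[n] (acc, encList e l ++ r, false) = (acc ++ l, r, true) := by
    intro l r
    induction l with
    | nil =>
      intro n acc hn
      obtain ⟨n, rfl⟩ : ∃ m, n = m + 1 := ⟨n - 1, by omega⟩
      rw [iterate_succ_apply]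
      simpa [parseListStep, encList] using hdone n acc r
    | cons a l ih =>
      intro n acc hn
      obtain ⟨n, rfl⟩ : ∃ m, n = m + 1 := ⟨n - 1, by omega⟩
      rw [iterate_succ_apply]
      have h1 : encList e (a :: l) ++ r = true :: (e a ++ (encList e l ++ r)) := by simp [encList]
      have h2 : parseListStep p (acc, encList e (a :: l) ++ r, false) =
          (acc ++ [a], encList e l ++ r, false) := by
        rw [h1]
        simp [parseListStep, h a]
      rw [h2, ih n _ (by simpa using hn)]
      simp
  intro l r
  -- Each element contributes at least its leading `true`, and the end mark one more symbol, so as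
  -- many iterations as there are symbols suffice.
  have hlen : l.length + 1 ≤ (encList e l ++ r).length := by
    have : l.length ≤ (l.flatMap (fun a => true :: e a)).length := by
      induction l with
      | nil => simp
      | cons a l ih => simp only [List.flatMap_cons, List.length_append, List.length_cons]; omega
    simp only [encList, List.length_append, List.length_cons, List.length_nil]
    omega
  simp only [parseList, key l r _ [] hlen, List.nil_append]

/-- The parser must stay within a polynomial bound on every string, not only on codes. The rest of
the string never grows, so each element is parsed off a string no longer than `x`, and each
iteration adds at most one element. -/
theorem parseListStep_iterate_le {α : Type} {p : List Bool → α × List Bool}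
    (hp : ∀ y, (p y).2.length ≤ y.length) (x : List Bool) (P : α → Prop)
    (hP : ∀ y, y.length ≤ x.length → P (p y).1) (n : ℕ) :
    ((parseListStep p)^[n] ([], x, false)).2.1.length ≤ x.length ∧
    ((parseListStep p)^[n] ([], x, false)).1.length ≤ n ∧
    ∀ a ∈ ((parseListStep p)^[n] ([], x, false)).1, P a := by
  induction n with
  | zero => simp
  | succ n ih =>
    rw [iterate_succ_apply']
    generalize (parseListStep p)^[n] ([], x, false) = s at ih
    obtain ⟨h1, h2, h3⟩ := ih
    have ht : s.2.1.tail.length ≤ x.length := by simp; omega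
    unfold parseListStep
    split_ifs
    · exact ⟨h1, by omega, h3⟩
    · refine ⟨(hp _).trans ht, by simpa using h2, fun a ha => ?_⟩
      rcases List.mem_append.1 ha with ha | ha
      · exact h3 a ha
      · rw [List.mem_singleton.1 ha]
        exact hP _ ht
    · exact ⟨ht, by simp; omega, h3⟩

theorem length_parseList_le {α : Type} {p : List Bool → α × List Bool}
    (hp : ∀ y, (p y).2.length ≤ y.length) (x : List Bool) :
    (parseList p x).2.length ≤ x.length :=
  (parseListStep_iterate_le hp x (fun _ => True) (fun _ _ => trivial) x.length).1

theorem PolyFun.parseList {α : Type} [Code α] [Inhabited α] {p : List Bool → α × List Bool}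
    (h : PolyFun p) (hp : ∀ y, (p y).2.length ≤ y.length) : PolyFun (parseList p) := by
  obtain ⟨q, hq⟩ := (PolyFun.fst h).size_le
  have hs : PolyFun (parseListStep p) := by
    have : PolyFun (fun s : List α × List Bool × Bool => p s.2.1.tail) := h.comp (by fun_prop)
    unfold parseListStep
    fun_prop
  have hi := PolyFun.iterate (n := fun x : List Bool => x.length) (init := fun x => ([], x, false))
    (step := fun _ => parseListStep p) (by fun_prop) (by fun_prop) (hs.comp PolyFun.prod_snd)
    (bound := fun x => 2 * (size x * (2 * q.eval (size x) + 1)) + (2 * size x + 3))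
    ((PolyBdd.mul (.const 2) (PolyBdd.size_self.mul
      ((PolyBdd.mul (.const 2) (PolyBdd.size_self.eval q)).add (.const 1)))).add
      ((PolyBdd.mul (.const 2) .size_self).add (.const 3)))
    (fun x i hi => by
      obtain ⟨h1, h2, h3⟩ := parseListStep_iterate_le hp x (fun a => size a ≤ q.eval (size x))
        (fun y hy => (hq y).trans (eval_le_eval q (by simpa using hy))) i
      have h4 := size_list_le h3
      have h5 := length_le_size x
      have h6 := Nat.mul_le_mul_right (2 * q.eval (size x) + 1) ((h2.trans hi).trans h5)
      generalize (parseListStep p)^[i] ([], x, false) = s at *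
      obtain ⟨l, r, b⟩ := s
      simp only [size_pair, size_bool, size_list_bool] at h1 h4 h6 ⊢
      omega)
  unfold KonigPPP.parseList
  fun_prop

/-- The parser for natural numbers. -/
def parseNat (x : List Bool) : ℕ × List Bool :=
  ((parseList (fun y => ((), y)) x).1.length, (parseList (fun y => ((), y)) x).2)

theorem parses_nat : Parses parseNat encNat := by
  intro n r
  have h : Parses (fun y => ((), y)) (fun _ => []) := fun _ _ => rfl
  -- The unary code of `n` is the code of a list of `n` units with empty codes, so the list parser
  -- reads numbers too.
  have e : encNat n = encList (fun _ => []) (List.replicate n ()) := by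
    simp only [encNat, encList]
    congr 1
    induction n with
    | zero => rfl
    | succ n ih => rw [List.replicate_succ, List.replicate_succ, ih]; rfl
  rw [e]
  simp [parseNat, h.list (List.replicate n ()) r]

theorem length_parseNat_le (x : List Bool) : (parseNat x).2.length ≤ x.length :=
  length_parseList_le (fun _ => le_rfl) x

@[fun_prop] theorem PolyFun.parseNat {γ : Type} [Code γ] {x : γ → List Bool} (hx : PolyFun x) :
    PolyFun (fun c => parseNat (x c)) := by
  have h := PolyFun.parseList (p := fun y => ((), y)) (by fun_prop) (fun _ => le_rfl)
  exact ((PolyFun.length (fst h)).prodMk (snd h)).comp hx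

attribute [irreducible] parseNat

/-- The parser for gates. -/
def parseGate (x : List Bool) : Gate × List Bool :=
  (⟨ofTable (x.getD 0 false) (x.getD 1 false) (x.getD 2 false) (x.getD 3 false),
    (parseNat (x.drop 4)).1, (parseNat (parseNat (x.drop 4)).2).1⟩,
    (parseNat (parseNat (x.drop 4)).2).2)

theorem parses_gate : Parses parseGate encGate := by
  intro g r
  have e : encGate g ++ r = g.op false false :: g.op false true :: g.op true false ::
      g.op true true :: (encNat g.left ++ (encNat g.right ++ r)) := by simp [encGate]
  rw [e]
  simp [parseGate, parses_nat g.left, parses_nat g.right, ofTable_op]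

theorem length_parseGate_le (x : List Bool) : (parseGate x).2.length ≤ x.length :=
  (length_parseNat_le _).trans ((length_parseNat_le _).trans (by simp))

@[fun_prop] theorem PolyFun.parseGate {γ : Type} [Code γ] {x : γ → List Bool} (hx : PolyFun x) :
    PolyFun (fun c => parseGate (x c)) := by
  unfold KonigPPP.parseGate
  fun_prop

attribute [irreducible] parseGate

/-- The parser for circuits. -/
def parseCircuit (x : List Bool) : Circuit × List Bool :=
  (⟨(parseNat x).1, (parseList parseGate (parseNat x).2).1,
    (parseList parseNat (parseList parseGate (parseNat x).2).2).1⟩,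
    (parseList parseNat (parseList parseGate (parseNat x).2).2).2)

theorem parses_circuit : Parses parseCircuit Circuit.enc := by
  intro C r
  have e : C.enc ++ r = encNat C.numInputs ++
      (encList encGate C.gates ++ (encList encNat C.outputs ++ r)) := by simp [Circuit.enc]
  rw [e]
  simp [parseCircuit, parses_nat C.numInputs, parses_gate.list C.gates, parses_nat.list C.outputs]

@[fun_prop] theorem PolyFun.parseCircuit {γ : Type} [Code γ] {x : γ → List Bool}
    (hx : PolyFun x) : PolyFun (fun c => parseCircuit (x c)) := by
  have h1 : PolyFun (fun c => (KonigPPP.parseNat (x c)).2) := by fun_prop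
  have h2 := (PolyFun.parseList (p := KonigPPP.parseGate) (by fun_prop) length_parseGate_le).comp h1
  have h3 := (PolyFun.parseList (p := KonigPPP.parseNat) (by fun_prop) length_parseNat_le).comp
    (snd h2)
  exact ((fst (PolyFun.parseNat hx)).circuit_mk (fst h2) (fst h3)).prodMk (snd h3)

attribute [irreducible] parseCircuit

/-! ### Instances as strings -/

/-- Unique decodability of the circuit code makes the instance a function of the string, so no other
instance can contribute solutions. -/
theorem konig_enc (I : KonigInstance) (y : List Bool) :
    konig (I.P.enc ++ I.root) y ↔ I.IsSolution y := by
  constructor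
  · rintro (⟨J, hJ, h⟩ | ⟨h, -⟩)
    · obtain ⟨h1, h2⟩ := parses_circuit.inj hJ
      obtain ⟨P, r, _, _⟩ := I
      obtain ⟨P', r', _, _⟩ := J
      obtain rfl : P' = P := h1
      obtain rfl : r' = r := h2
      exact h
    · exact absurd ⟨I, rfl⟩ h
  · exact fun h => .inl ⟨I, rfl, h⟩

theorem collision_enc (I : CollisionInstance) (y : List Bool) :
    collision I.C.enc y ↔ I.IsSolution y := by
  constructor
  · rintro (⟨J, hJ, h⟩ | ⟨h, -⟩)
    · obtain ⟨h1, -⟩ := parses_circuit.inj (r := []) (r' := []) (congrArg (· ++ []) hJ)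
      obtain ⟨C, _⟩ := I
      obtain ⟨C', _⟩ := J
      obtain rfl : C' = C := h1
      exact h
    · exact absurd ⟨I, rfl⟩ h
  · exact fun h => .inl ⟨I, rfl, h⟩

/-- The string is the code of an instance of König. -/
def konigValid (x : List Bool) : Bool :=
  decide ((parseCircuit x).1.outputs.length = (parseCircuit x).1.numInputs + 1) &&
  decide ((parseCircuit x).2.length = (parseCircuit x).1.numInputs) &&
  decide ((parseCircuit x).1.enc ++ (parseCircuit x).2 = x)

/-- The string is the code of an instance of Collision. -/
def collisionValid (x : List Bool) : Bool :=
  decide ((parseCircuit x).1.outputs.length = (parseCircuit x).1.numInputs) &&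
  decide ((parseCircuit x).1.enc = x)

/-- The parser returns some circuit and remainder on every string; encoding them again reproduces
the string exactly when it was a code. -/
theorem konigValid_iff {x : List Bool} :
    konigValid x = true ↔ ∃ I : KonigInstance, I.P.enc ++ I.root = x := by
  simp only [konigValid, Bool.and_eq_true, decide_eq_true_eq]
  constructor
  · rintro ⟨⟨h1, h2⟩, h3⟩
    exact ⟨⟨_, _, h1, h2⟩, h3⟩
  · rintro ⟨I, rfl⟩
    rw [parses_circuit]
    exact ⟨⟨I.hP, I.hroot⟩, rfl⟩

theorem collisionValid_iff {x : List Bool} :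
    collisionValid x = true ↔ ∃ I : CollisionInstance, I.C.enc = x := by
  simp only [collisionValid, Bool.and_eq_true, decide_eq_true_eq]
  constructor
  · rintro ⟨h1, h3⟩
    exact ⟨⟨_, h1⟩, h3⟩
  · rintro ⟨I, rfl⟩
    have := parses_circuit I.C []
    rw [List.append_nil] at this
    rw [this]
    exact ⟨I.hC, rfl⟩

theorem konig_of_not_valid {x y : List Bool} (h : konigValid x = false) : konig x y ↔ y = [] := by
  have : ¬ ∃ I : KonigInstance, I.P.enc ++ I.root = x := by
    rw [← konigValid_iff, h]; simp
  constructor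
  · rintro (⟨I, hI, -⟩ | ⟨-, h⟩)
    · exact absurd ⟨I, hI⟩ this
    · exact h
  · exact fun h => .inr ⟨this, h⟩

theorem collision_of_not_valid {x y : List Bool} (h : collisionValid x = false) :
    collision x y ↔ y = [] := by
  have : ¬ ∃ I : CollisionInstance, I.C.enc = x := by
    rw [← collisionValid_iff, h]; simp
  constructor
  · rintro (⟨I, hI, -⟩ | ⟨-, h⟩)
    · exact absurd ⟨I, hI⟩ this
    · exact h
  · exact fun h => .inr ⟨this, h⟩

@[fun_prop] theorem PolyFun.konigValid {γ : Type} [Code γ] {x : γ → List Bool} (hx : PolyFun x) :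
    PolyFun (fun c => konigValid (x c)) := by
  unfold KonigPPP.konigValid
  fun_prop

@[fun_prop] theorem PolyFun.collisionValid {γ : Type} [Code γ] {x : γ → List Bool}
    (hx : PolyFun x) : PolyFun (fun c => collisionValid (x c)) := by
  unfold KonigPPP.collisionValid
  fun_prop

theorem Circuit.length_eval (C : Circuit) (x : List Bool) :
    (C.eval x).length = C.outputs.length := by
  simp [Circuit.eval]

/-! ### Collision is total -/

/-- The pigeonhole principle: without a collision the circuit is an injective self-map of a finite
set, hence surjective, and so attains the zero string. -/
theorem CollisionInstance.exists_solution (I : CollisionInstance) : ∃ s, I.IsSolution s := by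
  by_contra! hno
  let F : List.Vector Bool I.C.numInputs → List.Vector Bool I.C.numInputs :=
    fun x => ⟨I.C.eval x.1, (I.C.length_eval x.1).trans I.hC⟩
  have hinj : Function.Injective F := by
    intro x y hxy
    by_contra hne
    exact hno _ (.inr ⟨x.1, y.1, x.2, y.2, rfl, fun h => hne (Subtype.ext h),
      congrArg Subtype.val hxy⟩)
  obtain ⟨x, hx⟩ := Finite.surjective_of_injective hinj
    ⟨List.replicate I.C.numInputs false, List.length_replicate⟩
  exact hno _ (.inl ⟨x.1, x.2, rfl, congrArg Subtype.val hx⟩)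

theorem collision_total (x : List Bool) : ∃ y, collision x y := by
  cases h : collisionValid x with
  | false => exact ⟨[], (collision_of_not_valid h).2 rfl⟩
  | true =>
    obtain ⟨I, rfl⟩ := collisionValid_iff.1 h
    obtain ⟨y, hy⟩ := I.exists_solution
    exact ⟨y, (collision_enc I y).2 hy⟩

/-! ### Solutions of König are recognized in polynomial time -/

/-- The parent of a node with respect to a circuit. -/
def Circuit.parent (C : Circuit) (x : List Bool) : List Bool := (C.eval x).take C.numInputs

/-- The side of a node with respect to a circuit. -/
def Circuit.side (C : Circuit) (x : List Bool) : Bool := (C.eval x).getD C.numInputs false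

/-- The node `r` is not among the first `n` nodes on the path that starts in `x`. -/
def Circuit.avoids (C : Circuit) (r x : List Bool) : Bool :=
  (List.range C.numInputs).all (fun k => !decide (C.parent^[k] x = r))

theorem Circuit.avoids_iff {C : Circuit} {r x : List Bool} :
    C.avoids r x = true ↔ ∀ k < C.numInputs, C.parent^[k] x ≠ r := by
  simp [Circuit.avoids]

theorem Circuit.length_parent_le (C : Circuit) (x : List Bool) :
    (C.parent x).length ≤ C.outputs.length := by
  simp [Circuit.parent, C.length_eval]

theorem KonigInstance.length_parent (I : KonigInstance) (x : List Bool) :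
    (I.parent x).length = I.n := by
  simp [KonigInstance.parent, KonigInstance.n, I.P.length_eval, I.hP]

namespace PolyFun

variable {γ : Type} [Code γ]

@[fun_prop] theorem circuit_parent {C : γ → Circuit} {x : γ → List Bool} (hC : PolyFun C)
    (hx : PolyFun x) : PolyFun (fun c => (C c).parent (x c)) := by
  unfold Circuit.parent
  fun_prop

@[fun_prop] theorem circuit_side {C : γ → Circuit} {x : γ → List Bool} (hC : PolyFun C)
    (hx : PolyFun x) : PolyFun (fun c => (C c).side (x c)) := by
  unfold Circuit.side
  fun_prop

@[fun_prop] theorem parent_iterate {C : γ → Circuit} {k : γ → ℕ} {x : γ → List Bool}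
    (hC : PolyFun C) (hk : PolyFun k) (hx : PolyFun x) :
    PolyFun (fun c => (C c).parent^[k c] (x c)) := by
  refine iterate (step := fun c => (C c).parent) hk hx (by fun_prop)
    (hx.size_le.add ((PolyBdd.const 3).mul (outputs hC).size_le)) (fun c i _ => ?_)
  have h1 := length_le_size (C c).outputs
  cases i with
  | zero => simp
  | succ i =>
    have h2 := (C c).length_parent_le ((C c).parent^[i] (x c))
    rw [iterate_succ_apply', size_list_bool]
    omega

@[fun_prop] theorem circuit_avoids {C : γ → Circuit} {r x : γ → List Bool}
    (hC : PolyFun C) (hr : PolyFun r) (hx : PolyFun x) :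
    PolyFun (fun c => (C c).avoids (r c) (x c)) := by
  unfold Circuit.avoids
  exact all (by fun_prop) (by fun_prop)

end PolyFun

/-- Decides whether the node `x` is a solution of the instance with circuit `C` and root `r`. -/
def nodeCheck (C : Circuit) (r x : List Bool) : Bool :=
  (decide (x = r) && !decide (C.parent x = x)) ||
    ((!decide (x = r) && decide (C.parent x = x)) || C.avoids r x)

/-- Decides whether `x` and `y` are identical children. -/
def pairCheck (C : Circuit) (x y : List Bool) : Bool :=
  !decide (x = y) && !decide (C.parent x = x) && !decide (C.parent y = y) &&
    decide (C.parent x = C.parent y) && (C.side x == C.side y)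

/-- Decides whether `s` is a solution of the instance with the circuit `C` and the root `r`. -/
def konigCheck (C : Circuit) (r s : List Bool) : Bool :=
  if s.headD false then
    decide (s.length = 2 * C.numInputs + 1) &&
      pairCheck C (s.tail.take C.numInputs) (s.tail.drop C.numInputs)
  else decide (s.length = C.numInputs + 1) && nodeCheck C r s.tail

@[fun_prop] theorem PolyFun.konigCheck {γ : Type} [Code γ] {C : γ → Circuit} {r s : γ → List Bool}
    (hC : PolyFun C) (hr : PolyFun r) (hs : PolyFun s) :
    PolyFun (fun c => konigCheck (C c) (r c) (s c)) := by
  unfold KonigPPP.konigCheck pairCheck nodeCheck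
  fun_prop

theorem nodeCheck_iff (I : KonigInstance) (x : List Bool) :
    nodeCheck I.P I.root x = true ↔
      I.InvalidRoot x ∨ I.NonUniqueRoot x ∨ I.P.avoids I.root x = true := by
  simp only [nodeCheck, Bool.and_eq_true, Bool.or_eq_true, decide_eq_true_eq, Bool.not_eq_true',
    decide_eq_false_iff_not]
  rfl

theorem pairCheck_iff (I : KonigInstance) (x y : List Bool) :
    pairCheck I.P x y = true ↔ I.IdenticalChildren x y := by
  simp only [pairCheck, Bool.and_eq_true, decide_eq_true_eq, Bool.not_eq_true',
    decide_eq_false_iff_not, beq_iff_eq, and_assoc]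
  rfl

/-- Both kinds of solution say that the root is missed at all steps `k < n`; they differ only in
whether it is met at step `n`. The pair can thus be tested and produced as one condition. -/
theorem KonigInstance.farAway_or_longPath_iff (I : KonigInstance) (x : List Bool) :
    I.FarAway x ∨ I.LongPath x ↔ I.P.avoids I.root x = true := by
  rw [Circuit.avoids_iff]
  change _ ↔ ∀ k < I.n, I.parent^[k] x ≠ I.root
  constructor
  · rintro (h | h) k hk
    · exact h k hk.le
    · exact h.2 k hk
  · intro h
    by_cases hn : I.parent^[I.n] x = I.root
    · exact .inr ⟨hn, h⟩
    · refine .inl fun k hk => ?_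
      rcases hk.lt_or_eq with hk | rfl
      · exact h k hk
      · exact hn

theorem konigCheck_iff (I : KonigInstance) (s : List Bool) :
    konigCheck I.P I.root s = true ↔ I.IsSolution s := by
  rcases s with _ | ⟨_ | _, s⟩
  · simp [konigCheck, KonigInstance.IsSolution]
  · have h : konigCheck I.P I.root (false :: s) = true ↔ s.length = I.n ∧
        (I.InvalidRoot s ∨ I.NonUniqueRoot s ∨ I.P.avoids I.root s = true) := by
      rw [← nodeCheck_iff]
      change (decide (s.length + 1 = I.n + 1) && nodeCheck I.P I.root s) = true ↔ _
      simp
    rw [h, ← I.farAway_or_longPath_iff]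
    simp [KonigInstance.IsSolution]
  · have h : konigCheck I.P I.root (true :: s) = true ↔ s.length = 2 * I.n ∧
        I.IdenticalChildren (s.take I.n) (s.drop I.n) := by
      rw [← pairCheck_iff]
      change (decide (s.length + 1 = 2 * I.n + 1) &&
        pairCheck I.P (s.take I.n) (s.drop I.n)) = true ↔ _
      simp
    rw [h]
    constructor
    · rintro ⟨h1, h2⟩
      exact .inr ⟨_, _, by simp; omega, by simp; omega, by simp, h2⟩
    · rintro (⟨x, -, h, -⟩ | ⟨x, y, hx, hy, h, h'⟩)
      · simp at h
      · obtain rfl : s = x ++ y := by simpa using h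
        rw [← hx, List.take_left, List.drop_left]
        exact ⟨by simp; omega, h'⟩

theorem KonigInstance.IsSolution.length_le {I : KonigInstance} {s : List Bool}
    (h : I.IsSolution s) : s.length ≤ 2 * I.n + 1 := by
  rcases h with ⟨x, h, rfl, -⟩ | ⟨x, y, h, h', rfl, -⟩
  · simp; omega
  · simp; omega

/-- Decides whether `p.2` is a solution of `p.1`. -/
def konigDecide (p : List Bool × List Bool) : Bool :=
  if konigValid p.1 then konigCheck (parseCircuit p.1).1 (parseCircuit p.1).2 p.2
  else decide (p.2 = [])

theorem konigDecide_iff (x y : List Bool) : konigDecide (x, y) = true ↔ konig x y := by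
  cases h : konigValid x with
  | false => simp [konigDecide, h, konig_of_not_valid h]
  | true =>
    obtain ⟨I, rfl⟩ := konigValid_iff.1 h
    rw [konig_enc, ← konigCheck_iff]
    simp [konigDecide, h, parses_circuit I.P I.root]

/-- A solution consists of a tag and at most two nodes of `n` bits, and `n` is bounded by the input
length because the root is written out. Totality is supplied separately, through Collision. -/
theorem konig_inTFNP (htotal : ∀ x, ∃ y, konig x y) : InTFNP konig := by
  refine ⟨⟨2 * .X + 1, fun x y hxy => ?_⟩, ⟨konigDecide, ?_, konigDecide_iff⟩, htotal⟩
  · cases h : konigValid x with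
    | false => simp [(konig_of_not_valid h).1 hxy]
    | true =>
      obtain ⟨I, rfl⟩ := konigValid_iff.1 h
      have h1 := ((konig_enc I y).1 hxy).length_le
      have h2 : I.root.length = I.n := I.hroot
      simp only [Polynomial.eval_add, Polynomial.eval_mul, Polynomial.eval_ofNat,
        Polynomial.eval_X, Polynomial.eval_one, List.length_append]
      omega
  · rw [polyTime₂_iff]
    unfold konigDecide
    fun_prop

/-! ### Building circuits -/

theorem wire_append_left {a : List Bool} {k : ℕ} (h : k < a.length) (b : List Bool) :
    wire (a ++ b) k = wire a k := List.getD_append _ _ _ _ h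

theorem wire_append_right {a : List Bool} {m : ℕ} (h : a.length = m) (b : List Bool) (k : ℕ) :
    wire (a ++ b) (m + k) = wire b k := by
  subst h
  unfold wire
  rw [List.getD_append_right _ _ _ _ (by omega), Nat.add_sub_cancel_left]

theorem wire_length {a : List Bool} {m : ℕ} (h : a.length = m) (c : Bool) (b : List Bool) :
    wire (a ++ c :: b) m = c := wire_append_right h (c :: b) 0

theorem wire_eq_false {a : List Bool} {k : ℕ} (h : a.length ≤ k) : wire a k = false :=
  List.getD_eq_default _ _ h

/-- An embedded circuit behaves as the original. This includes gates that read a wire not yet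
defined: such a wire is still undefined after the shift and carries 0. -/
theorem runGates_shift (gs : List Gate) {pre : List Bool} {s : ℕ} (h : pre.length = s)
    (Y : List Bool) :
    runGates (gs.map (fun g => g.shift s)) (pre ++ Y) = pre ++ runGates gs Y := by
  induction gs generalizing Y with
  | nil => rfl
  | cons g gs ih =>
    have : (g.shift s).val (pre ++ Y) = g.val Y := by
      simp [Gate.val, Gate.shift, wire_append_right h]
    rw [List.map_cons, runGates_cons, runGates_cons, this, List.append_assoc, ih]

/-- Gates that read nothing from their own layer can be evaluated in parallel. -/
theorem runGates_layer {gs : List Gate} {vs : List Bool}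
    (h : ∀ g ∈ gs, ∀ w, g.val (vs ++ w) = g.val vs) :
    runGates gs vs = vs ++ gs.map (fun g => g.val vs) := by
  have key : ∀ gs : List Gate, (∀ g ∈ gs, ∀ w, g.val (vs ++ w) = g.val vs) → ∀ w,
      runGates gs (vs ++ w) = vs ++ w ++ gs.map (fun g => g.val vs) := by
    intro gs
    induction gs with
    | nil => simp
    | cons g gs ih =>
      intro h w
      rw [runGates_cons, h g List.mem_cons_self, List.append_assoc,
        ih fun g hg => h g (List.mem_cons_of_mem _ hg)]
      simp
  simpa using key gs h []

theorem subset_runGates (gs : List Gate) (vs : List Bool) : vs <+: runGates gs vs := by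
  induction gs generalizing vs with
  | nil => simp
  | cons g gs ih => exact (List.prefix_append vs _).trans (ih _)

theorem wire_of_prefix {a b : List Bool} (h : a <+: b) {k : ℕ} (hk : k < a.length) :
    wire b k = wire a k := by
  obtain ⟨t, rfl⟩ := h
  exact wire_append_left hk t

/-- The gate `x ∧ (y = c)`. -/
def andEq (c : Bool) (l r : ℕ) : Gate := ⟨fun a b => a && (b == c), l, r⟩

/-- The conjunction of wire `k` with the conditions that wire `l + i` carries `c i` for `i < m`. -/
def chain (c : ℕ → Bool) (k l m : ℕ) : List Gate :=
  (List.range m).map (fun i => andEq (c i) (k + i) (l + i))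

theorem runGates_chain (c : ℕ → Bool) {k l m : ℕ} {vs : List Bool} (hk : vs.length = k + 1)
    (hl : l + m ≤ k + 1) :
    ∃ w, w.length = m ∧ runGates (chain c k l m) vs = vs ++ w ∧
      wire (vs ++ w) (k + m) =
        (wire vs k && (List.range m).all (fun i => wire vs (l + i) == c i)) := by
  induction m with
  | zero => exact ⟨[], by simp [chain]⟩
  | succ m ih =>
    obtain ⟨w, hw, h1, h2⟩ := ih (by omega)
    refine ⟨w ++ [(andEq (c m) (k + m) (l + m)).val (vs ++ w)], by simp [hw], ?_, ?_⟩
    · rw [← List.append_assoc, ← h1, chain, List.range_succ, List.map_append, runGates_append]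
      rfl
    · rw [← List.append_assoc, wire_length (by simp [hk, hw]; omega)]
      simp only [Gate.val, andEq]
      rw [h2, wire_append_left (by omega), List.range_succ, List.all_append]
      simp [Bool.and_assoc]

/-- The gate that copies wire `o` of a circuit with `m` wires embedded at position `s`. -/
def copyGate (m s o : ℕ) : Gate :=
  if o < m then ⟨fun a _ => a, s + o, 0⟩ else ⟨fun _ _ => false, 0, 0⟩

/-- An output number beyond the wires of the original circuit means the constant 0. In the larger
circuit that number could hit a later wire, hence the constant gate in that case. -/
theorem copyGate_val {pre Y w : List Bool} {m s : ℕ} (hs : pre.length = s) (hm : Y.length = m)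
    (o : ℕ) : (copyGate m s o).val (pre ++ Y ++ w) = wire Y o := by
  unfold copyGate
  split_ifs with h
  · simp only [Gate.val]
    rw [List.append_assoc, wire_append_right hs, wire_append_left (by omega)]
  · simp [Gate.val, wire_eq_false (a := Y) (k := o) (by omega)]

theorem runGates_copyGate {pre Y w : List Bool} {m s : ℕ} (hs : pre.length = s)
    (hm : Y.length = m) (os : List ℕ) :
    runGates (os.map (copyGate m s)) (pre ++ Y ++ w) = pre ++ Y ++ w ++ os.map (wire Y) := by
  rw [runGates_layer, List.map_map]
  · congr 1
    exact List.map_congr_left fun o _ => copyGate_val hs hm o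
  · intro g hg w'
    obtain ⟨o, -, rfl⟩ := List.mem_map.1 hg
    rw [copyGate_val hs hm, List.append_assoc _ w, copyGate_val hs hm]

namespace PolyFun

variable {γ : Type} [Code γ]

@[fun_prop] theorem andEq {c : γ → Bool} {l r : γ → ℕ} (hc : PolyFun c) (hl : PolyFun l)
    (hr : PolyFun r) : PolyFun (fun x => andEq (c x) (l x) (r x)) := by
  have : PolyFun (fun x => Gate.mk (ofTable false false (!(c x)) (c x)) (l x) (r x)) := by fun_prop
  refine this.congr fun x => congrArg (fun g => Code.enc (Gate.mk g (l x) (r x))) ?_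
  funext a b
  cases c x <;> cases a <;> cases b <;> rfl

@[fun_prop] theorem copyGate {m s o : γ → ℕ} (hm : PolyFun m) (hs : PolyFun s)
    (ho : PolyFun o) : PolyFun (fun x => copyGate (m x) (s x) (o x)) := by
  have : PolyFun (fun x => if decide (o x < m x) then Gate.mk (fun a _ => a) (s x + o x) 0
    else ⟨fun _ _ => false, 0, 0⟩) := by fun_prop
  simpa only [KonigPPP.copyGate, decide_eq_true_eq] using this

end PolyFun

/-! ### The circuit that computes the address of a node -/

/-- The number of gates of one round. -/
def roundLength (C : Circuit) : ℕ := C.gates.length + 2 * C.numInputs + 5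

/-- One step towards the root: wire `f` tells whether the root has been met, and the following
wires contain the current node. -/
def roundGates (C : Circuit) (r : List Bool) (f : ℕ) : List Gate :=
  C.gates.map (fun g => g.shift (f + 1)) ++
  (⟨fun _ _ => true, 0, 0⟩ ::
    chain (fun i => r.getD i false) (f + 1 + C.numInputs + C.gates.length) (f + 1) C.numInputs) ++
  [copyGate (C.numInputs + C.gates.length) (f + 1) (C.outputs.getD C.numInputs 0),
    ⟨fun a b => a || b, f + 1 + C.numInputs + C.gates.length + C.numInputs,
      f + 1 + C.numInputs + C.gates.length + C.numInputs + 1⟩,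
    ⟨fun a b => a && !b, f + 1 + C.numInputs + C.gates.length + C.numInputs + 2, f⟩,
    ⟨fun a b => a || b, f, f + 1 + C.numInputs + C.gates.length + C.numInputs⟩] ++
  (C.outputs.take C.numInputs).map (copyGate (C.numInputs + C.gates.length) (f + 1))

theorem eq_iff_all_wire {X r : List Bool} {n : ℕ} (hX : X.length = n) (hr : r.length = n) :
    (List.range n).all (fun i => wire X i == r.getD i false) = decide (X = r) := by
  rw [Bool.eq_iff_iff]
  simp only [List.all_eq_true, List.mem_range, beq_iff_eq, decide_eq_true_eq]
  constructor
  · intro h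
    refine List.ext_getElem (hX.trans hr.symm) fun i h1 h2 => ?_
    simpa [wire, h1, h2] using h i (by omega)
  · rintro rfl i -
    rfl

/-- A round lays out, from wire `f` on: the flag, the current node, the gates of `C`, the test
against `r` (a constant and `n` gates), the side, the disjunction of test and side, the address bit,
the new flag and the parent. The new flag is at `f + roundLength C`, directly after the address bit,
and the parent follows it, as the next round expects. -/
theorem runGates_round {C : Circuit} (hC : C.outputs.length = C.numInputs + 1) {r : List Bool}
    (hr : r.length = C.numInputs) {pre X : List Bool} {f : ℕ} (hf : pre.length = f)
    (hX : X.length = C.numInputs) (F : Bool) :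
    ∃ mid : List Bool, (pre ++ mid).length + 1 = f + roundLength C ∧
      runGates (roundGates C r f) (pre ++ F :: X) =
        (pre ++ mid ++ [(decide (X = r) || C.side X) && !F]) ++ (F || decide (X = r)) :: C.parent X := by
  set n := C.numInputs with hn
  set G := C.gates.length with hG
  set Y := C.wires X with hYdef
  have hY : Y.length = n + G := by rw [hYdef, C.wires_eq, length_runGates, hX]
  have hp : (pre ++ [F]).length = f + 1 := by simp [hf]
  have hXY : X <+: Y := subset_runGates _ _
  obtain ⟨w, hw, h1, h2⟩ := runGates_chain (fun i => r.getD i false) (k := f + 1 + n + G)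
    (l := f + 1) (m := n) (vs := (pre ++ [F]) ++ Y ++ [true]) (by simp [hf, hY]; omega) (by omega)
  rw [wire_length (by simp [hf, hY]; omega), Bool.true_and] at h2
  have h3 : (List.range n).all
      (fun i => wire ((pre ++ [F]) ++ Y ++ [true]) (f + 1 + i) == r.getD i false) =
      decide (X = r) := by
    rw [← eq_iff_all_wire hX hr, Bool.eq_iff_iff, List.all_eq_true, List.all_eq_true]
    refine forall₂_congr fun i hi => ?_
    have hi := List.mem_range.1 hi
    rw [List.append_assoc, wire_append_right hp, wire_append_left (by omega),
      wire_of_prefix hXY (by omega)]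
  rw [h3] at h2
  set V := (pre ++ [F]) ++ Y ++ [true] ++ w with hV
  have hVl : V.length = f + 1 + n + G + n + 1 := by simp [hV, hf, hY, hw]; omega
  have hVF : wire V f = F := by
    rw [hV]
    simp only [List.append_assoc, List.singleton_append]
    exact wire_length hf _ _
  have hs : wire Y (C.outputs.getD n 0) = C.side X := by
    have : n < C.outputs.length := by omega
    simp [Circuit.side, Circuit.eval, ← hn, List.getD_eq_getElem?_getD, this, hYdef]
  have hpar : (C.outputs.take n).map (wire Y) = C.parent X := by
    simp [Circuit.parent, Circuit.eval, ← hn, hYdef, List.map_take]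
  -- All wires between the prefix and the address bit.
  refine ⟨F :: (Y ++ [true] ++ w ++ [C.side X, decide (X = r) || C.side X]), ?_, ?_⟩
  · simp only [roundLength, List.length_append, List.length_cons, List.length_nil, hf, hY, hw]
    omega
  · have hch : runGates (⟨fun _ _ => true, 0, 0⟩ ::
        chain (fun i => r.getD i false) (f + 1 + n + G) (f + 1) n) ((pre ++ [F]) ++ Y) = V := by
      rw [runGates_cons]
      exact h1
    have e0 : pre ++ F :: X = (pre ++ [F]) ++ X := by simp
    rw [roundGates, ← hn, ← hG, runGates_append, runGates_append, runGates_append, e0,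
      runGates_shift _ hp, ← C.wires_eq, ← hYdef, hch]
    have e2 : (copyGate (n + G) (f + 1) (C.outputs.getD n 0)).val V = C.side X := by
      rw [hV, List.append_assoc _ [true] w, copyGate_val hp hY, hs]
    rw [runGates_cons, e2, runGates_cons]
    have e3 : Gate.val ⟨fun a b => a || b, f + 1 + n + G + n, f + 1 + n + G + n + 1⟩
        (V ++ [C.side X]) = (decide (X = r) || C.side X) := by
      simp only [Gate.val]
      rw [wire_append_left (by omega), wire_length hVl, h2]
    rw [e3, runGates_cons]
    have e4 : Gate.val ⟨fun a b => a && !b, f + 1 + n + G + n + 2, f⟩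
        (V ++ [C.side X] ++ [decide (X = r) || C.side X]) =
        ((decide (X = r) || C.side X) && !F) := by
      simp only [Gate.val]
      rw [wire_length (by simp [hVl]), List.append_assoc, wire_append_left (by omega), hVF]
    rw [e4, runGates_cons]
    have e5 : Gate.val ⟨fun a b => a || b, f, f + 1 + n + G + n⟩
        (V ++ [C.side X] ++ [decide (X = r) || C.side X] ++
          [(decide (X = r) || C.side X) && !F]) = (F || decide (X = r)) := by
      simp only [Gate.val]
      rw [List.append_assoc, List.append_assoc, wire_append_left (a := V) (by omega),
        wire_append_left (a := V) (by omega), hVF, h2]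
    rw [e5, runGates_nil, hV]
    have e6 := runGates_copyGate (w := [true] ++ w ++ [C.side X] ++ [decide (X = r) || C.side X] ++
      [(decide (X = r) || C.side X) && !F] ++ [F || decide (X = r)]) hp hY (C.outputs.take n)
    simp only [List.append_assoc] at e6 ⊢
    rw [e6, hpar]
    simp

/-- The circuit that computes the address of a node. -/
def addressCircuit (C : Circuit) (r : List Bool) : Circuit where
  numInputs := C.numInputs
  gates := (⟨fun _ _ => false, 0, 0⟩ ::
      (List.range C.numInputs).map (fun i => ⟨fun a _ => a, i, 0⟩)) ++
    (List.range C.numInputs).flatMap (fun j => roundGates C r (C.numInputs + j * roundLength C)) ++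
    (List.range C.numInputs).map (fun j => ⟨fun a b => a && b,
      C.numInputs + j * roundLength C + roundLength C - 1,
      C.numInputs + C.numInputs * roundLength C⟩)
  outputs := (List.range C.numInputs).map
    (fun j => C.numInputs + C.numInputs * roundLength C + 1 + C.numInputs + j)

/-- The node `r` has been met before step `j`. -/
def Circuit.met (C : Circuit) (r x : List Bool) (j : ℕ) : Bool :=
  (List.range j).any (fun i => decide (C.parent^[i] x = r))

/-- The `j`-th bit of the address of a node that has a path to the root. -/
def Circuit.addressBit (C : Circuit) (r x : List Bool) (j : ℕ) : Bool :=
  (decide (C.parent^[j] x = r) || C.side (C.parent^[j] x)) && !C.met r x j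

/-- The address of a node that meets `r` is its list of sides, a 1 at the step of the first meeting,
and zeros from there on. The final conjunction with `met` at `n` erases the address of every node
that does not meet `r` in time, so that 0ⁿ means failure. -/
theorem eval_addressCircuit {C : Circuit} (hC : C.outputs.length = C.numInputs + 1) {r : List Bool}
    (hr : r.length = C.numInputs) {x : List Bool} (hx : x.length = C.numInputs) :
    (addressCircuit C r).eval x = (List.range C.numInputs).map
      (fun j => C.addressBit r x j && C.met r x C.numInputs) := by
  set n := C.numInputs with hn
  set L := roundLength C with hL
  have hL1 : 1 ≤ L := by rw [hL, roundLength]; omega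
  have hinit : runGates (⟨fun _ _ => false, 0, 0⟩ ::
      (List.range n).map (fun i => ⟨fun a _ => a, i, 0⟩)) x = x ++ false :: x := by
    rw [runGates_cons]
    have e1 : Gate.val ⟨fun _ _ => false, 0, 0⟩ x = false := rfl
    rw [e1, runGates_layer]
    · rw [List.map_map, List.append_assoc]
      congr 1
      refine congrArg (false :: ·) (List.ext_getElem (by simp [hx]) fun i h1 h2 => ?_)
      simp [Gate.val, wire, List.getD_eq_getElem?_getD, List.getElem?_append_left h2, h2]
    · intro g hg w
      obtain ⟨i, hi, rfl⟩ := List.mem_map.1 hg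
      have := List.mem_range.1 hi
      simp only [Gate.val]
      exact wire_append_left (by simp; omega) w
  -- After `m` rounds the flag and the `m`-th ancestor stand at the end, and the first `m` address
  -- bits are the last wires of their rounds.
  have hrounds : ∀ m, ∃ pre, pre.length = n + m * L ∧
      runGates ((List.range m).flatMap (fun j => roundGates C r (n + j * L))) (x ++ false :: x) =
        pre ++ C.met r x m :: C.parent^[m] x ∧
      ∀ j < m, wire pre (n + j * L + L - 1) = C.addressBit r x j := by
    intro m
    induction m with
    | zero => exact ⟨x, by simp [hx], by simp [Circuit.met], by simp⟩
    | succ m ih =>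
      obtain ⟨pre, hpre, h1, h2⟩ := ih
      have hXm : (C.parent^[m] x).length = n := by
        cases m with
        | zero => exact hx
        | succ m => rw [iterate_succ_apply']; simp [Circuit.parent, C.length_eval, hC, ← hn]
      obtain ⟨mid, hmid, h3⟩ := runGates_round hC hr hpre hXm (C.met r x m)
      refine ⟨pre ++ mid ++ [C.addressBit r x m], ?_, ?_, ?_⟩
      rotate_left
      · rw [List.range_succ, List.flatMap_append, runGates_append, h1, List.flatMap_singleton, h3,
          iterate_succ_apply']
        have : C.met r x (m + 1) = (C.met r x m || decide (C.parent^[m] x = r)) := by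
          simp [Circuit.met, List.range_succ]
        rw [this]
        rfl
      · intro j hj
        rcases Nat.lt_succ_iff_lt_or_eq.1 hj with hj | rfl
        · rw [← h2 j hj, List.append_assoc]
          refine wire_append_left ?_ _
          have := Nat.mul_le_mul_right L (Nat.succ_le_of_lt hj)
          rw [Nat.succ_mul] at this
          omega
        · exact wire_length (by rw [← hL] at hmid; omega) _ _
      · rw [List.length_append, List.length_singleton, hmid, Nat.succ_mul, ← hL]
        omega
  obtain ⟨pre, hpre, h1, h2⟩ := hrounds n
  have hlast : ((C.parent^[n] x)).length = n := by
    cases hn' : n with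
    | zero => rw [← hn']; rw [hn'] at hx ⊢; exact hx
    | succ m => rw [iterate_succ_apply']; simp [Circuit.parent, C.length_eval, hC, ← hn, hn']
  have hwires : (addressCircuit C r).wires x = pre ++ C.met r x n :: C.parent^[n] x ++
      (List.range n).map (fun j => C.addressBit r x j && C.met r x n) := by
    rw [Circuit.wires_eq, addressCircuit]
    dsimp only
    rw [← hn, ← hL, runGates_append, runGates_append, hinit, h1]
    -- The masking gates read an address bit and the final flag, both defined before this layer, so
    -- its earlier gates do not affect them.
    have hval : ∀ j < n, ∀ w, Gate.val ⟨fun a b => a && b, n + j * L + L - 1, n + n * L⟩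
        (pre ++ C.met r x n :: C.parent^[n] x ++ w) =
        (C.addressBit r x j && C.met r x n) := by
      intro j hj w
      have hlt : n + j * L + L - 1 < pre.length := by
        have := Nat.mul_le_mul_right L (Nat.succ_le_of_lt hj)
        rw [Nat.succ_mul] at this
        omega
      simp only [Gate.val]
      rw [List.append_assoc, wire_append_left hlt, h2 j hj, List.cons_append, wire_length hpre]
    rw [runGates_layer, List.map_map]
    · congr 1
      refine List.map_congr_left fun j hj => ?_
      have := hval j (List.mem_range.1 hj) []
      rwa [List.append_nil] at this
    · intro g hg w
      obtain ⟨j, hj, rfl⟩ := List.mem_map.1 hg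
      have h := hval j (List.mem_range.1 hj)
      rw [h w, ← h [], List.append_nil]
  rw [Circuit.eval, hwires]
  simp only [addressCircuit, List.map_map, ← hn, ← hL]
  refine List.map_congr_left fun j hj => ?_
  have hj := List.mem_range.1 hj
  rw [comp_apply, wire_append_right (by simp [hpre, hlast]; omega)]
  simp [wire, List.getD_eq_getElem?_getD, hj]

/-! ### König reduces to Collision -/

@[fun_prop] theorem PolyFun.addressCircuit {γ : Type} [Code γ] {C : γ → Circuit}
    {r : γ → List Bool} (hC : PolyFun C) (hr : PolyFun r) :
    PolyFun (fun c => addressCircuit (C c) (r c)) := by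
  have hchain : PolyFun (fun x : ((Circuit × List Bool) × ℕ) =>
      chain (fun i => x.1.2.getD i false) (x.2 + 1 + x.1.1.numInputs + x.1.1.gates.length)
        (x.2 + 1) x.1.1.numInputs) := by
    unfold chain
    exact map (by fun_prop) (by fun_prop)
  have hshift : PolyFun (fun x : ((Circuit × List Bool) × ℕ) =>
      x.1.1.gates.map (fun g => g.shift (x.2 + 1))) := map (by fun_prop) (by fun_prop)
  have hcopy : PolyFun (fun x : ((Circuit × List Bool) × ℕ) =>
      (x.1.1.outputs.take x.1.1.numInputs).map
        (KonigPPP.copyGate (x.1.1.numInputs + x.1.1.gates.length) (x.2 + 1))) :=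
    map (by fun_prop) (by fun_prop)
  have hround : PolyFun (fun x : ((Circuit × List Bool) × ℕ) => roundGates x.1.1 x.1.2 x.2) := by
    unfold roundGates
    fun_prop
  have h1 : PolyFun (fun x : Circuit × List Bool =>
      (List.range x.1.numInputs).map (fun i => (⟨fun a _ => a, i, 0⟩ : Gate))) :=
    map (by fun_prop) (by fun_prop)
  have hL : PolyFun (fun C : Circuit => roundLength C) := by
    unfold roundLength
    fun_prop
  have h2 : PolyFun (fun x : Circuit × List Bool => (List.range x.1.numInputs).flatMap
      (fun j => roundGates x.1 x.2 (x.1.numInputs + j * roundLength x.1))) :=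
    flatMap (by fun_prop) (hround.comp (f := fun y : (Circuit × List Bool) × ℕ =>
      (y.1, y.1.1.numInputs + y.2 * roundLength y.1.1)) (by fun_prop))
  have h3 : PolyFun (fun x : Circuit × List Bool =>
      (List.range x.1.numInputs).map (fun j => (⟨fun a b => a && b,
        x.1.numInputs + j * roundLength x.1 + roundLength x.1 - 1,
        x.1.numInputs + x.1.numInputs * roundLength x.1⟩ : Gate))) :=
    map (by fun_prop) (by fun_prop)
  have h4 : PolyFun (fun x : Circuit × List Bool => (List.range x.1.numInputs).map
      (fun j => x.1.numInputs + x.1.numInputs * roundLength x.1 + 1 + x.1.numInputs + j)) :=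
    map (by fun_prop) (by fun_prop)
  have : PolyFun (fun x : Circuit × List Bool => KonigPPP.addressCircuit x.1 x.2) := by
    unfold KonigPPP.addressCircuit
    fun_prop
  exact this.comp (hC.prodMk hr)

/-- The least `i` with `q i`, provided that it is less than `n`. -/
def search (q : ℕ → Bool) (n : ℕ) : ℕ := (fun i => if q i then i else i + 1)^[n] 0

theorem search_inv (q : ℕ → Bool) (n : ℕ) :
    search q n ≤ n ∧ (∀ j < search q n, q j = false) ∧
      (search q n = n ∨ q (search q n) = true) := by
  induction n with
  | zero => simp [search]
  | succ n ih =>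
    obtain ⟨h1, h2, h3⟩ := ih
    have h : search q (n + 1) = if q (search q n) then search q n else search q n + 1 :=
      iterate_succ_apply' _ _ _
    rw [h]
    split_ifs with hq
    · exact ⟨by omega, h2, .inr hq⟩
    · refine ⟨by omega, fun j hj => ?_, .inl (by simpa [hq] using h3)⟩
      rcases Nat.lt_succ_iff_lt_or_eq.1 hj with hj | rfl
      · exact h2 j hj
      · simpa using hq

theorem search_spec {q : ℕ → Bool} {i n : ℕ} (hi : i < n) (hq : q i = true) :
    search q n ≤ i ∧ q (search q n) = true ∧ ∀ j < search q n, q j = false := by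
  obtain ⟨-, h2, h3⟩ := search_inv q n
  have hle : search q n ≤ i := by
    by_contra! h
    simp [h2 i h] at hq
  exact ⟨hle, h3.resolve_left (by omega), h2⟩

theorem PolyFun.search {γ : Type} [Code γ] {q : γ → ℕ → Bool} {n : γ → ℕ} (hn : PolyFun n)
    (hq : PolyFun (fun x : γ × ℕ => q x.1 x.2)) : PolyFun (fun c => search (q c) (n c)) := by
  refine iterate (init := fun _ => 0) (step := fun c i => if q c i then i else i + 1) hn
    (by fun_prop) (by fun_prop) hn.size_le (fun c i hi => ?_)
  have := (search_inv (q c) i).1.trans hi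
  simpa [KonigPPP.search] using this

theorem Circuit.not_avoids_iff {C : Circuit} {r x : List Bool} :
    C.avoids r x = false ↔ ∃ k < C.numInputs, C.parent^[k] x = r := by
  rw [← Bool.not_eq_true, C.avoids_iff]
  push Not
  rfl

theorem Circuit.met_eq_true {C : Circuit} {r x : List Bool} {j : ℕ} :
    C.met r x j = true ↔ ∃ i < j, C.parent^[i] x = r := by
  simp [Circuit.met]

/-- The number of steps from `x` to the root. -/
theorem Circuit.exists_depth {C : Circuit} {r x : List Bool} (h : C.avoids r x = false) :
    ∃ d < C.numInputs, C.parent^[d] x = r ∧ (∀ j < d, C.parent^[j] x ≠ r) ∧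
      C.addressBit r x d = true ∧ (∀ j < d, C.addressBit r x j = C.side (C.parent^[j] x)) ∧
      ∀ j, d < j → C.addressBit r x j = false := by
  have h := Circuit.not_avoids_iff.1 h
  classical
  have hd := (Nat.find_spec h)
  have hmin : ∀ j < Nat.find h, C.parent^[j] x ≠ r := fun j hj he =>
    Nat.find_min h hj ⟨hj.trans hd.1, he⟩
  have hmet : ∀ j ≤ Nat.find h, C.met r x j = false := fun j hj => by
    rw [← Bool.not_eq_true, Circuit.met_eq_true]
    rintro ⟨i, hi, he⟩
    exact hmin i (by omega) he
  refine ⟨Nat.find h, hd.1, hd.2, hmin, ?_, fun j hj => ?_, fun j hj => ?_⟩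
  · simp [Circuit.addressBit, hd.2, hmet _ le_rfl]
  · simp [Circuit.addressBit, hmin j hj, hmet j hj.le]
  · simp [Circuit.addressBit, Circuit.met_eq_true.2 ⟨_, hj, hd.2⟩]

/-- A node that meets `r` first at step `d < n` has a 1 in position `d` of its address. -/
theorem Circuit.avoids_of_address_eq_zero {C : Circuit} (hC : C.outputs.length = C.numInputs + 1)
    {r : List Bool} (hr : r.length = C.numInputs) {x : List Bool} (hx : x.length = C.numInputs)
    (h : (addressCircuit C r).eval x = List.replicate C.numInputs false) :
    C.avoids r x = true := by
  by_contra hav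
  obtain ⟨d, hd, he, -, hbit, -⟩ := Circuit.exists_depth (Bool.not_eq_true _ ▸ hav)
  rw [eval_addressCircuit hC hr hx] at h
  have h := congrArg (fun l => l.getD d false) h
  simp [List.getD_eq_getElem?_getD, hd, hbit] at h
  rw [Circuit.met_eq_true.2 ⟨d, hd, he⟩] at h
  simp at h

/-- Two distinct nodes with the same address have ancestors that are identical children. -/
theorem KonigInstance.identicalChildren_of_address_eq {I : KonigInstance} {a b : List Bool}
    (ha : a.length = I.n) (hb : b.length = I.n) (hab : a ≠ b)
    (h : (addressCircuit I.P I.root).eval a = (addressCircuit I.P I.root).eval b)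
    (hav : I.P.avoids I.root a = false) :
    I.IdenticalChildren
      (I.P.parent^[search (fun i => decide (I.P.parent^[i + 1] a = I.P.parent^[i + 1] b)) I.n] a)
      (I.P.parent^[search (fun i => decide (I.P.parent^[i + 1] a = I.P.parent^[i + 1] b)) I.n] b) := by
  rw [eval_addressCircuit I.hP I.hroot ha, eval_addressCircuit I.hP I.hroot hb] at h
  have hbits : ∀ j < I.n, (I.P.addressBit I.root a j && I.P.met I.root a I.n) =
      (I.P.addressBit I.root b j && I.P.met I.root b I.n) := fun j hj =>
    List.map_inj_left.1 h j (List.mem_range.2 hj)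
  obtain ⟨d, hd, hda, hmin, hbit, hside, hzero⟩ := Circuit.exists_depth hav
  have hmeta : I.P.met I.root a I.n = true := Circuit.met_eq_true.2 ⟨d, hd, hda⟩
  -- The address of `a` has a 1, hence so does that of `b`, which is therefore not erased.
  have hmetb : I.P.met I.root b I.n = true := by
    have := hbits d hd
    rw [hbit, hmeta] at this
    simp only [Bool.and_true] at this
    exact (Bool.and_eq_true_iff.1 this.symm).2
  simp only [hmeta, hmetb, Bool.and_true] at hbits
  obtain ⟨e, he, heb, hminb, hbitb, hsideb, hzerob⟩ :=
    Circuit.exists_depth (Circuit.not_avoids_iff.2 (Circuit.met_eq_true.1 hmetb))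
  -- The position of the last 1 in the address is the depth.
  obtain rfl : d = e := by
    rcases lt_trichotomy d e with hlt | heq | hlt
    · have := hbits e he
      rw [hbitb, hzero e hlt] at this
      cases this
    · exact heq
    · have := hbits d hd
      rw [hbit, hzerob d hlt] at this
      cases this
  have hd0 : d ≠ 0 := by
    rintro rfl
    exact hab (hda.trans heb.symm)
  -- Both paths are at the root after `d` steps, so the search for the first merging finds an index
  -- at most `d - 1`.
  obtain ⟨hle, hq, hlt⟩ := search_spec (i := d - 1) (n := I.n)
    (q := fun i => decide (I.P.parent^[i + 1] a = I.P.parent^[i + 1] b)) (by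
      change d < I.n at hd
      omega) (by
      rw [Nat.sub_add_cancel (by omega)]
      simp [hda, heb])
  generalize search (fun i => decide (I.P.parent^[i + 1] a = I.P.parent^[i + 1] b)) I.n = i at *
  have hid : i < d := by omega
  -- A path that reaches a fixed point other than the root stays there and cannot be at the root
  -- after `d` steps.
  have hself : ∀ x, I.P.parent^[d] x = I.root → I.P.parent^[i] x ≠ I.root →
      I.parent (I.P.parent^[i] x) ≠ I.P.parent^[i] x := by
    intro x hx hne hfix
    have h1 := iterate_fixed (f := I.P.parent) hfix (d - i)
    rw [← iterate_add_apply, Nat.sub_add_cancel hid.le, hx] at h1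
    exact hne h1.symm
  refine ⟨?_, hself a hda (hmin i hid), hself b heb (hminb i hid), ?_, ?_⟩
  -- The ancestors still differ by minimality of `i`; for `i = 0` they are `a` and `b` themselves.
  · cases i with
    | zero => exact hab
    | succ i => exact of_decide_eq_false (hlt i (by omega))
  · have := of_decide_eq_true hq
    rwa [iterate_succ_apply', iterate_succ_apply'] at this
  · have := hbits i (hid.trans hd)
    rwa [hside i hid, hsideb i hid] at this

/-- From a solution of the instance of Collision to a solution of the instance of König. -/
def konigSolution (C : Circuit) (r s : List Bool) : List Bool :=
  if s.headD false then
    if C.avoids r (s.tail.take C.numInputs) then false :: s.tail.take C.numInputs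
    else
      true :: (C.parent^[search (fun i => decide (C.parent^[i + 1] (s.tail.take C.numInputs) =
          C.parent^[i + 1] (s.tail.drop C.numInputs))) C.numInputs] (s.tail.take C.numInputs) ++
        C.parent^[search (fun i => decide (C.parent^[i + 1] (s.tail.take C.numInputs) =
          C.parent^[i + 1] (s.tail.drop C.numInputs))) C.numInputs] (s.tail.drop C.numInputs))
  else s

theorem KonigInstance.length_parent_iterate (I : KonigInstance) {x : List Bool}
    (hx : x.length = I.n) (k : ℕ) : (I.P.parent^[k] x).length = I.n := by
  cases k with
  | zero => exact hx
  | succ k =>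
    rw [iterate_succ_apply']
    exact I.length_parent _

/-- Invalid and non-unique roots are never returned. The argument uses only the first meeting with
`r`, whether or not `r` is a fixed point. -/
theorem konigSolution_spec (I : KonigInstance) {s : List Bool}
    (hs : CollisionInstance.IsSolution ⟨addressCircuit I.P I.root, by simp [addressCircuit]⟩ s) :
    I.IsSolution (konigSolution I.P I.root s) := by
  have hn : (addressCircuit I.P I.root).numInputs = I.n := rfl
  have hn' : I.P.numInputs = I.n := rfl
  rcases hs with ⟨a, ha, rfl, h⟩ | ⟨a, b, ha, hb, rfl, hab, h⟩
  · refine .inl ⟨a, ha, rfl, ?_⟩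
    have := I.farAway_or_longPath_iff a |>.2 (Circuit.avoids_of_address_eq_zero I.hP I.hroot ha h)
    tauto
  · change a.length = I.n at ha
    change b.length = I.n at hb
    simp only [konigSolution, List.headD_cons, if_true, List.tail_cons, hn']
    rw [← ha, List.take_left, List.drop_left, ha]
    cases hav : I.P.avoids I.root a with
    | true =>
      refine .inl ⟨a, ha, rfl, ?_⟩
      have := I.farAway_or_longPath_iff a |>.2 hav
      tauto
    | false =>
      exact .inr ⟨_, _, I.length_parent_iterate ha _, I.length_parent_iterate hb _, rfl,
        KonigInstance.identicalChildren_of_address_eq ha hb hab h hav⟩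

/-- A string that encodes no instance has the empty solution, which the second map returns
regardless; the first map therefore need not treat such strings separately. -/
theorem konig_reducible_collision : Reducible konig collision := by
  refine ⟨fun x => (addressCircuit (parseCircuit x).1 (parseCircuit x).2).enc,
    fun p => if konigValid p.1 then konigSolution (parseCircuit p.1).1 (parseCircuit p.1).2 p.2
      else [], polyTime_iff.2 (by fun_prop), polyTime₂_iff.2 ?_, fun x y hxy => ?_⟩
  · have hs : PolyFun (fun x : (Circuit × List Bool × List Bool) =>
        search (fun i => decide (x.1.parent^[i + 1] x.2.1 = x.1.parent^[i + 1] x.2.2))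
          x.1.numInputs) := .search (by fun_prop) (by fun_prop)
    have : PolyFun (fun x : Circuit × List Bool × List Bool => konigSolution x.1 x.2.1 x.2.2) := by
      have := hs.comp (f := fun x : Circuit × List Bool × List Bool =>
        (x.1, x.2.2.tail.take x.1.numInputs, x.2.2.tail.drop x.1.numInputs)) (by fun_prop)
      unfold konigSolution
      fun_prop
    have := this.comp (f := fun p : List Bool × List Bool =>
      ((parseCircuit p.1).1, (parseCircuit p.1).2, p.2)) (by fun_prop)
    fun_prop
  · dsimp only at hxy ⊢
    cases h : konigValid x with
    | false => exact (konig_of_not_valid h).2 rfl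
    | true =>
      obtain ⟨I, rfl⟩ := konigValid_iff.1 h
      rw [parses_circuit] at hxy ⊢
      rw [if_pos rfl, konig_enc]
      exact konigSolution_spec I ((collision_enc ⟨addressCircuit I.P I.root, _⟩ y).1 hxy)

theorem konig_total (x : List Bool) : ∃ y, konig x y := by
  obtain ⟨f, g, -, -, h⟩ := konig_reducible_collision
  obtain ⟨y, hy⟩ := collision_total (f x)
  exact ⟨_, h x y hy⟩

/-! ### Collision reduces to König -/

/-- Test whether the wires `0, …, m - 1` carry the values `c 0, …, c (m - 1)`; the first gate has
the number `k`. -/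
def eqTest (c : ℕ → Bool) (k m : ℕ) : List Gate := ⟨fun _ _ => true, 0, 0⟩ :: chain c k 0 m

theorem runGates_eqTest {X r vs : List Bool} {k m : ℕ} (hk : vs.length = k) (hX : X.length = m)
    (hr : r.length = m) (h : X <+: vs) :
    ∃ w, w.length = m + 1 ∧ runGates (eqTest (fun i => r.getD i false) k m) vs = vs ++ w ∧
      wire (vs ++ w) (k + m) = decide (X = r) := by
  have hm := h.length_le
  obtain ⟨w, hw, h1, h2⟩ := runGates_chain (fun i => r.getD i false) (k := k) (l := 0) (m := m)
    (vs := vs ++ [true]) (by simp [hk]) (by omega)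
  refine ⟨true :: w, by simp [hw], ?_, ?_⟩
  · rw [eqTest, runGates_cons]
    rw [List.append_assoc] at h1
    exact h1
  · rw [wire_length hk, Bool.true_and] at h2
    rw [List.append_cons, h2, ← eq_iff_all_wire hX hr, Bool.eq_iff_iff, List.all_eq_true,
      List.all_eq_true]
    refine forall₂_congr fun i hi => ?_
    have hi := List.mem_range.1 hi
    rw [zero_add, wire_of_prefix (h.trans (List.prefix_append _ _)) (by omega)]

theorem runGates_map_range {op : Bool → Bool → Bool} {f g : ℕ → ℕ} {n : ℕ} {vs : List Bool}
    (hf : ∀ i < n, f i < vs.length) (hg : ∀ i < n, g i < vs.length) :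
    runGates ((List.range n).map (fun i => ⟨op, f i, g i⟩)) vs =
      vs ++ (List.range n).map (fun i => op (wire vs (f i)) (wire vs (g i))) := by
  rw [runGates_layer, List.map_map]
  · rfl
  · intro e he w
    obtain ⟨i, hi, rfl⟩ := List.mem_map.1 he
    have hi := List.mem_range.1 hi
    simp only [Gate.val]
    rw [wire_append_left (hf i hi), wire_append_left (hg i hi)]

theorem map_range_wire {l : List Bool} {n : ℕ} (h : l.length = n) :
    (List.range n).map (fun i => wire l i) = l :=
  List.ext_getElem (by simp [h]) fun i h1 h2 => by
    simp [wire, List.getD_eq_getElem?_getD, h2]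

/-- The root of the tree: the string `0ⁿ1`. -/
def treeRoot (n : ℕ) : List Bool := List.replicate n false ++ [true]

theorem length_treeRoot (n : ℕ) : (treeRoot n).length = n + 1 := by simp [treeRoot]

/-- A binary tree with the nodes `{0,1}ⁿ⁺¹`, numbered as in a heap with the root `0ⁿ1`. The place
of the node `1c` is that of the leaf `1C(c)`, and the place of the node `0ⁿ⁺¹` is that of the leaf
`10ⁿ`. -/
def treeCircuit (C : Circuit) : Circuit where
  numInputs := C.numInputs + 1
  gates := C.gates.map (fun g => g.shift 1) ++
    eqTest (fun i => (List.replicate (C.numInputs + 1) false).getD i false)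
      (1 + C.numInputs + C.gates.length) (C.numInputs + 1) ++
    eqTest (fun i => (treeRoot C.numInputs).getD i false)
      (2 * C.numInputs + C.gates.length + 3) (C.numInputs + 1) ++
    C.outputs.map (copyGate (C.numInputs + C.gates.length) 1) ++
    (List.range C.numInputs).map (fun i => ⟨fun a b => a && b, 0,
      3 * C.numInputs + C.gates.length + 5 + i⟩) ++
    (List.range C.numInputs).map (fun i => ⟨fun a b => !a && b, 0, 1 + i⟩) ++
    [⟨fun _ _ => false, 0, 0⟩, ⟨fun a b => a || b, 0,
      1 + C.numInputs + C.gates.length + (C.numInputs + 1)⟩] ++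
    (List.range C.numInputs).map (fun i => ⟨fun a b => a || b,
      4 * C.numInputs + C.gates.length + 5 + i, 5 * C.numInputs + C.gates.length + 5 + i⟩) ++
    [⟨fun a b => a || b, 6 * C.numInputs + C.gates.length + 5 + C.numInputs,
      2 * C.numInputs + C.gates.length + 3 + (C.numInputs + 1)⟩]
  outputs := (List.range C.numInputs).map (fun i => 6 * C.numInputs + C.gates.length + 5 + i) ++
    [6 * C.numInputs + C.gates.length + 5 + (C.numInputs + 2),
      6 * C.numInputs + C.gates.length + 5 + (C.numInputs + 1)]

/-- The place of a node, preceded by a zero. -/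
def place (C : Circuit) (s : Bool) (c : List Bool) : List Bool :=
  false :: (s || decide (s :: c = List.replicate (C.numInputs + 1) false)) ::
    (if s then C.eval c else c)

theorem length_place {C : Circuit} (hC : C.outputs.length = C.numInputs) {s : Bool} {c : List Bool}
    (hc : c.length = C.numInputs) : (place C s c).length = C.numInputs + 2 := by
  cases s <;> simp [place, C.length_eval, hC, hc]

/-- The `n + 2` wires of the place start at `6 * n + G + 5`, where `G` is the number of gates of
`C`. They give the parent followed by the side, except that the last bit of the parent is joined
with the test for the root; this turns the parent 0ⁿ⁺¹ that the shift assigns to 0ⁿ1 into 0ⁿ1. -/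
theorem eval_treeCircuit {C : Circuit} (hC : C.outputs.length = C.numInputs) {s : Bool}
    {c : List Bool} (hc : c.length = C.numInputs) :
    (treeCircuit C).eval (s :: c) = (List.range C.numInputs).map (wire (place C s c)) ++
      [wire (place C s c) C.numInputs || decide (s :: c = treeRoot C.numInputs),
        wire (place C s c) (C.numInputs + 1)] := by
  set n := C.numInputs with hn
  set G := C.gates.length with hG
  have hpl : (place C s c).length = n + 2 := length_place hC hc
  have hY : (C.wires c).length = n + G := by rw [C.wires_eq, length_runGates, hc]
  have hpre : s :: c <+: [s] ++ C.wires c := by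
    rw [List.singleton_append, List.cons_prefix_cons]
    exact ⟨rfl, subset_runGates _ _⟩
  set V₁ := [s] ++ C.wires c with hV₁
  have hl₁ : V₁.length = 1 + n + G := by simp [hV₁, hY]; omega
  obtain ⟨w₂, hw₂, h₂, hz⟩ := runGates_eqTest (r := List.replicate (n + 1) false) hl₁
    (by simp [hc] : (s :: c).length = n + 1) (by simp) hpre
  set V₂ := V₁ ++ w₂ with hV₂
  have hl₂ : V₂.length = 2 * n + G + 3 := by simp [hV₂, hl₁, hw₂]; omega
  obtain ⟨w₃, hw₃, h₃, hroot⟩ := runGates_eqTest (r := treeRoot n) hl₂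
    (by simp [hc] : (s :: c).length = n + 1) (length_treeRoot n)
    (hpre.trans (List.prefix_append _ _))
  set V₃ := V₂ ++ w₃ with hV₃
  have hl₃ : V₃.length = 3 * n + G + 5 := by simp [hV₃, hl₂, hw₃]; omega
  have hs : ∀ t, wire (V₃ ++ t) 0 = s := fun t => by
    rw [hV₃, hV₂, hV₁]; rfl
  have hcw : ∀ t, ∀ i < n, wire (V₃ ++ t) (1 + i) = wire c i := fun t i hi => by
    have h : s :: c <+: V₃ ++ t := hpre.trans (by
      rw [hV₃, hV₂, List.append_assoc, List.append_assoc]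
      exact List.prefix_append _ _)
    rw [wire_of_prefix h (by simp [hc]; omega), add_comm]
    rfl
  have hzt : ∀ t, wire (V₃ ++ t) (1 + n + G + (n + 1)) =
      decide (s :: c = List.replicate (n + 1) false) := fun t => by
    rw [hV₃, List.append_assoc, wire_append_left (by omega), hz]
  have hrt : ∀ t, wire (V₃ ++ t) (2 * n + G + 3 + (n + 1)) = decide (s :: c = treeRoot n) :=
    fun t => by rw [wire_append_left (by omega), hroot]
  have h₄ : runGates (C.outputs.map (copyGate (n + G) 1)) V₃ = V₃ ++ C.eval c := by
    have := runGates_copyGate (pre := [s]) (w := w₂ ++ w₃) rfl hY C.outputs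
    rwa [← List.append_assoc, ← hV₁, ← hV₂, ← hV₃] at this
  have hle : (C.eval c).length = n := by rw [C.length_eval, hC]
  -- `A` and `B` form a multiplexer: the one not selected by `s` is zero, so their bitwise
  -- disjunction is `C(c)` for a leaf and `c` otherwise.
  set A := (List.range n).map (fun i => s && wire (C.eval c) i) with hA
  have h₅ : runGates ((List.range n).map (fun i => ⟨fun a b => a && b, 0, 3 * n + G + 5 + i⟩))
      (V₃ ++ C.eval c) = V₃ ++ (C.eval c ++ A) := by
    rw [runGates_map_range (by simp [hl₃]) (by simp [hl₃, hle]), List.append_assoc]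
    simp only [hs, wire_append_right hl₃, hA]
  set B := (List.range n).map (fun i => !s && wire c i) with hB
  have h₆ : runGates ((List.range n).map (fun i => ⟨fun a b => !a && b, 0, 1 + i⟩))
      (V₃ ++ (C.eval c ++ A)) = V₃ ++ (C.eval c ++ A ++ B) := by
    rw [runGates_map_range (by simp [hl₃]) (by simp [hl₃]; omega), List.append_assoc]
    simp only [List.append_assoc, hB]
    refine congrArg (fun l => V₃ ++ (C.eval c ++ (A ++ l))) (List.map_congr_left fun i hi => ?_)
    rw [hs, hcw _ i (List.mem_range.1 hi)]
  have hl₆ : (V₃ ++ (C.eval c ++ A ++ B)).length = 6 * n + G + 5 := by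
    simp [hl₃, hle, hA, hB]; omega
  have h₇ : runGates [⟨fun _ _ => false, 0, 0⟩, ⟨fun a b => a || b, 0, 1 + n + G + (n + 1)⟩]
      (V₃ ++ (C.eval c ++ A ++ B)) = V₃ ++ (C.eval c ++ A ++ B) ++
        [false, s || decide (s :: c = List.replicate (n + 1) false)] := by
    simp only [runGates_cons, runGates_nil, Gate.val, List.append_assoc, hs, hzt]
    rfl
  have h₈ : runGates ((List.range n).map (fun i => ⟨fun a b => a || b, 4 * n + G + 5 + i,
      5 * n + G + 5 + i⟩)) (V₃ ++ (C.eval c ++ A ++ B) ++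
        [false, s || decide (s :: c = List.replicate (n + 1) false)]) =
        V₃ ++ (C.eval c ++ A ++ B) ++ place C s c := by
    rw [runGates_map_range (by simp only [List.length_append, hl₆]; omega)
      (by simp only [List.length_append, hl₆]; omega)]
    rw [place, List.append_assoc]
    refine congrArg (fun l => V₃ ++ (C.eval c ++ A ++ B) ++
      ([false, s || decide (s :: c = List.replicate (n + 1) false)] ++ l)) ?_
    have hAl : A.length = n := by simp [hA]
    have hBl : B.length = n := by simp [hB]
    have : ∀ i < n, (wire (V₃ ++ (C.eval c ++ A ++ B) ++
        [false, s || decide (s :: c = List.replicate (n + 1) false)]) (4 * n + G + 5 + i) ||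
        wire (V₃ ++ (C.eval c ++ A ++ B) ++
        [false, s || decide (s :: c = List.replicate (n + 1) false)]) (5 * n + G + 5 + i)) =
        wire (if s then C.eval c else c) i := by
      intro i hi
      rw [wire_append_left (a := V₃ ++ (C.eval c ++ A ++ B)) (by omega),
        wire_append_left (a := V₃ ++ (C.eval c ++ A ++ B)) (by omega)]
      have hA' : wire (V₃ ++ (C.eval c ++ A ++ B)) (4 * n + G + 5 + i) = wire A i := by
        rw [← List.append_assoc, ← List.append_assoc,
          wire_append_left (by simp [hl₃, hle, hAl]; omega),
          wire_append_right (by simp [hl₃, hle]; omega)]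
      have hB' : wire (V₃ ++ (C.eval c ++ A ++ B)) (5 * n + G + 5 + i) = wire B i := by
        rw [← List.append_assoc, wire_append_right (by simp [hl₃, hle, hAl]; omega)]
      have hAi : wire A i = (s && wire (C.eval c) i) := by
        simp [hA, wire, List.getD_eq_getElem?_getD, hi]
      have hBi : wire B i = (!s && wire c i) := by
        simp [hB, wire, List.getD_eq_getElem?_getD, hi]
      rw [hA', hB', hAi, hBi]
      cases s <;> simp
    rw [List.map_congr_left fun i hi => this i (List.mem_range.1 hi)]
    exact map_range_wire (by cases s <;> simp [hle, hc])
  -- The last wire is bit `n` of the place, corrected at the root; the outputs use it instead of the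
  -- uncorrected bit.
  have hwires : (treeCircuit C).wires (s :: c) = V₃ ++ (C.eval c ++ A ++ B) ++ (place C s c ++
      [wire (place C s c) n || decide (s :: c = treeRoot n)]) := by
    rw [Circuit.wires_eq, treeCircuit]
    dsimp only
    rw [← hn, ← hG]
    simp only [runGates_append]
    have h₁ : runGates (C.gates.map (fun g => g.shift 1)) (s :: c) = V₁ :=
      runGates_shift (pre := [s]) C.gates rfl c
    rw [h₁, h₂, h₃,
      h₄, h₅, h₆, h₇, h₈, runGates_cons, runGates_nil]
    simp only [Gate.val]
    rw [wire_append_right hl₆, List.append_assoc V₃ _ (place C s c), hrt]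
    simp only [List.append_assoc]
  rw [Circuit.eval, hwires]
  simp only [treeCircuit, ← hn, ← hG, List.map_append, List.map_map, List.map_cons, List.map_nil,
    wire_append_right hl₆]
  congr 1
  · refine List.map_congr_left fun i hi => ?_
    have hi := List.mem_range.1 hi
    rw [comp_apply, wire_append_right hl₆, wire_append_left (by omega)]
  · rw [wire_length hpl, wire_append_left (by omega)]

theorem length_outputs_treeCircuit (C : Circuit) :
    (treeCircuit C).outputs.length = (treeCircuit C).numInputs + 1 := by
  simp [treeCircuit]

/-- The instance of König that belongs to an instance of Collision. -/
def CollisionInstance.tree (I : CollisionInstance) : KonigInstance :=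
  ⟨treeCircuit I.C, treeRoot I.C.numInputs, length_outputs_treeCircuit I.C,
    length_treeRoot I.C.numInputs⟩

/-! ### Paths and children in the heap-shaped tree -/

namespace CollisionInstance

variable {I : CollisionInstance}

theorem tree_n (I : CollisionInstance) : I.tree.n = I.C.numInputs + 1 := rfl

theorem eval_tree {s : Bool} {c : List Bool} (hc : c.length = I.C.numInputs)
    (h : s :: c ≠ treeRoot I.C.numInputs) : I.tree.P.eval (s :: c) = place I.C s c := by
  refine (eval_treeCircuit I.hC hc).trans ?_
  have h' : I.C.numInputs + 2 = (place I.C s c).length := (length_place I.hC hc).symm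
  conv_rhs => rw [← map_range_wire h'.symm, List.range_succ, List.range_succ]
  simp [h]

theorem parent_tree {s : Bool} {c : List Bool} (hc : c.length = I.C.numInputs)
    (h : s :: c ≠ treeRoot I.C.numInputs) :
    I.tree.parent (s :: c) = (place I.C s c).take (I.C.numInputs + 1) := by
  rw [KonigInstance.parent, eval_tree hc h, tree_n]

theorem side_tree {s : Bool} {c : List Bool} (hc : c.length = I.C.numInputs)
    (h : s :: c ≠ treeRoot I.C.numInputs) :
    I.tree.side (s :: c) = (place I.C s c).getD (I.C.numInputs + 1) false := by
  rw [KonigInstance.side, eval_tree hc h, tree_n]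

/-- The shift sends 0ⁿ1 to 0ⁿ⁺¹, and the correction by the root test restores the final 1. -/
theorem parent_treeRoot (hn : I.C.numInputs ≠ 0) :
    I.tree.parent (treeRoot I.C.numInputs) = treeRoot I.C.numInputs := by
  obtain ⟨m, hm⟩ := Nat.exists_eq_succ_of_ne_zero hn
  have h0 : treeRoot I.C.numInputs = false :: treeRoot m := by rw [hm]; rfl
  have hc : (treeRoot m).length = I.C.numInputs := by rw [length_treeRoot, hm]
  have hne : false :: treeRoot m ≠ List.replicate (m.succ + 1) false := by
    intro h
    have : true ∈ List.replicate (m.succ + 1) false := by rw [← h]; simp [treeRoot]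
    simp at this
  have hp : place I.C false (treeRoot m) = false :: false :: treeRoot m := by
    simp [place, hm, hne]
  have := eval_treeCircuit I.hC (s := false) hc
  rw [hp, hm] at this
  change ((treeCircuit I.C).eval (treeRoot I.C.numInputs)).take (I.C.numInputs + 1) = _
  have hr : (List.range m.succ).map (wire (false :: false :: treeRoot m)) =
      List.replicate m.succ false := by
    refine List.eq_replicate_iff.2 ⟨by simp, fun b hb => ?_⟩
    obtain ⟨i, hi, rfl⟩ := List.mem_map.1 hb
    have hi := List.mem_range.1 hi
    rcases i with _ | _ | i
    · rfl
    · rfl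
    · change wire (treeRoot m) i = false
      rw [treeRoot, wire_append_left (by simp; omega)]
      have : i < m := by omega
      simp [wire, List.getD_eq_getElem?_getD, this]
  rw [h0, this, hr, hm]
  have h1 : (false :: treeRoot m) = treeRoot m.succ := rfl
  rw [h1, treeRoot]
  simp [List.take_append]

theorem parent_tree_place {s : Bool} {c : List Bool} {m : ℕ} (hm : I.C.numInputs = m + 1)
    (hc : c.length = I.C.numInputs) (h : s :: c ≠ treeRoot I.C.numInputs) :
    I.tree.parent (s :: c) =
      false :: (s || decide (s :: c = List.replicate (I.C.numInputs + 1) false)) ::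
        (if s then I.C.eval c else c).take m := by
  rw [parent_tree hc h, hm, place, List.take_succ_cons, List.take_succ_cons, hm]

theorem _root_.KonigPPP.eq_replicate_or_exists (l : List Bool) :
    l = List.replicate l.length false ∨
      ∃ a w, l = List.replicate a false ++ true :: w := by
  induction l with
  | nil => exact .inl rfl
  | cons b l ih =>
    cases b with
    | true => exact .inr ⟨0, l, rfl⟩
    | false =>
      rcases ih with h | ⟨a, w, h⟩
      · exact .inl (by rw [List.length_cons, List.replicate_succ, ← h])
      · exact .inr ⟨a + 1, w, by rw [h]; rfl⟩

/-- Each step prepends a zero and drops the last bit of `w`; after `k` steps `w` is used up and 0ⁿ1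
remains. -/
theorem parent_iterate_heap (hn : I.C.numInputs ≠ 0) (k a : ℕ) (w : List Bool)
    (hw : w.length = k) (ha : a + 1 + k = I.C.numInputs) :
    I.tree.parent^[k] (List.replicate (a + 1) false ++ true :: w) =
      treeRoot I.C.numInputs := by
  obtain ⟨m, hm⟩ := Nat.exists_eq_succ_of_ne_zero hn
  induction k generalizing a w with
  | zero =>
    obtain rfl := List.eq_nil_of_length_eq_zero hw
    rw [← ha]
    rfl
  | succ k ih =>
    have hl : (List.replicate a false ++ true :: w).length = I.C.numInputs := by
      simp; omega
    have htrue : true ∈ List.replicate (a + 1) false ++ true :: w := by simp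
    have h0 : List.replicate (a + 1) false ++ true :: w ≠
        List.replicate (I.C.numInputs + 1) false := by
      intro h
      rw [h] at htrue
      simp at htrue
    -- Position `a + 1` is less than `n`, so it carries 0 in the root but 1 in this node.
    have hroot : List.replicate (a + 1) false ++ true :: w ≠ treeRoot I.C.numInputs := by
      intro h
      have := congrArg (fun l => l.getD (a + 1) false) h
      rw [List.getD_append_right _ _ _ _ (by simp), treeRoot,
        List.getD_append _ _ _ _ (by simp; omega)] at this
      simp [List.getD_eq_getElem?_getD, List.getElem?_replicate] at this
      split at this <;> simp at this
    rw [iterate_succ_apply, List.replicate_succ, List.cons_append, parent_tree_place hm hl hroot]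
    have : decide (false :: (List.replicate a false ++ true :: w) =
        List.replicate (I.C.numInputs + 1) false) = false := decide_eq_false h0
    rw [this]
    have hd : (List.replicate a false ++ true :: w).take m =
        List.replicate a false ++ true :: w.take k := by
      rw [List.take_append, List.take_of_length_le (by simp; omega)]
      have : m - (List.replicate a false).length = k + 1 := by simp; omega
      rw [this, List.take_succ_cons]
    have e : false :: (false || false) :: (if (false : Bool) = true then
        I.C.eval (List.replicate a false ++ true :: w) else
          List.replicate a false ++ true :: w).take m =
        List.replicate (a + 1 + 1) false ++ true :: w.take k := by
      rw [if_neg (by simp), hd]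
      rfl
    rw [e]
    exact ih (a + 1) _ (by simp; omega) (by omega)

/-- The heap has depth `n`, whereas nodes have `n + 1` bits. This surplus bit is what rules out long
paths. -/
theorem exists_parent_iterate_eq_treeRoot (hn : I.C.numInputs ≠ 0) {x : List Bool}
    (hx : x.length = I.C.numInputs + 1) :
    ∃ k < I.C.numInputs + 1, I.tree.parent^[k] x = treeRoot I.C.numInputs := by
  obtain ⟨m, hm⟩ := Nat.exists_eq_succ_of_ne_zero hn
  by_cases hroot : x = treeRoot I.C.numInputs
  · exact ⟨0, by omega, hroot⟩
  obtain ⟨s, c, rfl⟩ : ∃ s c, x = s :: c := List.exists_cons_of_length_eq_add_one hx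
  have hc : c.length = I.C.numInputs := by simpa using hx
  -- For a leaf or the zero string one step leads to a node 01w with `w` of length `n - 1`, from
  -- which the root is `n - 1` steps away.
  have hleaf : (s || decide (s :: c = List.replicate (I.C.numInputs + 1) false)) = true →
      ∃ k < I.C.numInputs + 1, I.tree.parent^[k] (s :: c) = treeRoot I.C.numInputs := by
    intro h
    refine ⟨m + 1, by omega, ?_⟩
    rw [iterate_succ_apply, parent_tree_place hm hc hroot, h]
    refine parent_iterate_heap hn m 0 _ ?_ (by omega)
    cases s <;> simp [I.C.length_eval, I.hC, hc, hm]
  rcases eq_replicate_or_exists (s :: c) with h | ⟨a, w, h⟩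
  · exact hleaf (by rw [hx] at h; simp [h])
  · cases a with
    | zero =>
      obtain ⟨rfl, -⟩ : s = true ∧ c = w := by simpa using h
      exact hleaf rfl
    | succ a =>
      have := congrArg List.length h
      simp only [List.length_append, List.length_replicate, List.length_cons] at this
      refine ⟨w.length, by omega, ?_⟩
      rw [h]
      exact parent_iterate_heap hn _ a w rfl (by omega)

/-- Identical children in the tree occupy the same place. -/
theorem place_eq_of_identicalChildren (hn : I.C.numInputs ≠ 0) {s t : Bool} {a b : List Bool}
    (ha : a.length = I.C.numInputs) (hb : b.length = I.C.numInputs)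
    (h : I.tree.IdenticalChildren (s :: a) (t :: b)) : place I.C s a = place I.C t b := by
  obtain ⟨-, h1, h2, h3, h4⟩ := h
  -- The root is its own parent and hence no child, so parent and side of both nodes are read off
  -- their places without correction.
  have hra : s :: a ≠ treeRoot I.C.numInputs := by
    intro h
    rw [h] at h1
    exact h1 (parent_treeRoot hn)
  have hrb : t :: b ≠ treeRoot I.C.numInputs := by
    intro h
    rw [h] at h2
    exact h2 (parent_treeRoot hn)
  rw [parent_tree ha hra, parent_tree hb hrb] at h3
  rw [side_tree ha hra, side_tree hb hrb] at h4
  have key : ∀ l : List Bool, l.length = I.C.numInputs + 2 →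
      l = l.take (I.C.numInputs + 1) ++ [l.getD (I.C.numInputs + 1) false] := by
    intro l hl
    conv_lhs => rw [← List.take_append_drop (I.C.numInputs + 1) l]
    rw [List.drop_eq_getElem_cons (by omega), List.drop_of_length_le (by omega)]
    simp [List.getD_eq_getElem?_getD, hl]
  rw [key _ (length_place I.hC ha), key _ (length_place I.hC hb), h3, h4]

end CollisionInstance

/-- From a solution of the instance of König to a solution of the instance of Collision. -/
def collisionSolution (n : ℕ) (y : List Bool) : List Bool :=
  if decide (n = 0) then [false]
  else if y.tail.headD false then
    if (y.tail.drop (n + 1)).headD false then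
      true :: ((y.tail.take (n + 1)).tail ++ (y.tail.drop (n + 1)).tail)
    else false :: (y.tail.take (n + 1)).tail
  else false :: (y.tail.drop (n + 1)).tail

/-- The second bit of a place separates inner nodes from leaves and the zero string. Distinct inner
nodes have distinct places, so every coincidence of places involves a leaf. -/
theorem collisionSolution_spec (I : CollisionInstance) {y : List Bool}
    (hy : I.tree.IsSolution y) : I.IsSolution (collisionSolution I.C.numInputs y) := by
  by_cases hn : I.C.numInputs = 0
  · refine .inl ⟨[], hn.symm, by simp [collisionSolution, hn], ?_⟩
    refine List.eq_replicate_iff.2 ⟨(I.C.length_eval _).trans I.hC, fun b hb => ?_⟩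
    have := List.length_pos_of_mem hb
    rw [I.C.length_eval, I.hC, hn] at this
    simp at this
  rcases hy with ⟨x, hx, rfl, h⟩ | ⟨x, z, hx, hz, rfl, h⟩
  -- Every node reaches the root in fewer than `n + 1` steps and the root is fixed, so no solution
  -- consists of a single node.
  · exfalso
    obtain ⟨k, hk, hroot⟩ := I.exists_parent_iterate_eq_treeRoot hn hx
    rcases h with ⟨h, h'⟩ | ⟨h, h'⟩ | h | h
    · rw [h] at h'
      exact h' (I.parent_treeRoot hn)
    · rw [iterate_fixed h'] at hroot
      exact h hroot
    · exact h k hk.le hroot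
    · exact h.2 k hk hroot
  · obtain ⟨s, a, rfl⟩ : ∃ s a, x = s :: a := List.exists_cons_of_length_eq_add_one hx
    obtain ⟨t, b, rfl⟩ : ∃ t b, z = t :: b := List.exists_cons_of_length_eq_add_one hz
    have ha : a.length = I.C.numInputs := Nat.succ_injective hx
    have hb : b.length = I.C.numInputs := Nat.succ_injective hz
    have hp := I.place_eq_of_identicalChildren hn ha hb h
    have hne := h.1
    have e1 : (s :: a ++ t :: b).take (I.C.numInputs + 1) = s :: a := List.take_left' hx
    have e2 : (s :: a ++ t :: b).drop (I.C.numInputs + 1) = t :: b := List.drop_left' hx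
    simp only [collisionSolution, hn, decide_false, Bool.false_eq_true, if_false, List.tail_cons, e1,
      e2]
    simp only [place, List.cons.injEq, true_and] at hp
    obtain ⟨hp1, hp2⟩ := hp
    have hrep : ∀ {c : List Bool}, false :: c = List.replicate (I.C.numInputs + 1) false →
        c = List.replicate I.C.numInputs false := fun h => (List.cons.inj h).2
    -- If exactly one node is a leaf, equality of the second bits forces the other to be 0ⁿ⁺¹, and
    -- the rest of the place gives a preimage of 0ⁿ. Two leaves give a collision.
    cases s <;> cases t
    · exact absurd (by simpa using hp2) (fun h : a = b => hne (by rw [h]))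
    · simp only [Bool.false_or, Bool.true_or, decide_eq_true_eq] at hp1
      refine .inl ⟨b, hb, by simp, ?_⟩
      rw [← hrep hp1]
      simpa using hp2.symm
    · simp only [Bool.false_or, Bool.true_or] at hp1
      refine .inl ⟨a, ha, by simp, ?_⟩
      rw [← hrep (of_decide_eq_true hp1.symm)]
      simpa using hp2
    · exact .inr ⟨a, b, ha, hb, by simp, fun h => hne (by rw [h]), by simpa using hp2⟩

/-! ### Polynomial time of the reduction from Collision -/

namespace PolyFun

theorem treeRoot : PolyFun treeRoot := by
  have : PolyFun (fun n => (List.range n).map (fun _ => false) ++ [true]) :=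
    append (map (by fun_prop) (by fun_prop)) (const _)
  exact this.congr fun n => by simp [KonigPPP.treeRoot]

theorem replicate_false : PolyFun (fun n : ℕ => List.replicate n false) := by
  have : PolyFun (fun n => (List.range n).map (fun _ => false)) :=
    map (by fun_prop) (by fun_prop)
  simpa using this

theorem treeCircuit : PolyFun treeCircuit := by
  have htest : PolyFun (fun x : List Bool × ℕ × ℕ =>
      eqTest (fun i => x.1.getD i false) x.2.1 x.2.2) := by
    have : PolyFun (fun x : List Bool × ℕ × ℕ => chain (fun i => x.1.getD i false) x.2.1 0 x.2.2) :=
      map (by fun_prop) (by fun_prop)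
    unfold eqTest
    fun_prop
  have hzero : PolyFun (fun C : Circuit => List.replicate (C.numInputs + 1) false) :=
    replicate_false.comp (by fun_prop)
  have hroot : PolyFun (fun C : Circuit => KonigPPP.treeRoot C.numInputs) :=
    treeRoot.comp (by fun_prop)
  have h1 : PolyFun (fun C : Circuit => C.gates.map (fun g => g.shift 1)) :=
    map (by fun_prop) (by fun_prop)
  have h2 := htest.comp (f := fun C : Circuit => (List.replicate (C.numInputs + 1) false,
    1 + C.numInputs + C.gates.length, C.numInputs + 1)) (by fun_prop)
  have h3 := htest.comp (f := fun C : Circuit => (KonigPPP.treeRoot C.numInputs,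
    2 * C.numInputs + C.gates.length + 3, C.numInputs + 1)) (by fun_prop)
  have h4 : PolyFun (fun C : Circuit =>
      C.outputs.map (KonigPPP.copyGate (C.numInputs + C.gates.length) 1)) :=
    map (by fun_prop) (by fun_prop)
  have hlayer : ∀ (op : Bool → Bool → Bool) (f g : Circuit × ℕ → ℕ), PolyFun f → PolyFun g →
      PolyFun (fun C : Circuit => (List.range C.numInputs).map (fun i =>
        (⟨op, f (C, i), g (C, i)⟩ : Gate))) := fun op f g hf hg =>
    map (by fun_prop) (by fun_prop)
  have h5 := hlayer (fun a b => a && b) (fun _ => 0)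
    (fun x => 3 * x.1.numInputs + x.1.gates.length + 5 + x.2) (by fun_prop) (by fun_prop)
  have h6 := hlayer (fun a b => !a && b) (fun _ => 0) (fun x => 1 + x.2) (by fun_prop) (by fun_prop)
  have h7 := hlayer (fun a b => a || b) (fun x => 4 * x.1.numInputs + x.1.gates.length + 5 + x.2)
    (fun x => 5 * x.1.numInputs + x.1.gates.length + 5 + x.2) (by fun_prop) (by fun_prop)
  have h8 : PolyFun (fun C : Circuit =>
      (List.range C.numInputs).map (fun i => 6 * C.numInputs + C.gates.length + 5 + i)) :=
    map (by fun_prop) (by fun_prop)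
  unfold KonigPPP.treeCircuit
  fun_prop

end PolyFun

theorem collision_reducible_konig : Reducible collision konig := by
  refine ⟨fun x => (treeCircuit (parseCircuit x).1).enc ++
      treeRoot (parseCircuit x).1.numInputs,
    fun p => if collisionValid p.1 then collisionSolution (parseCircuit p.1).1.numInputs p.2
      else [], polyTime_iff.2 ?_, polyTime₂_iff.2 ?_, fun x y hxy => ?_⟩
  · have h1 : PolyFun (fun x => treeCircuit (parseCircuit x).1) :=
      PolyFun.treeCircuit.comp (by fun_prop)
    have h2 : PolyFun (fun x => treeRoot (parseCircuit x).1.numInputs) :=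
      PolyFun.treeRoot.comp (by fun_prop)
    fun_prop
  · unfold collisionSolution
    fun_prop
  · dsimp only at hxy ⊢
    cases h : collisionValid x with
    | false => exact (collision_of_not_valid h).2 rfl
    | true =>
      obtain ⟨I, rfl⟩ := collisionValid_iff.1 h
      have hI := parses_circuit I.C []
      rw [List.append_nil] at hI
      rw [hI] at hxy ⊢
      rw [if_pos rfl, collision_enc]
      exact collisionSolution_spec I ((konig_enc I.tree y).1 hxy)

end KonigPPP

theorem theorem8 : KonigPPP.PPPComplete KonigPPP.konig :=
  ⟨⟨KonigPPP.konig_inTFNP KonigPPP.konig_total, KonigPPP.konig_reducible_collision⟩,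
    fun _ h => h.2.trans KonigPPP.collision_reducible_konig⟩
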